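/- **Setting.** Let $\mathcal S,\mathcal Z,\mathcal A$ be compact subsets of Euclidean spaces and consider the CMDP with augmented states $x=(s,z)\in\mathcal S\times\mathcal Z$, actions $a\in\mathcal A$, transition law $P_{\rm T}(s',z'\mid s,z,a)=P^{z}(s'\mid s,a)\,P_{\rm shift}(z'\mid z)$, costs $C'_k(s,a)$ and reshaped costs $\dot C'_k(x,a,x')=C'_k(s,a)+V_k(x')-V_k(x)$, $k=0,\dots,K$, with fixed potentials $V_k$. Policies $\pi_\theta(a\mid x)$, $\theta\in\Theta\subset\mathbb R^{n}$, have positive densities with respect to a fixed reference measure on $\mathcal A$. Let $\dot f_k(\theta)=\lim_{T\to\infty}\frac1T\mathbb E_{\pi_\theta}\sum_{t<T}\dot C'_k(x_t,a_t,x_{t+1})$; gradients in $\theta$ are taken within $\Theta$. **Assumption 1.** $\dot C'_k$ is bounded; $\Theta$ is compact and convex with nonempty interior; $\theta\mapsto\log\pi_\theta(a\mid x)$ is differentiable and Lipschitz on $\Theta$ with Lipschitz gradient, uniformly in $(x,a)$; $\dot f_k$ is differentiable on $\Theta$ with bounded Lipschitz gradient; there are $\lambda>0$, $\rho\in(0,1)$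 such that for every $\theta\in\Theta$ the state chain under $\pi_\theta$ has a stationary law $\mathbf P_{\pi_\theta}$ with $\sup_x d_{\rm TV}(P(x_t\in\cdot\mid x_0=x),\mathbf P_{\pi_\theta})\le\lambda\rho^t$ for all $t\ge0$, where $d_{\rm TV}(\alpha,\beta)=\int|\alpha(\mathrm dx)-\beta(\mathrm dx)|$. **Assumption 2.** The step sizes $\mu_i\in(0,1]$ and $\eta_i>0$ are deterministic and non-increasing, $\mu_i\to0$, $\sum\mu_i=\infty$, $\sum\mu_i^2<\infty$, $\eta_i\to0$, $1/\eta_i=O(i^{\varrho})$ for some $\varrho\in(0,1)$, $\sum\eta_i^2<\infty$, $\mu_i/\eta_i\to0$. **Algorithm.** Iteration $i$ uses the batch $\varepsilon_i$ of $B\ge 1$ consecutive time slots $t=Bi,\dots,Bi+B-1$ of one trajectory, in which, given the past, $a_t\sim\pi_{\theta_i}(\cdot\mid x_t)$ and $x_{t+1}\sim P_{\rm T}(\cdot\mid x_t,a_t)$. With $\hat{\mathbb E}_{\varepsilon_i}$ the batch average, $$\hat f_{k,i+1}=(1-\eta_{i+1})\hat f_{k,i}+\eta_i\hat{\mathbb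 E}_{\varepsilon_i}[\dot C'_k],\qquad \hat g_{k,i+1}=(1-\eta_{i+1})\hat g_{k,i}+\eta_i\hat{\mathbb E}_{\varepsilon_i}[Q_{\omega_{k,i}}(x,a)\nabla_\theta\log\pi_{\theta_i}(a\mid x)],$$ $$\theta_{i+1}=(1-\mu_i)\theta_i+\mu_i\bar\theta_i,\qquad \theta_0\in\Theta,\ \bar\theta_i\in\Theta .$$ The actor targets $\bar\theta_i$ and the Q-network weights $\omega_{k,i}$ are arbitrary random variables determined by the information available at the end of iteration $i$; the initial estimates and the outputs of the Q-networks along the run are bounded by a constant $b$. The surrogate Q-function is $$\hat Q_{k,i}(x,a)=\mathbb E_{\pi_{\theta_i}}\Bigl[\sum_{l=0}^{T_i-1}\bigl(\dot C'_{k,l}-\hat f_{k,i}\bigr)\Bigm| x_0=x,\,a_0=a\Bigr]$$ (expectation with $\theta_i,\hat f_{k,i}$ frozen), where the deterministic horizons $T_i$ are any with $\rho^{T_i}=O(\eta_{i+1})$. Put $$\epsilon_f(i)=\frac1{1+i}\sum_{i'=0}^i\mathbb E\bigl[(\hat f_{k,i'}-\dot f_k(\theta_{i'}))^2\bigr],\qquad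 \epsilon_g(i)=\frac1{1+i}\sum_{i'=0}^i\mathbb E\bigl[\|\hat g_{k,i'}-\nabla\dot f_k(\theta_{i'})\|_2^2\bigr],$$ $$\epsilon_Q(i)=\frac1{1+i}\sum_{i'=0}^i\mathbb E\Bigl[\sup_{x,a}\bigl|Q_{\omega_{k,i'}}(x,a)-\hat Q_{k,i'}(x,a)\bigr|\Bigr].$$ **Lemma 1 (Convergence rate of the surrogate functions).** Under Assumptions 1 and 2, all these expectations are finite, and there is a constant $C>0$, depending only on the CMDP, the policy class, $\Theta$, the step sizes, $B$, the Q-network architecture, the horizons $T_i$, and $b$ (not on the run, in particular not on the actor targets or on the Q-network weights), such that for every run, every $k$ and every $i\ge1$ $$\epsilon_f(i)\le\frac{C}{(1+i)\eta_{i+1}}+\frac{C}{1+i}\sum_{i'=0}^i\Bigl(\mu_{i'}\log^2 i+\frac{\mu_{i'}^2}{\eta_{i'+1}^2}+\frac{\mu_{i'}^2}{\eta_{i'+1}}+\eta_{i'+1}\log i\Bigr),$$ $$\epsilon_g(i)\le\frac{C}{(1+i)\eta_{i+1}}+\frac{C}{1+i}\sum_{i'=0}^i\Bigl(\mu_{i'}\log^2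 i+\frac{\mu_{i'}^2}{\eta_{i'+1}^2}+\frac{\mu_{i'}^2}{\eta_{i'+1}}+\eta_{i'+1}\Bigr)+C\,\epsilon_Q(i)+\sqrt{\epsilon_f(i)} .$$ Moreover $\lim_{i\to\infty}\epsilon_f(i)=0$, and $\epsilon_g(i)$ converges to zero up to the critic error: $\limsup_{i\to\infty}\bigl(\epsilon_g(i)-C\epsilon_Q(i)\bigr)\le0$. -/

import Mathlib

open MeasureTheory ProbabilityTheory Filter Topology
open scoped ENNReal NNReal

noncomputable section

namespace CACRL

/-- The parameter space `ℝⁿ`, with the Euclidean norm. -/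
abbrev Euc (n : ℕ) : Type := EuclideanSpace ℝ (Fin n)

/-- The augmented state space `𝒮 × 𝒵`. -/
abbrev AugState {nS nZ : ℕ} (S : Set (Euc nS)) (Z : Set (Euc nZ)) : Type := ↥S × ↥Z

/-- Total variation distance `∫ |α(dx) - β(dx)|` of two finite measures. -/
def tvDist {X : Type*} [MeasurableSpace X] (α β : Measure X)
    [IsFiniteMeasure α] [IsFiniteMeasure β] : ℝ :=
  ((α.toSignedMeasure - β.toSignedMeasure).totalVariation Set.univ).toReal

/-- A constrained Markov decision process whose transition function is driven by a latent Markov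
process: `cost k` is the per-step cost `C'ₖ` (`k = 0` the objective, `k = 1, …, K` the
constraints), `potential k` is the potential used to reshape it, `init` the law of the initial
augmented state. -/
structure CMDP {nS nZ nA : ℕ} (S : Set (Euc nS)) (Z : Set (Euc nZ)) (A : Set (Euc nA))
    (K : ℕ) where
  /-- `P^z(s' | s, a)`. -/
  trans : Kernel (AugState S Z × ↥A) ↥S
  trans_markov : IsMarkovKernel trans
  /-- `P_shift(z' | z)`. -/
  shift : Kernel ↥Z ↥Z
  shift_markov : IsMarkovKernel shift
  cost : Fin (K + 1) → ↥S → ↥A → ℝ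
  cost_measurable : ∀ k, Measurable fun p : ↥S × ↥A => cost k p.1 p.2
  potential : Fin (K + 1) → AugState S Z → ℝ
  potential_measurable : ∀ k, Measurable (potential k)
  init : Measure (AugState S Z)
  init_prob : IsProbabilityMeasure init

/-- A parameterized stochastic policy: `dens θ x a` is the density `π_θ(a | x)` with respect to
a reference measure on the action space. -/
structure Policy {nS nZ nA : ℕ} (S : Set (Euc nS)) (Z : Set (Euc nZ)) (A : Set (Euc nA))
    (n : ℕ) where
  ref : Measure ↥A
  ref_sigmaFinite : SigmaFinite ref
  dens : Euc n → AugState S Z → ↥A → ℝ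
  dens_measurable :
    Measurable fun p : Euc n × AugState S Z × ↥A => dens p.1 p.2.1 p.2.2
  dens_pos : ∀ θ x a, 0 < dens θ x a
  dens_norm : ∀ θ x, ∫⁻ a, ENNReal.ofReal (dens θ x a) ∂ref = 1

variable {nS nZ nA K n : ℕ} {S : Set (Euc nS)} {Z : Set (Euc nZ)} {A : Set (Euc nA)}

namespace Policy

/-- The policy `π_θ` as a kernel from augmented states to actions. -/
def kernel (π : Policy S Z A n) (θ : Euc n) : Kernel (AugState S Z) ↥A :=
  haveI := π.ref_sigmaFinite
  Kernel.withDensity (Kernel.const (AugState S Z) π.ref)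
    (fun x a => ENNReal.ofReal (π.dens θ x a))

instance (π : Policy S Z A n) (θ : Euc n) : IsMarkovKernel (π.kernel θ) := by
  have := π.ref_sigmaFinite
  have hm : Measurable (Function.uncurry fun x a => ENNReal.ofReal (π.dens θ x a)) :=
    ENNReal.measurable_ofReal.comp
      (π.dens_measurable.comp (measurable_const.prodMk measurable_id))
  refine ⟨fun x => ⟨?_⟩⟩
  rw [kernel, Kernel.withDensity_apply' _ hm, setLIntegral_univ, Kernel.const_apply]
  exact π.dens_norm θ x

/-- The score `∇_θ log π_θ(a | x)`; the gradient is taken within the parameter set `Θ`. -/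
def score (π : Policy S Z A n) (Θ : Set (Euc n)) (θ : Euc n) (x : AugState S Z) (a : ↥A) :
    Euc n :=
  gradientWithin (fun θ' => Real.log (π.dens θ' x a)) Θ θ

end Policy

namespace CMDP

/-- `P_T((s', z') | (s, z), a) = P^z(s' | s, a) P_shift(z' | z)`. -/
def augTrans (M : CMDP S Z A K) : Kernel (AugState S Z × ↥A) (AugState S Z) :=
  M.trans ×ₖ (M.shift.comap (fun p : AugState S Z × ↥A => p.1.2)
    (measurable_snd.comp measurable_fst))

instance (M : CMDP S Z A K) : IsMarkovKernel M.augTrans := by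
  have := M.trans_markov
  have := M.shift_markov
  unfold augTrans
  infer_instance

/-- The reshaped cost `C'ₖ(s, a) + Vₖ(x') - Vₖ(x)`, where `x = (s, z)`. -/
def reshapedCost (M : CMDP S Z A K) (k : Fin (K + 1)) (x : AugState S Z) (a : ↥A)
    (x' : AugState S Z) : ℝ :=
  M.cost k x.1 a + (M.potential k x' - M.potential k x)

/-- One step under the policy `π_θ`: the law of (action, next augmented state) given the current
augmented state. -/
def stepKernel (M : CMDP S Z A K) (π : Policy S Z A n) (θ : Euc n) :
    Kernel (AugState S Z) (↥A × AugState S Z) :=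
  (π.kernel θ) ⊗ₖ M.augTrans

instance (M : CMDP S Z A K) (π : Policy S Z A n) (θ : Euc n) :
    IsMarkovKernel (M.stepKernel π θ) := by
  unfold stepKernel
  infer_instance

/-- The transition kernel of the augmented state under the policy `π_θ`. -/
def stateKernel (M : CMDP S Z A K) (π : Policy S Z A n) (θ : Euc n) :
    Kernel (AugState S Z) (AugState S Z) :=
  (M.stepKernel π θ).snd

instance (M : CMDP S Z A K) (π : Policy S Z A n) (θ : Euc n) :
    IsMarkovKernel (M.stateKernel π θ) := by
  unfold stateKernel
  infer_instance

/-- The `t`-step transition kernel under the policy `π_θ`. -/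
def iterKernel (M : CMDP S Z A K) (π : Policy S Z A n) (θ : Euc n) :
    ℕ → Kernel (AugState S Z) (AugState S Z)
  | 0 => Kernel.id
  | t + 1 => (M.stateKernel π θ) ∘ₖ (iterKernel M π θ t)

instance (M : CMDP S Z A K) (π : Policy S Z A n) (θ : Euc n) (t : ℕ) :
    IsMarkovKernel (M.iterKernel π θ t) := by
  induction t with
  | zero => unfold iterKernel; infer_instance
  | succ t ih => unfold iterKernel; infer_instance

/-- Expected reshaped cost of one step from the augmented state `x` under `π_θ`. -/
def meanCost (M : CMDP S Z A K) (π : Policy S Z A n) (θ : Euc n) (k : Fin (K + 1))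
    (x : AugState S Z) : ℝ :=
  ∫ p, M.reshapedCost k x p.1 p.2 ∂(M.stepKernel π θ x)

/-- The reshaped objective (`k = 0`) and constraint (`k ≥ 1`) functions: the long-run average
`lim_{T → ∞} (1/T) 𝔼 ∑_{t < T} Ċ'ₖ(xₜ, aₜ, xₜ₊₁)` under the fixed policy `π_θ`. -/
def objective (M : CMDP S Z A K) (π : Policy S Z A n) (k : Fin (K + 1)) (θ : Euc n) : ℝ :=
  limUnder atTop fun T : ℕ =>
    (1 / (T : ℝ)) * ∑ t ∈ Finset.range T,
      ∫ x, M.meanCost π θ k x ∂(M.init.bind (M.iterKernel π θ t))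

/-- The gradient of the reshaped function `k`, taken within the parameter set `Θ`. -/
def gradObjective (M : CMDP S Z A K) (π : Policy S Z A n) (Θ : Set (Euc n)) (k : Fin (K + 1))
    (θ : Euc n) : Euc n :=
  gradientWithin (M.objective π k) Θ θ

/-- `𝔼[Ċ'ₖ(x_l, a_l, x_{l+1}) | x₀ = x, a₀ = a]` under the policy `π_θ`. -/
def expCost (M : CMDP S Z A K) (π : Policy S Z A n) (θ : Euc n) (k : Fin (K + 1)) (l : ℕ)
    (x : AugState S Z) (a : ↥A) : ℝ :=
  match l with
  | 0 => ∫ x', M.reshapedCost k x a x' ∂(M.augTrans (x, a))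
  | l + 1 => ∫ y, M.meanCost π θ k y ∂((M.iterKernel π θ l ∘ₖ M.augTrans) (x, a))

/-- The surrogate Q-function `𝔼[∑_{l < T} (Ċ'ₖ(x_l, a_l, x_{l+1}) - y) | x₀ = x, a₀ = a]` under
`π_θ`, where the estimate `y` replaces the long-run average. -/
def surrogateQ (M : CMDP S Z A K) (π : Policy S Z A n) (θ : Euc n) (k : Fin (K + 1)) (y : ℝ)
    (T : ℕ) (x : AugState S Z) (a : ↥A) : ℝ :=
  ∑ l ∈ Finset.range T, (M.expCost π θ k l x a - y)

end CMDP

/-- Assumptions on the problem structure; `lam` and `ρ` are the constants of the uniform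
geometric ergodicity. -/
structure ProblemAssumptions (M : CMDP S Z A K) (π : Policy S Z A n) (Θ : Set (Euc n))
    (lam ρ : ℝ) : Prop where
  compact_S : IsCompact S
  compact_Z : IsCompact Z
  compact_A : IsCompact A
  cost_bounded : ∃ c : ℝ, ∀ k x a x', |M.reshapedCost k x a x'| ≤ c
  compact_Θ : IsCompact Θ
  convex_Θ : Convex ℝ Θ
  /-- Gradients with respect to `θ ∈ Θ` are well defined. -/
  interior_Θ : (interior Θ).Nonempty
  policy_differentiable : ∀ x a, DifferentiableOn ℝ (fun θ => Real.log (π.dens θ x a)) Θ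
  policy_lipschitz : ∃ L : ℝ≥0, ∀ x a, LipschitzOnWith L (fun θ => Real.log (π.dens θ x a)) Θ
  score_lipschitz : ∃ L : ℝ≥0, ∀ x a, LipschitzOnWith L (fun θ => π.score Θ θ x a) Θ
  score_measurable :
    Measurable fun p : Euc n × AugState S Z × ↥A => π.score Θ p.1 p.2.1 p.2.2
  objective_differentiable : ∀ k, DifferentiableOn ℝ (M.objective π k) Θ
  gradient_bounded : ∃ c : ℝ, ∀ k, ∀ θ ∈ Θ, ‖M.gradObjective π Θ k θ‖ ≤ c
  gradient_lipschitz : ∃ L : ℝ≥0, ∀ k, LipschitzOnWith L (M.gradObjective π Θ k) Θ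
  lam_pos : 0 < lam
  ρ_pos : 0 < ρ
  ρ_lt_one : ρ < 1
  /-- Uniform ergodicity: the stationary law under `π_θ` is approached geometrically. -/
  ergodic : ∀ θ ∈ Θ, ∃ m : ProbabilityMeasure (AugState S Z),
    Kernel.Invariant (M.stateKernel π θ) (m : Measure (AugState S Z)) ∧
      ∀ x t, tvDist (M.iterKernel π θ t x) (m : Measure (AugState S Z)) ≤ lam * ρ ^ t

/-- Assumptions on the step sizes of the policy (`μ`) and of the estimates (`η`). -/
structure StepSizes (μ η : ℕ → ℝ) : Prop where
  μ_pos : ∀ i, 0 < μ i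
  μ_le_one : ∀ i, μ i ≤ 1
  η_pos : ∀ i, 0 < η i
  μ_antitone : Antitone μ
  η_antitone : Antitone η
  μ_tendsto : Tendsto μ atTop (𝓝 0)
  μ_sum : Tendsto (fun N => ∑ i ∈ Finset.range N, μ i) atTop atTop
  μ_sq : Summable fun i => μ i ^ 2
  η_tendsto : Tendsto η atTop (𝓝 0)
  η_inv : ∃ r : ℝ, 0 < r ∧ r < 1 ∧
    (fun i : ℕ => 1 / η i) =O[atTop] (fun i : ℕ => (i : ℝ) ^ r)
  η_sq : Summable fun i => η i ^ 2
  ratio : Tendsto (fun i => μ i / η i) atTop (𝓝 0)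

/-- A run of the actor-critic recursion on a probability space. Iteration `i` uses the `B` time
slots `B i, …, B i + B - 1`, in which actions are drawn from `π_{θᵢ}`. `𝓕 t` is the information
available just before the action of slot `t` is drawn. `Qnet k w` is the Q-network with weights
`w`; the weights `w k i` and the actor's target `θbar i` are arbitrary functions of the information
available after iteration `i`. -/
structure Run (M : CMDP S Z A K) (π : Policy S Z A n) (Θ : Set (Euc n)) {q : ℕ}
    (Qnet : Fin (K + 1) → Euc q → AugState S Z → ↥A → ℝ) (μ η : ℕ → ℝ) (B : ℕ)
    {Ω : Type*} [mΩ : MeasurableSpace Ω] (P : Measure Ω) where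
  𝓕 : Filtration ℕ mΩ
  /-- Augmented states. -/
  s : ℕ → Ω → AugState S Z
  /-- Actions. -/
  a : ℕ → Ω → ↥A
  /-- Policy parameters. -/
  θ : ℕ → Ω → Euc n
  θbar : ℕ → Ω → Euc n
  /-- Q-network weights. -/
  w : Fin (K + 1) → ℕ → Ω → Euc q
  /-- Estimates of the function values. -/
  fhat : Fin (K + 1) → ℕ → Ω → ℝ
  /-- Estimates of the gradients. -/
  ghat : Fin (K + 1) → ℕ → Ω → Euc n
  s_measurable : ∀ t, Measurable[𝓕 t] (s t)
  a_measurable : ∀ t, Measurable[𝓕 (t + 1)] (a t)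
  s_init : P.map (s 0) = M.init
  /-- Given the past, the action is drawn from the current policy and the next augmented state
  from the transition function. -/
  law : ∀ (t : ℕ) (U : Set (↥A × AugState S Z)), MeasurableSet U →
    P[((fun ω => (a t ω, s (t + 1) ω)) ⁻¹' U).indicator (fun _ => (1 : ℝ)) | 𝓕 t]
      =ᵐ[P] fun ω => (M.stepKernel π (θ (t / B) ω) (s t ω)).real U
  θ_init_measurable : Measurable[𝓕 0] (θ 0)
  θ_init_mem : ∀ ω, θ 0 ω ∈ Θ
  θbar_measurable : ∀ i, Measurable[𝓕 (B * (i + 1))] (θbar i)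
  θbar_mem : ∀ i ω, θbar i ω ∈ Θ
  w_measurable : ∀ k i, Measurable[𝓕 (B * (i + 1))] (w k i)
  fhat_init_measurable : ∀ k, Measurable[𝓕 0] (fhat k 0)
  ghat_init_measurable : ∀ k, Measurable[𝓕 0] (ghat k 0)
  θ_succ : ∀ i ω, θ (i + 1) ω = (1 - μ i) • θ i ω + μ i • θbar i ω
  /-- `f̂ᵢ₊₁ = (1 - ηᵢ₊₁) f̂ᵢ + ηᵢ f̃ᵢ` with `f̃ᵢ` the batch average of the reshaped costs. -/
  fhat_succ : ∀ k i ω, fhat k (i + 1) ω =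
    (1 - η (i + 1)) * fhat k i ω + η i * ((1 / (B : ℝ)) * ∑ j ∈ Finset.range B,
      M.reshapedCost k (s (B * i + j) ω) (a (B * i + j) ω) (s (B * i + j + 1) ω))
  /-- `ĝᵢ₊₁ = (1 - ηᵢ₊₁) ĝᵢ + ηᵢ g̃ᵢ` with `g̃ᵢ` the batch average of the Q-network output times
  the score. -/
  ghat_succ : ∀ k i ω, ghat k (i + 1) ω =
    (1 - η (i + 1)) • ghat k i ω + η i • ((1 / (B : ℝ)) • ∑ j ∈ Finset.range B,
      Qnet k (w k i ω) (s (B * i + j) ω) (a (B * i + j) ω) •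
        π.score Θ (θ i ω) (s (B * i + j) ω) (a (B * i + j) ω))

namespace Run

variable {M : CMDP S Z A K} {π : Policy S Z A n} {Θ : Set (Euc n)} {q : ℕ}
  {Qnet : Fin (K + 1) → Euc q → AugState S Z → ↥A → ℝ} {μ η : ℕ → ℝ} {B : ℕ}
  {Ω : Type*} [mΩ : MeasurableSpace Ω] {P : Measure Ω}

/-- The initial estimates and the outputs of the Q-networks along the run are bounded by `b`. -/
structure BoundedBy (R : Run M π Θ Qnet μ η B P) (b : ℝ) : Prop where
  fhat_init : ∀ k ω, |R.fhat k 0 ω| ≤ b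
  ghat_init : ∀ k ω, ‖R.ghat k 0 ω‖ ≤ b
  critic : ∀ k i ω x a, |Qnet k (R.w k i ω) x a| ≤ b

/-- Squared error of the value estimate at iteration `i`. -/
def sqErrF (R : Run M π Θ Qnet μ η B P) (k : Fin (K + 1)) (i : ℕ) (ω : Ω) : ℝ :=
  (R.fhat k i ω - M.objective π k (R.θ i ω)) ^ 2

/-- Squared error of the gradient estimate at iteration `i`. -/
def sqErrG (R : Run M π Θ Qnet μ η B P) (k : Fin (K + 1)) (i : ℕ) (ω : Ω) : ℝ :=
  ‖R.ghat k i ω - M.gradObjective π Θ k (R.θ i ω)‖ ^ 2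

/-- `ε_f(i)`. -/
def epsF (R : Run M π Θ Qnet μ η B P) (k : Fin (K + 1)) (i : ℕ) : ℝ :=
  (1 / (1 + (i : ℝ))) * ∑ j ∈ Finset.range (i + 1), ∫ ω, R.sqErrF k j ω ∂P

/-- `ε_g(i)`. -/
def epsG (R : Run M π Θ Qnet μ η B P) (k : Fin (K + 1)) (i : ℕ) : ℝ :=
  (1 / (1 + (i : ℝ))) * ∑ j ∈ Finset.range (i + 1), ∫ ω, R.sqErrG k j ω ∂P

/-- Expectation of the largest gap, over all augmented states and actions, between the Q-network
and the surrogate Q-function (with horizon `T`) at iteration `i`. -/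
def criticErr (R : Run M π Θ Qnet μ η B P) (k : Fin (K + 1)) (T : ℕ) (i : ℕ) : ℝ≥0∞ :=
  ∫⁻ ω, ⨆ (x : AugState S Z) (a : ↥A), ENNReal.ofReal
    |Qnet k (R.w k i ω) x a - M.surrogateQ π (R.θ i ω) k (R.fhat k i ω) T x a| ∂P

/-- Average over the iterations `0, …, i` of the error of the Q-networks. -/
def epsQ (R : Run M π Θ Qnet μ η B P) (k : Fin (K + 1)) (T : ℕ → ℕ) (i : ℕ) : ℝ :=
  (1 / (1 + (i : ℝ))) * ∑ j ∈ Finset.range (i + 1), (R.criticErr k (T j) j).toReal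

end Run

end CACRL

end

/-! Each estimate is a stochastic approximation with step `η`, tracking a target that moves by
O(`μ`) per iteration, since the actor only takes convex combinations inside the compact `Θ`. Two
effects must be controlled: the drift of the target, and the bias of Markovian samples drawn under a
policy that keeps changing.

Drift (`Recursion.sq_err_le`). Expand the squared error after one step and divide by the step size.
The contraction leaves twice the squared error; the weights 1/η telescope; Young's inequality spends
one of the two copies on the cross term with the drift, at the price μ²/η²; the second moment of the
samples costs η.

Bias (`Run.integral_inner_batch`, `Recursion.neg_sum_inner_le`). Let u solve Poisson's equation for
the current policy. Up to martingale differences, the batch average minus its stationary mean is 1/B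
times the difference of u at the two ends of the batch. Summation by parts moves this difference
onto the error and the parameter, which vary slowly; the cost is O(μ + η) per step. No mixing-time
argument is made, so no logarithm appears: the accumulated error is bounded by `StepSizes.budget`.
What is needed is that u is bounded and Lipschitz in θ. This follows from uniform ergodicity
(`GeomErgodic.norm_poisson_sub_le`) because the policies are Lipschitz in total variation.

Gradient. The policy gradient theorem (`Regularity.gradObjective_eq`) writes the target as a
stationary mean of `qValue` times the score, so the same scheme applies once the Q-network is
compared with `qValue`. By `Regularity.exists_abs_surrogateQ_sub_le` the surrogate equals `qValue` +
T(average cost - estimate) + O(ρ^T). The middle term may be large, but it is known before the batch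
and does not depend on the action, and the score has conditional mean zero; hence it vanishes in
expectation (`Run.abs_integral_inner_gradSample_sub_le`). Only the critic error and O(η) remain, so
the bound on ε_g holds even without the term √ε_f.

The logarithms of the stated rate are at least 1 from index 3 on; earlier indices are absorbed by
the term with 1/η (`StepSizes.budget_le`). -/

noncomputable section

namespace CACRL

/-! ### Bounded measurable functions and total variation. -/

section BoundedMeasurable

variable {X Y E : Type*} [MeasurableSpace X] [MeasurableSpace Y] [NormedAddCommGroup E]

/-- Strongly measurable functions bounded in norm by `C`. -/
structure BddMeas (φ : X → E) (C : ℝ) : Prop where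
  meas : StronglyMeasurable φ
  bound : ∀ x, ‖φ x‖ ≤ C

namespace BddMeas

variable {φ ψ : X → E} {C D : ℝ}

theorem integrable (h : BddMeas φ C) (ν : Measure X) [IsFiniteMeasure ν] : Integrable φ ν :=
  Integrable.of_bound h.meas.aestronglyMeasurable C (ae_of_all _ h.bound)

theorem mono (h : BddMeas φ C) (hCD : C ≤ D) : BddMeas φ D :=
  ⟨h.meas, fun x => (h.bound x).trans hCD⟩

theorem sub (h : BddMeas φ C) (h' : BddMeas ψ D) : BddMeas (fun x => φ x - ψ x) (C + D) :=
  ⟨h.meas.sub h'.meas, fun x => (norm_sub_le _ _).trans (add_le_add (h.bound x) (h'.bound x))⟩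

theorem add (h : BddMeas φ C) (h' : BddMeas ψ D) : BddMeas (fun x => φ x + ψ x) (C + D) :=
  ⟨h.meas.add h'.meas, fun x => (norm_add_le _ _).trans (add_le_add (h.bound x) (h'.bound x))⟩

theorem const (v : E) : BddMeas (fun _ : X => v) ‖v‖ := ⟨stronglyMeasurable_const, fun _ => le_rfl⟩

theorem comp (h : BddMeas φ C) {g : Y → X} (hg : Measurable g) : BddMeas (fun y => φ (g y)) C :=
  ⟨h.meas.comp_measurable hg, fun y => h.bound (g y)⟩

variable [NormedSpace ℝ E]

theorem smul {c : X → ℝ} (hc : BddMeas c D) (h : BddMeas φ C) :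
    BddMeas (fun x => c x • φ x) (D * C) :=
  ⟨hc.meas.smul h.meas, fun x => by
    rw [norm_smul]
    exact mul_le_mul (hc.bound x) (h.bound x) (norm_nonneg _) ((norm_nonneg _).trans (hc.bound x))⟩

theorem norm_integral_le (h : BddMeas φ C) (ν : Measure X) [IsProbabilityMeasure ν] :
    ‖∫ x, φ x ∂ν‖ ≤ C := by
  simpa using norm_integral_le_of_norm_le_const (μ := ν) (ae_of_all _ h.bound)

theorem kernel (h : BddMeas φ C) (κ : Kernel Y X) [IsMarkovKernel κ] :
    BddMeas (fun y => ∫ x, φ x ∂(κ y)) C :=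
  ⟨h.meas.integral_kernel, fun y => h.norm_integral_le (κ y)⟩

end BddMeas

theorem BddMeas.integral_bind [NormedSpace ℝ E] [CompleteSpace E] {φ : X → E} {C : ℝ}
    (h : BddMeas φ C) (ν : Measure Y) [IsFiniteMeasure ν] (κ : Kernel Y X) [IsMarkovKernel κ] :
    ∫ x, φ x ∂(ν.bind κ) = ∫ y, ∫ x, φ x ∂(κ y) ∂ν := by
  have h1 := Kernel.integral_comp (η := κ) (κ := Kernel.const Unit ν) (a := ())
    (h.integrable _)
  rwa [Kernel.comp_const, Kernel.const_apply, Kernel.const_apply] at h1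

/-- Integrals of bounded functions against two probability measures differ by at most the total
variation distance. -/
theorem BddMeas.norm_integral_sub_le_tvDist [NormedSpace ℝ E] {φ : X → E} {C : ℝ} (h : BddMeas φ C)
    (α β : Measure X) [IsProbabilityMeasure α] [IsProbabilityMeasure β] :
    ‖∫ x, φ x ∂α - ∫ x, φ x ∂β‖ ≤ C * tvDist α β := by
  set s : SignedMeasure X := α.toSignedMeasure - β.toSignedMeasure with hs
  set p := s.toJordanDecomposition.posPart with hp
  set q := s.toJordanDecomposition.negPart with hq
  -- The Jordan decomposition gives α - β = p - q. Moving the negative terms across leaves an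
  -- identity of positive finite measures, against which integrals can be added.
  have hsum : α + q = β + p := by
    ext U hU
    have h1 := congrArg (fun v : SignedMeasure X => v U) s.toSignedMeasure_toJordanDecomposition
    simp only [JordanDecomposition.toSignedMeasure, hs, sub_apply,
      Measure.toSignedMeasure_apply_measurable hU] at h1
    rw [← hs, ← hp, ← hq] at h1
    have h2 : (α + q).real U = (β + p).real U := by
      rw [measureReal_add_apply, measureReal_add_apply]; linarith
    exact (measureReal_eq_measureReal_iff (by finiteness) (by finiteness)).1 h2
  have h3 : ∫ x, φ x ∂α + ∫ x, φ x ∂q = ∫ x, φ x ∂β + ∫ x, φ x ∂p := by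
    rw [← integral_add_measure (h.integrable α) (h.integrable q),
      ← integral_add_measure (h.integrable β) (h.integrable p), hsum]
  have h4 : ∫ x, φ x ∂α - ∫ x, φ x ∂β = ∫ x, φ x ∂p - ∫ x, φ x ∂q := by
    rw [sub_eq_sub_iff_add_eq_add, h3, add_comm]
  have h5 : tvDist α β = p.real Set.univ + q.real Set.univ := by
    rw [tvDist, ← hs, SignedMeasure.totalVariation, ← measureReal_def, measureReal_add_apply]
  rw [h4, h5, mul_add]
  refine (norm_sub_le _ _).trans (add_le_add ?_ ?_)
  · exact norm_integral_le_of_norm_le_const (ae_of_all _ h.bound)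
  · exact norm_integral_le_of_norm_le_const (ae_of_all _ h.bound)

end BoundedMeasurable

/-! ### Poisson's equation for uniformly ergodic kernels, and its perturbation theory. -/

section Poisson

variable {X : Type*} [MeasurableSpace X]

/-- Powers of a transition kernel. -/
def kernelPow (κ : Kernel X X) : ℕ → Kernel X X
  | 0 => Kernel.id
  | t + 1 => κ ∘ₖ kernelPow κ t

instance (κ : Kernel X X) [IsMarkovKernel κ] (t : ℕ) : IsMarkovKernel (kernelPow κ t) := by
  induction t with
  | zero => unfold kernelPow; infer_instance
  | succ t ih => unfold kernelPow; infer_instance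

theorem kernelPow_succ' (κ : Kernel X X) (t : ℕ) : kernelPow κ (t + 1) = kernelPow κ t ∘ₖ κ := by
  induction t with
  | zero => simp [kernelPow]
  | succ t ih =>
    conv_lhs => rw [kernelPow, ih, ← Kernel.comp_assoc]
    rfl

/-- A kernel that converges geometrically fast, uniformly in the initial state, to its invariant
law `m`. -/
structure GeomErgodic (κ : Kernel X X) [IsMarkovKernel κ] (m : Measure X) [IsProbabilityMeasure m]
    (D ρ : ℝ) : Prop where
  invariant : κ.Invariant m
  mix : ∀ x t, tvDist (kernelPow κ t x) m ≤ D * ρ ^ t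
  D_nonneg : 0 ≤ D
  ρ_nonneg : 0 ≤ ρ
  ρ_lt_one : ρ < 1

variable {E : Type*} [NormedAddCommGroup E] [NormedSpace ℝ E]

/-- The solution `∑ₜ (Pᵗ φ - m φ)` of Poisson's equation. -/
def poisson (κ : Kernel X X) (m : Measure X) (φ : X → E) (x : X) : E :=
  ∑' t, (∫ y, φ y ∂(kernelPow κ t x) - ∫ y, φ y ∂m)

theorem integral_kernelPow_zero [CompleteSpace E] (κ : Kernel X X) {φ : X → E} {C : ℝ}
    (h : BddMeas φ C) (x : X) : ∫ y, φ y ∂(kernelPow κ 0 x) = φ x := by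
  rw [kernelPow, Kernel.id_apply, integral_dirac' _ _ h.meas]

variable (κ : Kernel X X) [IsMarkovKernel κ] (m : Measure X) [IsProbabilityMeasure m]

theorem integral_kernelPow_succ [CompleteSpace E] {φ : X → E} {C : ℝ} (h : BddMeas φ C) (t : ℕ)
    (x : X) : ∫ y, φ y ∂(kernelPow κ (t + 1) x) = ∫ z, ∫ y, φ y ∂(κ z) ∂(kernelPow κ t x) := by
  rw [kernelPow, Kernel.integral_comp (h.integrable _)]

theorem integral_kernelPow_succ' [CompleteSpace E] {φ : X → E} {C : ℝ} (h : BddMeas φ C) (t : ℕ)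
    (x : X) : ∫ y, φ y ∂(kernelPow κ (t + 1) x) = ∫ z, ∫ y, φ y ∂(kernelPow κ t z) ∂(κ x) := by
  rw [kernelPow_succ', Kernel.integral_comp (h.integrable _)]

namespace GeomErgodic

variable {κ m} {D ρ : ℝ} (g : GeomErgodic κ m D ρ)
include g

theorem norm_sub_le {φ : X → E} {C : ℝ} (h : BddMeas φ C) (x : X) (t : ℕ) :
    ‖∫ y, φ y ∂(kernelPow κ t x) - ∫ y, φ y ∂m‖ ≤ C * D * ρ ^ t := by
  have hC : 0 ≤ C := (norm_nonneg _).trans (h.bound x)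
  refine (h.norm_integral_sub_le_tvDist _ _).trans ?_
  rw [mul_assoc]
  exact mul_le_mul_of_nonneg_left (g.mix x t) hC

theorem summable_bound (C : ℝ) : Summable fun t : ℕ => C * D * ρ ^ t :=
  (summable_geometric_of_lt_one g.ρ_nonneg g.ρ_lt_one).mul_left _

theorem tsum_bound (C : ℝ) : ∑' t : ℕ, C * D * ρ ^ t = C * D / (1 - ρ) := by
  rw [tsum_mul_left, tsum_geometric_of_lt_one g.ρ_nonneg g.ρ_lt_one, div_eq_mul_inv]

theorem tendsto_pow {φ : X → E} {C : ℝ} (h : BddMeas φ C) (x : X) :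
    Tendsto (fun t => ∫ y, φ y ∂(kernelPow κ t x)) atTop (𝓝 (∫ y, φ y ∂m)) := by
  rw [tendsto_iff_norm_sub_tendsto_zero]
  refine squeeze_zero (fun _ => norm_nonneg _) (fun t => g.norm_sub_le h x t) ?_
  simpa using (tendsto_pow_atTop_nhds_zero_of_lt_one g.ρ_nonneg g.ρ_lt_one).const_mul (C * D)

variable [CompleteSpace E] {φ : X → E} {C : ℝ} (h : BddMeas φ C)
include h

theorem integral_kernel_invariant : ∫ x, ∫ y, φ y ∂(κ x) ∂m = ∫ x, φ x ∂m := by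
  conv_rhs => rw [← g.invariant.def]
  rw [h.integral_bind]

theorem summable_poisson (x : X) :
    Summable fun t => ∫ y, φ y ∂(kernelPow κ t x) - ∫ y, φ y ∂m :=
  Summable.of_norm_bounded (g.summable_bound C) (g.norm_sub_le h x)

theorem bddMeas_poisson : BddMeas (poisson κ m φ) (C * D / (1 - ρ)) := by
  constructor
  · refine stronglyMeasurable_of_tendsto (u := atTop)
      (f := fun N x => ∑ t ∈ Finset.range N,
        (∫ y, φ y ∂(kernelPow κ t x) - ∫ y, φ y ∂m)) (fun N => ?_) ?_
    · exact Finset.stronglyMeasurable_fun_sum _ fun t _ =>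
        (h.kernel (kernelPow κ t)).meas.sub stronglyMeasurable_const
    · rw [tendsto_pi_nhds]
      intro x
      exact (g.summable_poisson h x).hasSum.tendsto_sum_nat
  · intro x
    rw [← g.tsum_bound]
    exact tsum_of_norm_bounded (g.summable_bound C).hasSum (g.norm_sub_le h x)

/-- The geometric bound is uniform in the state, so integral and series can be exchanged; the
semigroup property then shifts the index by `N`. -/
theorem integral_poisson_pow (x : X) (N : ℕ) :
    Tendsto (fun T => ∑ t ∈ Finset.range T,
      (∫ y, φ y ∂(kernelPow κ (N + t) x) - ∫ y, φ y ∂m)) atTop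
      (𝓝 (∫ y, poisson κ m φ y ∂(kernelPow κ N x))) := by
  have h0 : ∀ t, ∫ y, φ y ∂(kernelPow κ (N + t) x) - ∫ y, φ y ∂m =
      ∫ z, (∫ y, φ y ∂(kernelPow κ t z) - ∫ y, φ y ∂m) ∂(kernelPow κ N x) := by
    intro t
    rw [integral_sub ((h.kernel _).integrable _) (integrable_const _)]
    simp only [integral_const, probReal_univ, one_smul]
    congr 1
    induction N generalizing x with
    | zero => rw [integral_kernelPow_zero κ (h.kernel _), zero_add]
    | succ N ih =>
      rw [show N + 1 + t = (N + t) + 1 by ring, integral_kernelPow_succ' κ h,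
        integral_kernelPow_succ' κ (h.kernel _)]
      exact integral_congr_ae (ae_of_all _ fun z => ih z)
  simp_rw [h0]
  have h1 : HasSum (fun t => ∫ z, (∫ y, φ y ∂(kernelPow κ t z) - ∫ y, φ y ∂m) ∂(kernelPow κ N x))
      (∫ y, poisson κ m φ y ∂(kernelPow κ N x)) := by
    refine hasSum_integral_of_summable_integral_norm (F := fun t z =>
      ∫ y, φ y ∂(kernelPow κ t z) - ∫ y, φ y ∂m)
      (fun t => ((h.kernel _).integrable _).sub (integrable_const _)) ?_
    refine Summable.of_nonneg_of_le (fun t => integral_nonneg fun _ => norm_nonneg _) (fun t => ?_)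
      (g.summable_bound C)
    have := norm_integral_le_of_norm_le_const (μ := kernelPow κ N x)
      (f := fun z => ‖∫ y, φ y ∂(kernelPow κ t z) - ∫ y, φ y ∂m‖) (C := C * D * ρ ^ t)
      (ae_of_all _ fun z => by rw [norm_norm]; exact g.norm_sub_le h z t)
    simpa using (le_abs_self _).trans this
  exact h1.tendsto_sum_nat

/-- Poisson's equation. -/
theorem poisson_sub (x : X) :
    poisson κ m φ x - ∫ y, poisson κ m φ y ∂(κ x) = φ x - ∫ y, φ y ∂m := by
  have h1 := g.integral_poisson_pow h x 1
  have h2 : ∀ t, kernelPow κ (1 + t) x = kernelPow κ (t + 1) x := fun t => by rw [add_comm]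
  simp_rw [h2] at h1
  have h3 : kernelPow κ 1 = κ := by simp [kernelPow]
  rw [h3] at h1
  have h4 := (g.summable_poisson h x).hasSum.tendsto_sum_nat
  -- Applying the kernel once drops the term `t = 0` of the series, so partial sums of length `N +
  -- 1` are compared with shifted ones of length `N`.
  have h5 := (h4.comp (tendsto_add_atTop_nat 1))
  have h6 : ((fun N => ∑ t ∈ Finset.range N, (∫ y, φ y ∂(kernelPow κ t x) - ∫ y, φ y ∂m)) ∘
      fun a => a + 1) = fun N => (∑ t ∈ Finset.range N,
        (∫ y, φ y ∂(kernelPow κ (t + 1) x) - ∫ y, φ y ∂m)) + (φ x - ∫ y, φ y ∂m) := by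
    funext N
    simp only [Function.comp]
    rw [Finset.sum_range_succ', integral_kernelPow_zero κ h]
  rw [h6] at h5
  have h7 := tendsto_nhds_unique h5 (h1.add_const _)
  rw [sub_eq_iff_eq_add', ← h7]
  rfl

/-- Functions that are nearly harmonic are nearly constant. -/
theorem norm_sub_integral_le {δ : ℝ} (hδ : ∀ x, ‖φ x - ∫ y, φ y ∂(κ x)‖ ≤ δ) (x : X) :
    ‖φ x - ∫ y, φ y ∂m‖ ≤ δ * D / (1 - ρ) := by
  have hψ : BddMeas (fun x => φ x - ∫ y, φ y ∂(κ x)) δ := ⟨h.meas.sub (h.kernel κ).meas, hδ⟩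
  -- By invariance the defect φ - Pφ is centered, so its iterates decay geometrically with prefactor
  -- `δ * D`. Summing them telescopes to φ minus its iterate, which converges to φ minus its mean.
  have hm : ∫ x, (φ x - ∫ y, φ y ∂(κ x)) ∂m = 0 := by
    rw [integral_sub (h.integrable _) ((h.kernel κ).integrable _), g.integral_kernel_invariant h,
      sub_self]
  have hstep : ∀ N, ∑ t ∈ Finset.range N, ∫ z, (φ z - ∫ y, φ y ∂(κ z)) ∂(kernelPow κ t x)
      = φ x - ∫ y, φ y ∂(kernelPow κ N x) := by
    intro N
    induction N with
    | zero => simp [integral_kernelPow_zero κ h]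
    | succ N ih =>
      rw [Finset.sum_range_succ, ih, integral_sub (h.integrable _) ((h.kernel κ).integrable _),
        integral_kernelPow_succ κ h]
      abel
  have hlim : Tendsto (fun N => φ x - ∫ y, φ y ∂(kernelPow κ N x)) atTop
      (𝓝 (φ x - ∫ y, φ y ∂m)) := (g.tendsto_pow h x).const_sub _
  refine le_of_tendsto hlim.norm (Eventually.of_forall fun N => ?_)
  rw [← hstep, ← g.tsum_bound]
  have hle : ∀ t, ‖∫ z, (φ z - ∫ y, φ y ∂(κ z)) ∂(kernelPow κ t x)‖ ≤ δ * D * ρ ^ t := by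
    intro t
    have := g.norm_sub_le hψ x t
    rwa [hm, sub_zero] at this
  have hδ0 : 0 ≤ δ := (norm_nonneg _).trans (hδ x)
  refine (norm_sum_le_of_le _ fun t _ => hle t).trans ?_
  exact (g.summable_bound δ).sum_le_tsum _ fun t _ =>
    mul_nonneg (mul_nonneg hδ0 g.D_nonneg) (pow_nonneg g.ρ_nonneg t)

/-- Poisson's equation iterated along the chain: centered sums over a finite horizon are exact
differences of the solution. This serves to normalize the solution and, later, to truncate the
horizon of the action value. -/
theorem poisson_sub_pow (x : X) (N : ℕ) :
    poisson κ m φ x - ∫ y, poisson κ m φ y ∂(kernelPow κ N x) =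
      ∑ t ∈ Finset.range N, (∫ y, φ y ∂(kernelPow κ t x) - ∫ y, φ y ∂m) := by
  have hu := g.bddMeas_poisson h
  induction N with
  | zero => simp [integral_kernelPow_zero κ hu]
  | succ N ih =>
    rw [Finset.sum_range_succ, ← ih, integral_kernelPow_succ κ hu]
    have h2 : ∫ z, (φ z - ∫ y, φ y ∂m) ∂(kernelPow κ N x) =
        ∫ z, (poisson κ m φ z - ∫ y, poisson κ m φ y ∂(κ z)) ∂(kernelPow κ N x) :=
      integral_congr_ae (ae_of_all _ fun z => (g.poisson_sub h z).symm)
    rw [integral_sub (h.integrable _) (integrable_const _), integral_sub (hu.integrable _)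
      ((hu.kernel κ).integrable _)] at h2
    simp only [integral_const, probReal_univ, one_smul] at h2
    rw [h2]; abel

/-- Let `N` tend to infinity in `poisson_sub_pow`. This normalization fixes the additive constant
that Poisson's equation leaves free. -/
theorem integral_poisson : ∫ x, poisson κ m φ x ∂m = 0 := by
  have hne : Nonempty X := by
    by_contra hX
    rw [not_nonempty_iff] at hX
    exact IsProbabilityMeasure.ne_zero m (Measure.eq_zero_of_isEmpty m)
  obtain ⟨x⟩ := hne
  have hu := g.bddMeas_poisson h
  have h2 : Tendsto (fun N => poisson κ m φ x - ∫ y, poisson κ m φ y ∂(kernelPow κ N x)) atTop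
      (𝓝 (poisson κ m φ x)) := by
    simp_rw [g.poisson_sub_pow h x]
    exact (g.summable_poisson h x).hasSum.tendsto_sum_nat
  have h3 := tendsto_nhds_unique h2 ((g.tendsto_pow hu x).const_sub _)
  rwa [eq_comm, sub_eq_self] at h3

/-- Dependence of the invariant law on the kernel. -/
theorem norm_integral_sub_le {κ' : Kernel X X} [IsMarkovKernel κ'] {m' : Measure X}
    [IsProbabilityMeasure m'] {D' ρ' : ℝ} (g' : GeomErgodic κ' m' D' ρ') {δ : ℝ}
    (hδ : ∀ (ψ : X → E) (B : ℝ), BddMeas ψ B →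
      ∀ x, ‖∫ y, ψ y ∂(κ' x) - ∫ y, ψ y ∂(κ x)‖ ≤ B * δ) :
    ‖∫ x, φ x ∂m' - ∫ x, φ x ∂m‖ ≤ C * D / (1 - ρ) * δ := by
  have hu := g.bddMeas_poisson h
  -- Poisson's equation for `κ` is integrated against `m'`, and invariance of `m'` rewrites the mean
  -- of the solution as the mean of its image under `κ'`. Only the difference of the kernels is
  -- left.
  have h1 : ∫ x, φ x ∂m' - ∫ x, φ x ∂m =
      ∫ x, (∫ y, poisson κ m φ y ∂(κ' x) - ∫ y, poisson κ m φ y ∂(κ x)) ∂m' := by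
    have h2 : ∫ z, (φ z - ∫ y, φ y ∂m) ∂m' =
        ∫ z, (poisson κ m φ z - ∫ y, poisson κ m φ y ∂(κ z)) ∂m' :=
      integral_congr_ae (ae_of_all _ fun z => (g.poisson_sub h z).symm)
    rw [integral_sub (h.integrable _) (integrable_const _), integral_sub (hu.integrable _)
      ((hu.kernel κ).integrable _)] at h2
    simp only [integral_const, probReal_univ, one_smul] at h2
    rw [h2, integral_sub ((hu.kernel κ').integrable _) ((hu.kernel κ).integrable _),
      g'.integral_kernel_invariant hu]
  rw [h1]
  have := norm_integral_le_of_norm_le_const (μ := m') (ae_of_all m' (hδ _ _ hu))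
  simpa using this

omit h in
theorem norm_mean_sub_le {κ' : Kernel X X} [IsMarkovKernel κ'] {m' : Measure X}
    [IsProbabilityMeasure m'] (g' : GeomErgodic κ' m' D ρ) {δ : ℝ}
    (hδ : ∀ (ψ : X → E) (B : ℝ), BddMeas ψ B →
      ∀ x, ‖∫ y, ψ y ∂(κ' x) - ∫ y, ψ y ∂(κ x)‖ ≤ B * δ)
    {φ φ' : X → E} {C δ' : ℝ} (h : BddMeas φ C) (h' : BddMeas φ' C)
    (hφ : ∀ x, ‖φ' x - φ x‖ ≤ δ') :
    ‖∫ x, φ' x ∂m' - ∫ x, φ x ∂m‖ ≤ δ' + C * D / (1 - ρ) * δ := by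
  have h1 : ∫ x, φ' x ∂m' - ∫ x, φ x ∂m =
      (∫ x, (φ' x - φ x) ∂m') + (∫ x, φ x ∂m' - ∫ x, φ x ∂m) := by
    rw [integral_sub (h'.integrable _) (h.integrable _)]; abel
  rw [h1]
  refine (norm_add_le _ _).trans (add_le_add ?_ (g.norm_integral_sub_le h g' hδ))
  exact BddMeas.norm_integral_le ⟨h'.meas.sub h.meas, hφ⟩ m'

omit h in
/-- Dependence of the solution of Poisson's equation on the kernel and the right-hand side. -/
theorem norm_poisson_sub_le {κ' : Kernel X X} [IsMarkovKernel κ'] {m' : Measure X}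
    [IsProbabilityMeasure m'] (g' : GeomErgodic κ' m' D ρ) {δ : ℝ}
    (hδ : ∀ (ψ : X → E) (B : ℝ), BddMeas ψ B →
      ∀ x, ‖∫ y, ψ y ∂(κ' x) - ∫ y, ψ y ∂(κ x)‖ ≤ B * δ)
    {φ φ' : X → E} {C δ' : ℝ} (h : BddMeas φ C) (h' : BddMeas φ' C)
    (hφ : ∀ x, ‖φ' x - φ x‖ ≤ δ') (x : X) :
    ‖poisson κ' m' φ' x - poisson κ m φ x‖ ≤
      (2 * δ' + 2 * (C * D / (1 - ρ)) * δ) * D / (1 - ρ) + C * D / (1 - ρ) * D / (1 - ρ) * δ := by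
  have hu := g.bddMeas_poisson h
  have hu' := g'.bddMeas_poisson h'
  have hw := hu'.sub hu
  have hmean := g.norm_mean_sub_le g' hδ h h' hφ
  -- The difference of the two solutions is almost harmonic for `κ'`. Its defect has three parts:
  -- the change of the right-hand side, the change of the mean, and the change of the kernel acting
  -- on the old solution.
  have hpo : ∀ x, ‖(poisson κ' m' φ' x - poisson κ m φ x) -
      ∫ y, (poisson κ' m' φ' y - poisson κ m φ y) ∂(κ' x)‖ ≤ 2 * δ' + 2 * (C * D / (1 - ρ)) * δ := by
    intro x
    have e1 := g.poisson_sub h x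
    have e2 := g'.poisson_sub h' x
    rw [integral_sub (hu'.integrable _) (hu.integrable _)]
    have e3 : poisson κ' m' φ' x - poisson κ m φ x -
        (∫ y, poisson κ' m' φ' y ∂(κ' x) - ∫ y, poisson κ m φ y ∂(κ' x)) =
        (φ' x - φ x) - (∫ y, φ' y ∂m' - ∫ y, φ y ∂m) +
        (∫ y, poisson κ m φ y ∂(κ' x) - ∫ y, poisson κ m φ y ∂(κ x)) := by
      have : ∀ a b c d e f k l : E, a - c = e → b - d = f → a - b - (c - k) = e - f + (k - d) := by
        rintro a b c d e f k l rfl rfl; abel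
      rw [this _ _ _ _ _ _ _ 0 e2 e1]; abel
    rw [e3]
    have t1 := hφ x
    have t2 := hδ _ _ hu x
    have t3 := norm_add_le ((φ' x - φ x) - (∫ y, φ' y ∂m' - ∫ y, φ y ∂m))
      (∫ y, poisson κ m φ y ∂(κ' x) - ∫ y, poisson κ m φ y ∂(κ x))
    have t4 := _root_.norm_sub_le (φ' x - φ x) (∫ y, φ' y ∂m' - ∫ y, φ y ∂m)
    linarith
  have hfin := g'.norm_sub_integral_le hw hpo x
  -- Almost harmonic functions are almost constant. The constant here is minus the `m'`-mean of the
  -- old solution, which is small because its `m`-mean is zero.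
  have hmw : ‖∫ x, (poisson κ' m' φ' x - poisson κ m φ x) ∂m'‖ ≤ C * D / (1 - ρ) * D / (1 - ρ) * δ := by
    rw [integral_sub (hu'.integrable _) (hu.integrable _), g'.integral_poisson h', zero_sub, norm_neg]
    have := g.norm_integral_sub_le hu g' hδ
    rwa [g.integral_poisson h, sub_zero] at this
  have t := norm_add_le (poisson κ' m' φ' x - poisson κ m φ x -
    ∫ x, (poisson κ' m' φ' x - poisson κ m φ x) ∂m')
    (∫ x, (poisson κ' m' φ' x - poisson κ m φ x) ∂m')
  rw [sub_add_cancel] at t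
  linarith

end GeomErgodic

end Poisson

/-! ### Exponential inequalities and gradients within a convex set. -/

section Calculus

/-- The tangent-line inequality at both points. The symmetric right-hand side is chosen because it
integrates to a constant when the exponentials are probability densities. -/
theorem abs_exp_sub_exp_le (a b : ℝ) :
    |Real.exp a - Real.exp b| ≤ |a - b| * (Real.exp a + Real.exp b) := by
  have key : ∀ a b : ℝ, Real.exp a - Real.exp b ≤ |a - b| * Real.exp a := by
    intro a b
    have h1 := Real.add_one_le_exp (b - a)
    have h2 : Real.exp b = Real.exp (b - a) * Real.exp a := by rw [← Real.exp_add]; ring_nf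
    have h3 : a - b ≤ |a - b| := le_abs_self _
    have h4 := Real.exp_pos a
    rw [h2]
    nlinarith
  have h1 := key a b
  have h2 := key b a
  rw [abs_sub_comm b a] at h2
  have h3 := mul_nonneg (abs_nonneg (a - b)) (Real.exp_pos a).le
  have h4 := mul_nonneg (abs_nonneg (a - b)) (Real.exp_pos b).le
  rw [abs_le]
  constructor <;> nlinarith

/-- Multiplying 1 - y ≤ exp(-y) by exp(y) bounds the remainder by y(exp(y) - 1), to which
`abs_exp_sub_exp_le` applies. -/
theorem abs_exp_sub_one_sub_le (y : ℝ) :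
    |Real.exp y - 1 - y| ≤ y ^ 2 * (Real.exp y + 1) := by
  have h1 := Real.add_one_le_exp y
  have h2 := Real.add_one_le_exp (-y)
  have h3 : Real.exp (-y) * Real.exp y = 1 := by rw [← Real.exp_add]; simp
  have h4 := abs_exp_sub_exp_le y 0
  rw [Real.exp_zero, sub_zero] at h4
  have h5 : Real.exp y - 1 - y ≤ y * (Real.exp y - 1) := by nlinarith [Real.exp_pos y]
  rw [abs_of_nonneg (by linarith)]
  refine h5.trans ((le_abs_self _).trans ?_)
  rw [abs_mul, ← sq_abs, sq, mul_assoc]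
  exact mul_le_mul_of_nonneg_left h4 (abs_nonneg y)

variable {n : ℕ} {Θ : Set (Euc n)}

/-- Both gradients computed below, that of the total mass of the policy and that of the average
cost, are found from an explicit quadratic remainder instead of differentiation under the integral.
-/
theorem hasGradientWithinAt_of_quadratic {f : Euc n → ℝ} {θ v : Euc n} {R : ℝ}
    (h : ∀ θ' ∈ Θ, |f θ' - f θ - inner ℝ v (θ' - θ)| ≤ R * ‖θ' - θ‖ ^ 2) :
    HasGradientWithinAt f v Θ θ := by
  rw [hasGradientWithinAt_iff_hasFDerivWithinAt, hasFDerivWithinAt_iff_isLittleO]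
  refine Asymptotics.IsBigO.trans_isLittleO (g := fun θ' => ‖θ' - θ‖ ^ 2) ?_ ?_
  · refine Asymptotics.IsBigO.of_bound R ?_
    filter_upwards [self_mem_nhdsWithin] with θ' hθ'
    simpa using h θ' hθ'
  · have : Tendsto (fun θ' : Euc n => θ' - θ) (𝓝[Θ] θ) (𝓝 0) := by
      have : Tendsto (fun θ' : Euc n => θ' - θ) (𝓝 θ) (𝓝 (θ - θ)) :=
        (continuous_id.sub continuous_const).tendsto θ
      rw [sub_self] at this
      exact this.mono_left nhdsWithin_le_nhds
    exact (Asymptotics.isLittleO_norm_pow_id one_lt_two).comp_tendsto this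

theorem gradientWithin_eq_of_hasGradientWithinAt {f : Euc n → ℝ} {θ v : Euc n}
    (hΘ : UniqueDiffWithinAt ℝ Θ θ) (h : HasGradientWithinAt f v Θ θ) :
    gradientWithin f Θ θ = v := by
  rw [gradientWithin, h.hasFDerivWithinAt.fderivWithin hΘ]
  simp

/-- Mean value inequality on the segment, which stays in `Θ` by convexity and along which the
gradient moves by at most L‖θ' - θ‖. -/
theorem abs_sub_sub_inner_gradientWithin_le {f : Euc n → ℝ} (hΘ : Convex ℝ Θ)
    (hf : DifferentiableOn ℝ f Θ) {L : ℝ≥0} (hL : LipschitzOnWith L (gradientWithin f Θ) Θ)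
    {θ θ' : Euc n} (hθ : θ ∈ Θ) (hθ' : θ' ∈ Θ) :
    |f θ' - f θ - inner ℝ (gradientWithin f Θ θ) (θ' - θ)| ≤ L * ‖θ' - θ‖ ^ 2 := by
  have hseg : segment ℝ θ θ' ⊆ Θ := hΘ.segment_subset hθ hθ'
  have h := Convex.norm_image_sub_le_of_norm_hasFDerivWithin_le' (𝕜 := ℝ) (f := f)
    (f' := fun z => (InnerProductSpace.toDual ℝ (Euc n)) (gradientWithin f Θ z))
    (φ := (InnerProductSpace.toDual ℝ (Euc n)) (gradientWithin f Θ θ))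
    (C := L * ‖θ' - θ‖) (s := segment ℝ θ θ') (x := θ) (y := θ') ?_ ?_
    (convex_segment θ θ') (left_mem_segment ℝ θ θ') (right_mem_segment ℝ θ θ')
  · simpa [sq, mul_assoc] using h
  · intro z hz
    exact ((hf z (hseg hz)).hasGradientWithinAt.hasFDerivWithinAt).mono hseg
  · intro z hz
    rw [← map_sub, LinearIsometryEquiv.norm_map]
    refine (hL.norm_sub_le (hseg hz) hθ).trans ?_
    refine mul_le_mul_of_nonneg_left ?_ L.2
    rw [segment_eq_image_lineMap] at hz
    obtain ⟨t, ⟨ht0, ht1⟩, rfl⟩ := hz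
    rw [AffineMap.lineMap_apply_module', add_sub_cancel_right, norm_smul, Real.norm_eq_abs,
      abs_of_nonneg ht0]
    exact mul_le_of_le_one_left (norm_nonneg _) ht1

/-- At an interior point the Lipschitz constant of `f` bounds the ordinary derivative. The Lipschitz
gradient carries this bound to the rest of `Θ`, boundary included. -/
theorem norm_gradientWithin_le {f : Euc n → ℝ} {K L : ℝ≥0} (hK : LipschitzOnWith K f Θ)
    (hL : LipschitzOnWith L (gradientWithin f Θ) Θ) {θ₀ θ : Euc n} (hθ₀ : θ₀ ∈ interior Θ)
    (hθ : θ ∈ Θ) : ‖gradientWithin f Θ θ‖ ≤ K + L * ‖θ - θ₀‖ := by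
  have h0 : ‖gradientWithin f Θ θ₀‖ ≤ K := by
    have hnhds : Θ ∈ 𝓝 θ₀ := mem_interior_iff_mem_nhds.1 hθ₀
    rw [gradientWithin, LinearIsometryEquiv.norm_map, fderivWithin_of_mem_nhds hnhds]
    exact norm_fderiv_le_of_lipschitzOn ℝ hnhds hK
  have h1 := hL.norm_sub_le hθ (interior_subset hθ₀)
  have h2 := norm_add_le (gradientWithin f Θ θ₀) (gradientWithin f Θ θ - gradientWithin f Θ θ₀)
  rw [add_sub_cancel] at h2
  linarith

end Calculus

/-! ### Dependence of the policy and of the one-step kernel on the parameter. -/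

section PolicyIntegrals

variable {nS nZ nA K n : ℕ} {S : Set (Euc nS)} {Z : Set (Euc nZ)} {A : Set (Euc nA)}
  {E : Type*} [NormedAddCommGroup E] [NormedSpace ℝ E]

namespace Policy

variable (π : Policy S Z A n)

theorem measurable_dens (θ : Euc n) (x : AugState S Z) : Measurable (π.dens θ x) :=
  π.dens_measurable.comp (measurable_const.prodMk (measurable_const.prodMk measurable_id))

theorem integrable_dens (θ : Euc n) (x : AugState S Z) : Integrable (π.dens θ x) π.ref := by
  refine ⟨(π.measurable_dens θ x).aestronglyMeasurable, ?_⟩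
  rw [hasFiniteIntegral_iff_ofReal (ae_of_all _ fun a => (π.dens_pos θ x a).le), π.dens_norm]
  exact ENNReal.one_lt_top

theorem integral_dens (θ : Euc n) (x : AugState S Z) : ∫ a, π.dens θ x a ∂π.ref = 1 := by
  rw [integral_eq_lintegral_of_nonneg_ae (ae_of_all _ fun a => (π.dens_pos θ x a).le)
    (π.measurable_dens θ x).aestronglyMeasurable, π.dens_norm, ENNReal.toReal_one]

theorem integral_kernel (θ : Euc n) (x : AugState S Z) (ψ : ↥A → E) :
    ∫ a, ψ a ∂(π.kernel θ x) = ∫ a, π.dens θ x a • ψ a ∂π.ref := by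
  have := π.ref_sigmaFinite
  have hm : Measurable (Function.uncurry fun x a => ENNReal.ofReal (π.dens θ x a)) :=
    ENNReal.measurable_ofReal.comp
      (π.dens_measurable.comp (measurable_const.prodMk measurable_id))
  rw [kernel, Kernel.withDensity_apply _ hm, Kernel.const_apply,
    integral_withDensity_eq_integral_toReal_smul
      (π.measurable_dens θ x).ennreal_ofReal
      (ae_of_all _ fun _ => ENNReal.ofReal_lt_top)]
  simp only [ENNReal.toReal_ofReal (π.dens_pos θ x _).le]

theorem integrable_dens_smul (θ : Euc n) (x : AugState S Z) {ψ : ↥A → E} {C : ℝ}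
    (h : BddMeas ψ C) : Integrable (fun a => π.dens θ x a • ψ a) π.ref :=
  (π.integrable_dens θ x).smul_bdd C h.meas.aestronglyMeasurable (ae_of_all _ h.bound)

variable {π} {Θ : Set (Euc n)} {L : ℝ≥0}

theorem abs_dens_sub_le (hL : ∀ x a, LipschitzOnWith L (fun θ => Real.log (π.dens θ x a)) Θ)
    {θ θ' : Euc n} (hθ : θ ∈ Θ) (hθ' : θ' ∈ Θ) (x : AugState S Z) (a : ↥A) :
    |π.dens θ' x a - π.dens θ x a| ≤ L * ‖θ' - θ‖ * (π.dens θ' x a + π.dens θ x a) := by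
  have h := abs_exp_sub_exp_le (Real.log (π.dens θ' x a)) (Real.log (π.dens θ x a))
  rw [Real.exp_log (π.dens_pos _ _ _), Real.exp_log (π.dens_pos _ _ _)] at h
  refine h.trans (mul_le_mul_of_nonneg_right ?_ ?_)
  · exact (hL x a).norm_sub_le hθ' hθ
  · exact (add_pos (π.dens_pos _ _ _) (π.dens_pos _ _ _)).le

/-- The densities differ pointwise by at most L‖θ' - θ‖ times their sum, and each has mass one;
hence the factor 2. -/
theorem norm_integral_kernel_sub_le
    (hL : ∀ x a, LipschitzOnWith L (fun θ => Real.log (π.dens θ x a)) Θ)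
    {θ θ' : Euc n} (hθ : θ ∈ Θ) (hθ' : θ' ∈ Θ) (x : AugState S Z) {ψ : ↥A → E} {C : ℝ}
    (h : BddMeas ψ C) :
    ‖∫ a, ψ a ∂(π.kernel θ' x) - ∫ a, ψ a ∂(π.kernel θ x)‖ ≤ C * (2 * L * ‖θ' - θ‖) := by
  rw [π.integral_kernel, π.integral_kernel, ← integral_sub (π.integrable_dens_smul θ' x h)
    (π.integrable_dens_smul θ x h)]
  have hI : Integrable (fun a => L * ‖θ' - θ‖ * (π.dens θ' x a + π.dens θ x a) * C) π.ref :=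
    (((π.integrable_dens θ' x).add (π.integrable_dens θ x)).const_mul _).mul_const _
  refine (norm_integral_le_of_norm_le hI (ae_of_all _ fun a => ?_)).trans_eq ?_
  · rw [← sub_smul, norm_smul]
    exact mul_le_mul (abs_dens_sub_le hL hθ hθ' x a) (h.bound a) (norm_nonneg _)
      ((abs_nonneg _).trans (abs_dens_sub_le hL hθ hθ' x a))
  · rw [integral_mul_const, integral_const_mul,
      integral_add (π.integrable_dens θ' x) (π.integrable_dens θ x), π.integral_dens,
      π.integral_dens]
    ring

/-- With y the log-ratio of the densities, the new density is the old one times exp(y). The error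
splits into exp(y) - 1 - y, quadratic since |y| ≤ L‖θ' - θ‖, and y minus its linearization,
quadratic since the score is Lipschitz. -/
theorem abs_integral_kernel_sub_sub_inner_le (hΘ : Convex ℝ Θ)
    (hd : ∀ x a, DifferentiableOn ℝ (fun θ => Real.log (π.dens θ x a)) Θ)
    (hL : ∀ x a, LipschitzOnWith L (fun θ => Real.log (π.dens θ x a)) Θ) {L' : ℝ≥0}
    (hL' : ∀ x a, LipschitzOnWith L' (fun θ => π.score Θ θ x a) Θ)
    {θ θ' : Euc n} (hθ : θ ∈ Θ) (hθ' : θ' ∈ Θ) (x : AugState S Z) {sb : ℝ}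
    (hs : BddMeas (π.score Θ θ x) sb) {ψ : ↥A → ℝ} {C : ℝ} (h : BddMeas ψ C) :
    |∫ a, ψ a ∂(π.kernel θ' x) - ∫ a, ψ a ∂(π.kernel θ x) -
      inner ℝ (∫ a, ψ a • π.score Θ θ x a ∂(π.kernel θ x)) (θ' - θ)| ≤
      C * (2 * (L : ℝ) ^ 2 + L') * ‖θ' - θ‖ ^ 2 := by
  have hinner : inner ℝ (∫ a, ψ a • π.score Θ θ x a ∂(π.kernel θ x)) (θ' - θ) =
      ∫ a, ψ a * inner ℝ (π.score Θ θ x a) (θ' - θ) ∂(π.kernel θ x) := by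
    rw [real_inner_comm, ← integral_inner ((h.smul hs).integrable _)]
    refine integral_congr_ae (ae_of_all _ fun a => ?_)
    simp only [real_inner_comm, inner_smul_left, RCLike.conj_to_real]
  have hb : BddMeas (fun a => ψ a * inner ℝ (π.score Θ θ x a) (θ' - θ)) (C * (sb * ‖θ' - θ‖)) :=
    h.smul ⟨hs.meas.inner stronglyMeasurable_const, fun a =>
      (norm_inner_le_norm _ _).trans (mul_le_mul_of_nonneg_right (hs.bound a) (norm_nonneg _))⟩
  have i1 := π.integrable_dens_smul θ' x h
  have i2 := π.integrable_dens_smul θ x h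
  have i3 := π.integrable_dens_smul θ x hb
  have i12 : Integrable (fun a => π.dens θ' x a • ψ a - π.dens θ x a • ψ a) π.ref := i1.sub i2
  rw [hinner, π.integral_kernel, π.integral_kernel, π.integral_kernel, ← integral_sub i1 i2,
    ← integral_sub i12 i3]
  set r := ‖θ' - θ‖ with hr
  have j1 := π.integrable_dens θ' x
  have j2 := π.integrable_dens θ x
  have hI : Integrable (fun a => (L ^ 2 * r ^ 2 * (π.dens θ' x a + π.dens θ x a) +
      L' * r ^ 2 * π.dens θ x a) * C) π.ref :=
    (((j1.add j2).const_mul _).add (j2.const_mul _)).mul_const _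
  rw [← Real.norm_eq_abs]
  refine (norm_integral_le_of_norm_le hI (ae_of_all _ fun a => ?_)).trans_eq ?_
  · have e1 : (π.dens θ' x a • ψ a - π.dens θ x a • ψ a) -
        π.dens θ x a • (ψ a * inner ℝ (π.score Θ θ x a) (θ' - θ)) =
        (π.dens θ' x a - π.dens θ x a -
          π.dens θ x a * inner ℝ (π.score Θ θ x a) (θ' - θ)) * ψ a := by
      simp only [smul_eq_mul]; ring
    change ‖(π.dens θ' x a • ψ a - π.dens θ x a • ψ a) -
        π.dens θ x a • (ψ a * inner ℝ (π.score Θ θ x a) (θ' - θ))‖ ≤ _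
    rw [e1, norm_mul]
    have hp := π.dens_pos θ x a
    have hp' := π.dens_pos θ' x a
    set y := Real.log (π.dens θ' x a) - Real.log (π.dens θ x a) with hy
    have hexp : π.dens θ x a * Real.exp y = π.dens θ' x a := by
      rw [hy, Real.exp_sub, Real.exp_log hp, Real.exp_log hp']; field_simp
    have hyL : |y| ≤ L * r := (hL x a).norm_sub_le hθ' hθ
    have hyS : |y - inner ℝ (π.score Θ θ x a) (θ' - θ)| ≤ L' * r ^ 2 :=
      abs_sub_sub_inner_gradientWithin_le hΘ (hd x a) (hL' x a) hθ hθ'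
    have hy2 : y ^ 2 ≤ L ^ 2 * r ^ 2 := by
      rw [← mul_pow, ← sq_abs]; exact pow_le_pow_left₀ (abs_nonneg _) hyL 2
    have e2 := abs_exp_sub_one_sub_le y
    have e3 : π.dens θ' x a - π.dens θ x a - π.dens θ x a * inner ℝ (π.score Θ θ x a) (θ' - θ) =
        π.dens θ x a * (Real.exp y - 1 - y) +
          π.dens θ x a * (y - inner ℝ (π.score Θ θ x a) (θ' - θ)) := by
      rw [← hexp]; ring
    refine mul_le_mul ?_ (h.bound a) (norm_nonneg _) (by positivity)
    rw [e3]
    refine (norm_add_le _ _).trans (add_le_add ?_ ?_)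
    · rw [norm_mul, Real.norm_eq_abs, Real.norm_eq_abs, abs_of_pos hp]
      calc π.dens θ x a * |Real.exp y - 1 - y| ≤ π.dens θ x a * (y ^ 2 * (Real.exp y + 1)) := by
            gcongr
        _ = y ^ 2 * (π.dens θ' x a + π.dens θ x a) := by rw [← hexp]; ring
        _ ≤ _ := by gcongr
    · rw [norm_mul, Real.norm_eq_abs, Real.norm_eq_abs, abs_of_pos hp, mul_comm]
      gcongr
  · have k1 : Integrable (fun a => (L : ℝ) ^ 2 * r ^ 2 * (π.dens θ' x a + π.dens θ x a)) π.ref :=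
      (j1.add j2).const_mul _
    rw [integral_mul_const, integral_add k1 (j2.const_mul _), integral_const_mul,
      integral_const_mul, integral_add j1 j2, π.integral_dens, π.integral_dens]
    ring

/-- The score has mean zero. -/
theorem integral_score (hΘ : Convex ℝ Θ) (hint : (interior Θ).Nonempty)
    (hd : ∀ x a, DifferentiableOn ℝ (fun θ => Real.log (π.dens θ x a)) Θ)
    (hL : ∀ x a, LipschitzOnWith L (fun θ => Real.log (π.dens θ x a)) Θ) {L' : ℝ≥0}
    (hL' : ∀ x a, LipschitzOnWith L' (fun θ => π.score Θ θ x a) Θ)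
    {θ : Euc n} (hθ : θ ∈ Θ) (x : AugState S Z) {sb : ℝ} (hs : BddMeas (π.score Θ θ x) sb) :
    ∫ a, π.score Θ θ x a ∂(π.kernel θ x) = 0 := by
  have hU := uniqueDiffOn_convex hΘ hint θ hθ
  -- For the integrand 1 the zeroth-order difference vanishes, so the expansion exhibits the mean
  -- score as a gradient of the zero function; gradients within `Θ` are unique.
  rw [← gradientWithin_eq_of_hasGradientWithinAt hU (f := fun _ => (0 : ℝ))
    (v := ∫ a, π.score Θ θ x a ∂(π.kernel θ x))]
  · rw [gradientWithin]; simp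
  · refine hasGradientWithinAt_of_quadratic (R := ‖(1 : ℝ)‖ * (2 * (L : ℝ) ^ 2 + L'))
      fun θ' hθ' => ?_
    have := abs_integral_kernel_sub_sub_inner_le hΘ hd hL hL' hθ hθ' x hs
      (BddMeas.const (X := ↥A) (1 : ℝ))
    simpa using this

end Policy

namespace CMDP

variable (M : CMDP S Z A K) (π : Policy S Z A n)

theorem iterKernel_eq (θ : Euc n) (t : ℕ) :
    M.iterKernel π θ t = kernelPow (M.stateKernel π θ) t := by
  induction t with
  | zero => rfl
  | succ t ih => rw [iterKernel, ih, kernelPow]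

theorem integral_stepKernel (θ : Euc n) (x : AugState S Z) {φ : ↥A × AugState S Z → E} {C : ℝ}
    (h : BddMeas φ C) :
    ∫ p, φ p ∂(M.stepKernel π θ x) =
      ∫ a, ∫ x', φ (a, x') ∂(M.augTrans (x, a)) ∂(π.kernel θ x) := by
  rw [stepKernel, ProbabilityTheory.integral_compProd (h.integrable _)]

theorem integral_stateKernel (θ : Euc n) (x : AugState S Z) {φ : AugState S Z → E} {C : ℝ}
    (h : BddMeas φ C) :
    ∫ y, φ y ∂(M.stateKernel π θ x) = ∫ p, φ p.2 ∂(M.stepKernel π θ x) := by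
  rw [stateKernel, Kernel.snd_apply, integral_map measurable_snd.aemeasurable
    h.meas.aestronglyMeasurable]

theorem bddMeas_augTrans {φ : ↥A × AugState S Z → E} {C : ℝ} (h : BddMeas φ C)
    (x : AugState S Z) : BddMeas (fun a => ∫ x', φ (a, x') ∂(M.augTrans (x, a))) C := by
  constructor
  · have h1 : StronglyMeasurable (fun q : (AugState S Z × ↥A) × AugState S Z => φ (q.1.2, q.2)) :=
      h.meas.comp_measurable (by fun_prop)
    exact (h1.integral_kernel_prod_right' (κ := M.augTrans)).comp_measurable
      (measurable_const.prodMk measurable_id)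
  · intro a
    exact (h.comp (measurable_const.prodMk measurable_id)).norm_integral_le _

variable {π} {Θ : Set (Euc n)} {L : ℝ≥0}

theorem norm_integral_stepKernel_sub_le
    (hL : ∀ x a, LipschitzOnWith L (fun θ => Real.log (π.dens θ x a)) Θ)
    {θ θ' : Euc n} (hθ : θ ∈ Θ) (hθ' : θ' ∈ Θ) (x : AugState S Z) {φ : ↥A × AugState S Z → E}
    {C : ℝ} (h : BddMeas φ C) :
    ‖∫ p, φ p ∂(M.stepKernel π θ' x) - ∫ p, φ p ∂(M.stepKernel π θ x)‖ ≤
      C * (2 * L * ‖θ' - θ‖) := by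
  rw [M.integral_stepKernel π θ' x h, M.integral_stepKernel π θ x h]
  exact Policy.norm_integral_kernel_sub_le hL hθ hθ' x (M.bddMeas_augTrans h x)

theorem norm_integral_stateKernel_sub_le
    (hL : ∀ x a, LipschitzOnWith L (fun θ => Real.log (π.dens θ x a)) Θ)
    {θ θ' : Euc n} (hθ : θ ∈ Θ) (hθ' : θ' ∈ Θ) (φ : AugState S Z → E)
    (C : ℝ) (h : BddMeas φ C) (x : AugState S Z) :
    ‖∫ y, φ y ∂(M.stateKernel π θ' x) - ∫ y, φ y ∂(M.stateKernel π θ x)‖ ≤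
      C * (2 * L * ‖θ' - θ‖) := by
  rw [M.integral_stateKernel π θ' x h, M.integral_stateKernel π θ x h]
  exact M.norm_integral_stepKernel_sub_le hL hθ hθ' x (h.comp measurable_snd)

end CMDP

end PolicyIntegrals

/-! ### Calculus of bounded Lipschitz families. -/

section Families

variable {n : ℕ} {Θ : Set (Euc n)} {X Y E : Type*} [MeasurableSpace X] [MeasurableSpace Y]
  [NormedAddCommGroup E]

/-- Families of measurable functions, indexed by the parameters, that are uniformly bounded and
uniformly Lipschitz in the parameter. -/
structure LipFamily (φ : ↥Θ → X → E) : Prop where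
  bdd : ∃ C, 0 ≤ C ∧ ∀ θ, BddMeas (φ θ) C
  lip : ∃ C, 0 ≤ C ∧ ∀ θ θ' x, ‖φ θ' x - φ θ x‖ ≤ C * ‖(θ' : Euc n) - θ‖

/-- The maxima with 0 give nonnegative constants even if there is no point that would force the
sign. -/
theorem LipFamily.of_bound {φ : ↥Θ → X → E} {C D : ℝ} (hC : ∀ θ, BddMeas (φ θ) C)
    (hD : ∀ θ θ' x, ‖φ θ' x - φ θ x‖ ≤ D * ‖(θ' : Euc n) - θ‖) : LipFamily φ :=
  ⟨⟨max C 0, le_max_right _ _, fun θ => (hC θ).mono (le_max_left _ _)⟩,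
    ⟨max D 0, le_max_right _ _, fun θ θ' x => (hD θ θ' x).trans
      (mul_le_mul_of_nonneg_right (le_max_left _ _) (norm_nonneg _))⟩⟩

namespace LipFamily

variable {φ ψ : ↥Θ → X → E}

theorem const {f : X → E} {C : ℝ} (h : BddMeas f C) : LipFamily (fun _ : ↥Θ => f) :=
  LipFamily.of_bound (D := 0) (fun _ => h) (by simp)

theorem add (h : LipFamily φ) (h' : LipFamily ψ) : LipFamily (fun θ x => φ θ x + ψ θ x) := by
  obtain ⟨⟨C, -, hC⟩, ⟨D, -, hD⟩⟩ := h
  obtain ⟨⟨C', -, hC'⟩, ⟨D', -, hD'⟩⟩ := h'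
  refine .of_bound (C := C + C') (D := D + D') (fun θ => (hC θ).add (hC' θ)) fun θ θ' x => ?_
  rw [add_sub_add_comm, add_mul]
  exact (norm_add_le _ _).trans (add_le_add (hD θ θ' x) (hD' θ θ' x))

theorem sub (h : LipFamily φ) (h' : LipFamily ψ) : LipFamily (fun θ x => φ θ x - ψ θ x) := by
  obtain ⟨⟨C, -, hC⟩, ⟨D, -, hD⟩⟩ := h
  obtain ⟨⟨C', -, hC'⟩, ⟨D', -, hD'⟩⟩ := h'
  refine .of_bound (C := C + C') (D := D + D') (fun θ => (hC θ).sub (hC' θ)) fun θ θ' x => ?_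
  rw [sub_sub_sub_comm, add_mul]
  exact (norm_sub_le _ _).trans (add_le_add (hD θ θ' x) (hD' θ θ' x))

theorem comp (h : LipFamily φ) {g : Y → X} (hg : Measurable g) :
    LipFamily (fun θ y => φ θ (g y)) := by
  obtain ⟨⟨C, -, hC⟩, ⟨D, -, hD⟩⟩ := h
  exact .of_bound (fun θ => (hC θ).comp hg) fun θ θ' y => hD θ θ' (g y)

variable [NormedSpace ℝ E]

theorem smul {c : ↥Θ → X → ℝ} (hc : LipFamily c) (h : LipFamily φ) :
    LipFamily (fun θ x => c θ x • φ θ x) := by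
  obtain ⟨⟨C, hC0, hC⟩, ⟨D, hD0, hD⟩⟩ := hc
  obtain ⟨⟨C', hC0', hC'⟩, ⟨D', hD0', hD'⟩⟩ := h
  refine .of_bound (C := C * C') (D := D * C' + C * D') (fun θ => (hC θ).smul (hC' θ))
    fun θ θ' x => ?_
  have e : c θ' x • φ θ' x - c θ x • φ θ x =
      (c θ' x - c θ x) • φ θ' x + c θ x • (φ θ' x - φ θ x) := by
    rw [sub_smul, smul_sub]; abel
  rw [e]
  refine (norm_add_le _ _).trans ?_
  rw [norm_smul, norm_smul]
  have h1 := mul_le_mul (hD θ θ' x) ((hC' θ').bound x) (norm_nonneg _)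
    (mul_nonneg hD0 (norm_nonneg _))
  have h2 := mul_le_mul ((hC θ).bound x) (hD' θ θ' x) (norm_nonneg _) hC0
  calc _ ≤ _ := add_le_add h1 h2
    _ = _ := by ring

theorem kernel (h : LipFamily φ) (κ : Kernel Y X) [IsMarkovKernel κ] :
    LipFamily (fun θ y => ∫ x, φ θ x ∂(κ y)) := by
  obtain ⟨⟨C, -, hC⟩, ⟨D, -, hD⟩⟩ := h
  refine .of_bound (D := D) (fun θ => (hC θ).kernel κ) fun θ θ' y => ?_
  rw [← integral_sub ((hC θ').integrable _) ((hC θ).integrable _)]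
  exact BddMeas.norm_integral_le ⟨(hC θ').meas.sub (hC θ).meas, hD θ θ'⟩ _

-- Continuity in the parameter and measurability in the other variable give joint measurability.
-- Averages under the stationary laws thereby become measurable in θ although the laws themselves
-- are picked by choice.
omit [NormedSpace ℝ E] in
theorem stronglyMeasurable_uncurry (h : LipFamily φ) :
    StronglyMeasurable (Function.uncurry φ) := by
  obtain ⟨⟨C, -, hC⟩, ⟨D, hD0, hD⟩⟩ := h
  refine stronglyMeasurable_uncurry_of_continuous_of_stronglyMeasurable (fun x => ?_)
    fun θ => (hC θ).meas
  refine LipschitzWith.continuous (K := D.toNNReal) (LipschitzWith.of_dist_le_mul fun θ' θ => ?_)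
  rw [dist_eq_norm, Real.coe_toNNReal _ hD0, Subtype.dist_eq, dist_eq_norm]
  exact hD θ θ' x

end LipFamily

end Families

/-! ### Stability of Lipschitz families under policy averages, Poisson solutions and stationary
means. -/

section Regularity

variable {nS nZ nA K n : ℕ} {S : Set (Euc nS)} {Z : Set (Euc nZ)} {A : Set (Euc nA)}
  {E : Type*} [NormedAddCommGroup E] [NormedSpace ℝ E]

/-- The assumptions on the problem together with a choice of the stationary laws. -/
structure Regularity (M : CMDP S Z A K) (π : Policy S Z A n) (Θ : Set (Euc n)) (lam ρ : ℝ)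
    (m : ↥Θ → ProbabilityMeasure (AugState S Z)) : Prop where
  problem : ProblemAssumptions M π Θ lam ρ
  ergodic : ∀ θ : ↥Θ, GeomErgodic (M.stateKernel π θ) (m θ : Measure (AugState S Z)) lam ρ

theorem ProblemAssumptions.exists_regularity {M : CMDP S Z A K} {π : Policy S Z A n}
    {Θ : Set (Euc n)} {lam ρ : ℝ} (h : ProblemAssumptions M π Θ lam ρ) :
    ∃ m, Regularity M π Θ lam ρ m := by
  choose m hm using fun θ : ↥Θ => h.ergodic θ θ.2
  refine ⟨m, h, fun θ => ⟨(hm θ).1, fun x t => ?_, h.lam_pos.le, h.ρ_pos.le, h.ρ_lt_one⟩⟩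
  simp_rw [← CMDP.iterKernel_eq]
  exact (hm θ).2 x t

namespace Regularity

variable {M : CMDP S Z A K} {π : Policy S Z A n} {Θ : Set (Euc n)} {lam ρ : ℝ}
  {m : ↥Θ → ProbabilityMeasure (AugState S Z)}

theorem lipFamily_policy (R : Regularity M π Θ lam ρ m) {φ : ↥Θ → AugState S Z × ↥A → E}
    (h : LipFamily φ) : LipFamily (fun θ x => ∫ a, φ θ (x, a) ∂(π.kernel θ x)) := by
  obtain ⟨L, hL⟩ := R.problem.policy_lipschitz
  obtain ⟨⟨C, -, hC⟩, ⟨D, -, hD⟩⟩ := h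
  have hx : ∀ θ x, BddMeas (fun a => φ θ (x, a)) C := fun θ x =>
    (hC θ).comp (measurable_const.prodMk measurable_id)
  refine .of_bound (C := C) (D := D + C * (2 * L)) (fun θ => ⟨?_, fun x => ?_⟩) fun θ θ' x => ?_
  · exact (hC θ).meas.integral_kernel_prod_right' (κ := π.kernel θ)
  · exact (hx θ x).norm_integral_le _
  · have e : ∫ a, φ θ' (x, a) ∂(π.kernel θ' x) - ∫ a, φ θ (x, a) ∂(π.kernel θ x) =
        ∫ a, (φ θ' (x, a) - φ θ (x, a)) ∂(π.kernel θ' x) +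
          (∫ a, φ θ (x, a) ∂(π.kernel θ' x) - ∫ a, φ θ (x, a) ∂(π.kernel θ x)) := by
      rw [integral_sub ((hx θ' x).integrable _) ((hx θ x).integrable _)]; abel
    rw [e, add_mul]
    refine (norm_add_le _ _).trans (add_le_add ?_ ?_)
    · exact BddMeas.norm_integral_le
        ⟨(hx θ' x).meas.sub (hx θ x).meas, fun a => hD θ θ' (x, a)⟩ _
    · rw [mul_assoc]
      exact Policy.norm_integral_kernel_sub_le hL θ.2 θ'.2 x (hx θ x)

/-- An interior base point and the boundedness of `Θ` turn the two Lipschitz hypotheses into a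
uniform bound on the score. -/
theorem lipFamily_score (R : Regularity M π Θ lam ρ m) :
    LipFamily (fun (θ : ↥Θ) (p : AugState S Z × ↥A) => π.score Θ θ p.1 p.2) := by
  obtain ⟨L, hL⟩ := R.problem.policy_lipschitz
  obtain ⟨L', hL'⟩ := R.problem.score_lipschitz
  obtain ⟨θ₀, hθ₀⟩ := R.problem.interior_Θ
  obtain ⟨r, hr⟩ := R.problem.compact_Θ.isBounded.subset_closedBall θ₀
  refine .of_bound (C := L + L' * r) (D := L') (fun θ => ⟨?_, fun p => ?_⟩) fun θ θ' p => ?_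
  · exact (R.problem.score_measurable.comp
      (measurable_const.prodMk measurable_id : Measurable fun p : AugState S Z × ↥A =>
        ((θ : Euc n), p))).stronglyMeasurable
  · refine (norm_gradientWithin_le (hL p.1 p.2) (hL' p.1 p.2) hθ₀ θ.2).trans ?_
    have : ‖(θ : Euc n) - θ₀‖ ≤ r := by rw [← dist_eq_norm]; exact hr θ.2
    gcongr
  · exact (hL' p.1 p.2).norm_sub_le θ'.2 θ.2

variable [CompleteSpace E]

/-- The constants of ergodicity are the same for all parameters, so the perturbation bound with
kernel distance 2L‖θ' - θ‖ is uniform. -/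
theorem lipFamily_poisson (R : Regularity M π Θ lam ρ m) {φ : ↥Θ → AugState S Z → E}
    (h : LipFamily φ) :
    LipFamily (fun θ => poisson (M.stateKernel π θ) (m θ : Measure (AugState S Z)) (φ θ)) := by
  obtain ⟨L, hL⟩ := R.problem.policy_lipschitz
  obtain ⟨⟨C, -, hC⟩, ⟨D, -, hD⟩⟩ := h
  refine .of_bound (C := C * lam / (1 - ρ))
    (D := (2 * D + 2 * (C * lam / (1 - ρ)) * (2 * L)) * lam / (1 - ρ) +
      C * lam / (1 - ρ) * lam / (1 - ρ) * (2 * L))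
    (fun θ => (R.ergodic θ).bddMeas_poisson (hC θ)) fun θ θ' x => ?_
  refine ((R.ergodic θ).norm_poisson_sub_le (R.ergodic θ') (δ := 2 * L * ‖(θ' : Euc n) - θ‖)
    (fun ψ B hB x => M.norm_integral_stateKernel_sub_le hL θ.2 θ'.2 ψ B hB x) (hC θ) (hC θ')
    (fun x => hD θ θ' x) x).trans_eq ?_
  ring

/-- The dummy variable lets functions of the parameter alone take part in the calculus of families.
-/
theorem lipFamily_mean (R : Regularity M π Θ lam ρ m) {φ : ↥Θ → AugState S Z → E}
    (h : LipFamily φ) {Y : Type*} [MeasurableSpace Y] :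
    LipFamily (fun θ (_ : Y) => ∫ x, φ θ x ∂(m θ : Measure (AugState S Z))) := by
  obtain ⟨L, hL⟩ := R.problem.policy_lipschitz
  obtain ⟨⟨C, -, hC⟩, ⟨D, -, hD⟩⟩ := h
  refine .of_bound (C := C) (D := D + C * lam / (1 - ρ) * (2 * L))
    (fun θ => ⟨stronglyMeasurable_const, fun _ => (hC θ).norm_integral_le _⟩) fun θ θ' _ => ?_
  refine ((R.ergodic θ).norm_mean_sub_le (R.ergodic θ') (δ := 2 * L * ‖(θ' : Euc n) - θ‖)
    (fun ψ B hB x => M.norm_integral_stateKernel_sub_le hL θ.2 θ'.2 ψ B hB x) (hC θ) (hC θ')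
    (fun x => hD θ θ' x)).trans_eq ?_
  ring

end Regularity

end Regularity

/-! ### Differential values, the policy gradient theorem and the surrogate action value. -/

section Values

variable {nS nZ nA K n : ℕ} {S : Set (Euc nS)} {Z : Set (Euc nZ)} {A : Set (Euc nA)}

namespace CMDP

variable (M : CMDP S Z A K) (π : Policy S Z A n) {Θ : Set (Euc n)}
  (m : ↥Θ → ProbabilityMeasure (AugState S Z)) (k : Fin (K + 1))

/-- Average of the reshaped cost under the stationary law. -/
def avgCost (θ : ↥Θ) : ℝ := ∫ x, M.meanCost π θ k x ∂(m θ : Measure (AugState S Z))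

/-- Differential value function. -/
def value (θ : ↥Θ) : AugState S Z → ℝ :=
  poisson (M.stateKernel π θ) (m θ : Measure (AugState S Z)) (M.meanCost π θ k)

/-- Cost of one step, centered, plus the value of the next state. -/
def target (θ : ↥Θ) (x : AugState S Z) (p : ↥A × AugState S Z) : ℝ :=
  M.reshapedCost k x p.1 p.2 - M.avgCost π m k θ + M.value π m k θ p.2

/-- Differential action-value function. -/
def qValue (θ : ↥Θ) (p : AugState S Z × ↥A) : ℝ :=
  ∫ x', M.target π m k θ p.1 (p.2, x') ∂(M.augTrans p)

/-- Conditional mean of the action value times the score. -/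
def gradTerm (θ : ↥Θ) (x : AugState S Z) : Euc n :=
  ∫ a, M.qValue π m k θ (x, a) • π.score Θ θ x a ∂(π.kernel θ x)

/-- Solution of Poisson's equation for `gradTerm`. -/
def gradValue (θ : ↥Θ) : AugState S Z → Euc n :=
  poisson (M.stateKernel π θ) (m θ : Measure (AugState S Z)) (M.gradTerm π m k θ)

end CMDP

namespace Regularity

variable {M : CMDP S Z A K} {π : Policy S Z A n} {Θ : Set (Euc n)} {lam ρ : ℝ}
  {m : ↥Θ → ProbabilityMeasure (AugState S Z)} (R : Regularity M π Θ lam ρ m) (k : Fin (K + 1))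
include R

theorem exists_bddMeas_reshapedCost : ∃ C, BddMeas
    (fun p : (AugState S Z × ↥A) × AugState S Z => M.reshapedCost k p.1.1 p.1.2 p.2) C := by
  obtain ⟨c, hc⟩ := R.problem.cost_bounded
  refine ⟨c, Measurable.stronglyMeasurable ?_, fun p => hc k _ _ _⟩
  have h1 : Measurable fun p : (AugState S Z × ↥A) × AugState S Z => M.cost k p.1.1.1 p.1.2 :=
    (M.cost_measurable k).comp (g := fun p : ↥S × ↥A => M.cost k p.1 p.2)
      (f := fun p : (AugState S Z × ↥A) × AugState S Z => (p.1.1.1, p.1.2)) (by fun_prop)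
  have h2 : Measurable fun p : (AugState S Z × ↥A) × AugState S Z => M.potential k p.2 :=
    (M.potential_measurable k).comp (by fun_prop)
  have h3 : Measurable fun p : (AugState S Z × ↥A) × AugState S Z => M.potential k p.1.1 :=
    (M.potential_measurable k).comp (by fun_prop)
  exact h1.add (h2.sub h3)

omit R in
theorem bddMeas_slice {E : Type*} [NormedAddCommGroup E]
    {φ : (AugState S Z × ↥A) × AugState S Z → E} {C : ℝ} (h : BddMeas φ C)
    (x : AugState S Z) : BddMeas (fun p : ↥A × AugState S Z => φ ((x, p.1), p.2)) C :=
  h.comp (g := fun p : ↥A × AugState S Z => ((x, p.1), p.2)) (by fun_prop)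

omit R in
theorem bddMeas_integral_augTrans {φ : (AugState S Z × ↥A) × AugState S Z → ℝ} {C : ℝ}
    (h : BddMeas φ C) : BddMeas (fun p => ∫ x', φ (p, x') ∂(M.augTrans p)) C :=
  ⟨h.meas.integral_kernel_prod_right' (κ := M.augTrans), fun _ =>
    (h.comp (measurable_const.prodMk measurable_id)).norm_integral_le _⟩

theorem exists_bddMeas_expCost_zero :
    ∃ C, BddMeas (fun p : AugState S Z × ↥A =>
      ∫ x', M.reshapedCost k p.1 p.2 x' ∂(M.augTrans p)) C := by
  obtain ⟨C, hC⟩ := R.exists_bddMeas_reshapedCost k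
  exact ⟨C, bddMeas_integral_augTrans hC⟩

theorem meanCost_eq (θ : Euc n) (x : AugState S Z) : M.meanCost π θ k x =
    ∫ a, ∫ x', M.reshapedCost k x a x' ∂(M.augTrans (x, a)) ∂(π.kernel θ x) := by
  obtain ⟨C, hC⟩ := R.exists_bddMeas_reshapedCost k
  exact M.integral_stepKernel π θ x (bddMeas_slice hC x)

theorem lipFamily_meanCost : LipFamily (fun θ : ↥Θ => M.meanCost π θ k) := by
  obtain ⟨C, hC⟩ := R.exists_bddMeas_expCost_zero k
  convert R.lipFamily_policy (LipFamily.const hC) using 3 with θ x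
  exact R.meanCost_eq k θ x

theorem lipFamily_value : LipFamily (M.value π m k) := R.lipFamily_poisson (R.lipFamily_meanCost k)

theorem lipFamily_avgCost {Y : Type*} [MeasurableSpace Y] :
    LipFamily (fun θ (_ : Y) => M.avgCost π m k θ) :=
  R.lipFamily_mean (R.lipFamily_meanCost k)

theorem qValue_eq (θ : ↥Θ) (p : AugState S Z × ↥A) : M.qValue π m k θ p =
    ∫ x', M.reshapedCost k p.1 p.2 x' ∂(M.augTrans p) - M.avgCost π m k θ +
      ∫ x', M.value π m k θ x' ∂(M.augTrans p) := by
  obtain ⟨C, hC⟩ := R.exists_bddMeas_reshapedCost k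
  obtain ⟨⟨D, -, hD⟩, -⟩ := R.lipFamily_value k
  have h1 : BddMeas (fun x' => M.reshapedCost k p.1 p.2 x') C :=
    hC.comp (measurable_const.prodMk measurable_id)
  have h2 := h1.sub (BddMeas.const (X := AugState S Z) (M.avgCost π m k θ))
  have e1 := integral_add (h2.integrable (M.augTrans p)) ((hD θ).integrable (M.augTrans p))
  have e2 := integral_sub (h1.integrable (M.augTrans p))
    ((BddMeas.const (X := AugState S Z) (M.avgCost π m k θ)).integrable (M.augTrans p))
  simp only [integral_const, probReal_univ, one_smul] at e2
  rw [← e2, ← e1]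
  rfl

theorem lipFamily_qValue : LipFamily (M.qValue π m k) := by
  obtain ⟨C, hC⟩ := R.exists_bddMeas_expCost_zero k
  have h := ((LipFamily.const (Θ := Θ) hC).sub (R.lipFamily_avgCost k)).add
    ((R.lipFamily_value k).kernel M.augTrans)
  convert h using 3 with θ p
  exact R.qValue_eq k θ p

theorem lipFamily_gradTerm : LipFamily (M.gradTerm π m k) :=
  R.lipFamily_policy ((R.lipFamily_qValue k).smul R.lipFamily_score)

theorem lipFamily_gradValue : LipFamily (M.gradValue π m k) :=
  R.lipFamily_poisson (R.lipFamily_gradTerm k)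

/-- One step of the differential value recursion, under a policy that may differ from the one of
the value function. -/
theorem integral_qValue (θ : ↥Θ) (θ' : Euc n) (x : AugState S Z) :
    ∫ a, M.qValue π m k θ (x, a) ∂(π.kernel θ' x) =
      M.meanCost π θ' k x - M.avgCost π m k θ +
        ∫ y, M.value π m k θ y ∂(M.stateKernel π θ' x) := by
  obtain ⟨C, hC⟩ := R.exists_bddMeas_expCost_zero k
  obtain ⟨⟨D, -, hD⟩, -⟩ := R.lipFamily_value k
  have h1 : BddMeas (fun a => ∫ x', M.reshapedCost k x a x' ∂(M.augTrans (x, a))) C :=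
    hC.comp (measurable_const.prodMk measurable_id)
  have h2 := h1.sub (BddMeas.const (X := ↥A) (M.avgCost π m k θ))
  have h3 := M.bddMeas_augTrans ((hD θ).comp (measurable_snd (α := ↥A))) x
  have e1 := integral_add (h2.integrable (π.kernel θ' x)) (h3.integrable (π.kernel θ' x))
  have e2 := integral_sub (h1.integrable (π.kernel θ' x))
    ((BddMeas.const (X := ↥A) (M.avgCost π m k θ)).integrable (π.kernel θ' x))
  simp only [integral_const, probReal_univ, one_smul] at e2
  rw [M.integral_stateKernel π θ' x (hD θ), M.integral_stepKernel π θ' x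
    ((hD θ).comp measurable_snd), R.meanCost_eq, ← e2, ← e1]
  exact integral_congr_ae (ae_of_all _ fun a => R.qValue_eq k θ (x, a))

/-- When both policies agree, the one-step recursion is Poisson's equation for the mean cost. -/
theorem integral_qValue_self (θ : ↥Θ) (x : AugState S Z) :
    ∫ a, M.qValue π m k θ (x, a) ∂(π.kernel θ x) = M.value π m k θ x := by
  obtain ⟨⟨C, -, hC⟩, -⟩ := R.lipFamily_meanCost k
  have h := (R.ergodic θ).poisson_sub (hC θ) x
  rw [R.integral_qValue]
  change M.value π m k θ x - ∫ y, M.value π m k θ y ∂(M.stateKernel π θ x) =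
    M.meanCost π θ k x - M.avgCost π m k θ at h
  linarith

/-- The performance difference formula. -/
theorem avgCost_sub (θ θ' : ↥Θ) : M.avgCost π m k θ' - M.avgCost π m k θ =
    ∫ x, (∫ a, M.qValue π m k θ (x, a) ∂(π.kernel θ' x) -
      ∫ a, M.qValue π m k θ (x, a) ∂(π.kernel θ x)) ∂(m θ' : Measure (AugState S Z)) := by
  obtain ⟨⟨C, -, hC⟩, -⟩ := R.lipFamily_meanCost k
  obtain ⟨⟨D, -, hD⟩, -⟩ := R.lipFamily_value k
  simp_rw [R.integral_qValue_self, R.integral_qValue]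
  set ν : Measure (AugState S Z) := (m θ' : Measure (AugState S Z))
  have h1 := (hC θ').sub (BddMeas.const (X := AugState S Z) (M.avgCost π m k θ))
  have h2 := (hD θ).kernel (M.stateKernel π θ')
  have e1 := integral_sub ((h1.add h2).integrable ν) ((hD θ).integrable ν)
  have e2 := integral_add (h1.integrable ν) (h2.integrable ν)
  have e3 := integral_sub ((hC θ').integrable ν)
    ((BddMeas.const (X := AugState S Z) (M.avgCost π m k θ)).integrable ν)
  simp only [integral_const, probReal_univ, one_smul] at e3
  -- Invariance of the stationary law of `θ'` cancels the two value terms.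
  rw [e1, e2, e3, (R.ergodic θ').integral_kernel_invariant (hD θ)]
  change _ = M.avgCost π m k θ' - _ + _ - _
  ring

/-- The long-run average cost is the average under the stationary law. -/
theorem objective_eq (θ : ↥Θ) : M.objective π k θ = M.avgCost π m k θ := by
  obtain ⟨⟨C, -, hC⟩, -⟩ := R.lipFamily_meanCost k
  have := M.init_prob
  have hlim : Tendsto (fun t => ∫ x, M.meanCost π θ k x ∂(M.init.bind (M.iterKernel π θ t))) atTop
      (𝓝 (M.avgCost π m k θ)) := by
    rw [tendsto_iff_norm_sub_tendsto_zero]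
    refine squeeze_zero (fun _ => norm_nonneg _) (g := fun t => C * lam * ρ ^ t) (fun t => ?_) ?_
    · rw [(hC θ).integral_bind]
      have e := integral_sub (((hC θ).kernel (M.iterKernel π θ t)).integrable M.init)
        ((BddMeas.const (X := AugState S Z) (M.avgCost π m k θ)).integrable M.init)
      simp only [integral_const, probReal_univ, one_smul] at e
      rw [← e]
      refine BddMeas.norm_integral_le (C := C * lam * ρ ^ t)
        ⟨((hC θ).kernel (M.iterKernel π θ t)).meas.sub stronglyMeasurable_const, fun x => ?_⟩ _
      rw [M.iterKernel_eq]
      exact (R.ergodic θ).norm_sub_le (hC θ) x t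
    · simpa using (tendsto_pow_atTop_nhds_zero_of_lt_one (R.ergodic θ).ρ_nonneg
        (R.ergodic θ).ρ_lt_one).const_mul (C * lam)
  refine Tendsto.limUnder_eq ?_
  -- The expected costs themselves converge, so their Cesàro means have the same limit.
  simpa only [one_div] using hlim.cesaro

/-- The policy gradient theorem. -/
theorem gradObjective_eq (θ : ↥Θ) : M.gradObjective π Θ k θ =
    ∫ x, M.gradTerm π m k θ x ∂(m θ : Measure (AugState S Z)) := by
  obtain ⟨L, hL⟩ := R.problem.policy_lipschitz
  obtain ⟨L', hL'⟩ := R.problem.score_lipschitz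
  obtain ⟨⟨Cq, hCq0, hCq⟩, -⟩ := R.lipFamily_qValue k
  obtain ⟨⟨Ch, -, hCh⟩, -⟩ := R.lipFamily_gradTerm k
  obtain ⟨⟨Cs, -, hCs⟩, -⟩ := R.lipFamily_score
  have hU := uniqueDiffOn_convex R.problem.convex_Θ R.problem.interior_Θ θ θ.2
  -- `R₁` is the second-order error of the expansion of the policy. `R₂` accounts for replacing the
  -- stationary law of the new parameter by that of the old one in the first-order term: an O(‖Δ‖)
  -- change of law times an O(‖Δ‖) integrand.
  set R₁ := Cq * (2 * (L : ℝ) ^ 2 + L') with hR₁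
  set R₂ := Ch * lam / (1 - ρ) * (2 * L) with hR₂
  refine gradientWithin_eq_of_hasGradientWithinAt hU
    (hasGradientWithinAt_of_quadratic (R := R₁ + R₂) fun θ₁ hθ₁ => ?_)
  lift θ₁ to ↥Θ using hθ₁ with θ'
  rw [R.objective_eq, R.objective_eq, R.avgCost_sub]
  set ν : Measure (AugState S Z) := (m θ' : Measure (AugState S Z))
  set Δ : Euc n := (θ' : Euc n) - θ
  have hinner : BddMeas (fun x => inner ℝ (M.gradTerm π m k θ x) Δ) (Ch * ‖Δ‖) :=
    ⟨(hCh θ).meas.inner stronglyMeasurable_const, fun x => (norm_inner_le_norm _ _).trans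
      (mul_le_mul_of_nonneg_right ((hCh θ).bound x) (norm_nonneg _))⟩
  have hq : ∀ θ₁ : ↥Θ, BddMeas (fun x => ∫ a, M.qValue π m k θ (x, a) ∂(π.kernel θ₁ x)) Cq :=
    fun θ₁ => ⟨(hCq θ).meas.integral_kernel_prod_right' (κ := π.kernel θ₁), fun x =>
      ((hCq θ).comp (measurable_const.prodMk measurable_id)).norm_integral_le _⟩
  have e1 := integral_sub (((hq θ').sub (hq θ)).integrable ν) (hinner.integrable ν)
  have e2 : ∫ x, inner ℝ (M.gradTerm π m k θ x) Δ ∂ν =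
      inner ℝ (∫ x, M.gradTerm π m k θ x ∂ν) Δ := by
    simp_rw [real_inner_comm Δ]
    exact integral_inner ((hCh θ).integrable ν) Δ
  have hb : ‖∫ x, ((∫ a, M.qValue π m k θ (x, a) ∂(π.kernel θ' x) -
      ∫ a, M.qValue π m k θ (x, a) ∂(π.kernel θ x)) -
      inner ℝ (M.gradTerm π m k θ x) Δ) ∂ν‖ ≤ R₁ * ‖Δ‖ ^ 2 :=
    BddMeas.norm_integral_le ⟨((hq θ').sub (hq θ)).meas.sub hinner.meas, fun x =>
      Policy.abs_integral_kernel_sub_sub_inner_le R.problem.convex_Θ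
        R.problem.policy_differentiable hL hL' θ.2 θ'.2 x
        ((hCs θ).comp (measurable_const.prodMk measurable_id))
        ((hCq θ).comp (measurable_const.prodMk measurable_id))⟩ ν
  have hm := (R.ergodic θ).norm_integral_sub_le (hCh θ) (R.ergodic θ')
    (δ := 2 * L * ‖Δ‖) fun ψ B hB x => M.norm_integral_stateKernel_sub_le hL θ.2 θ'.2 ψ B hB x
  rw [e1, e2] at hb
  have e3 : ∀ (a : ℝ) (v w : Euc n), a - inner ℝ w Δ = (a - inner ℝ v Δ) + inner ℝ (v - w) Δ := by
    intro a v w; rw [inner_sub_left]; ring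
  rw [e3 _ (∫ x, M.gradTerm π m k θ x ∂ν), ← Real.norm_eq_abs, add_mul]
  refine (norm_add_le _ _).trans (add_le_add hb ((norm_inner_le_norm _ _).trans ?_))
  calc _ ≤ Ch * lam / (1 - ρ) * (2 * L * ‖Δ‖) * ‖Δ‖ :=
        mul_le_mul_of_nonneg_right hm (norm_nonneg _)
    _ = R₂ * ‖Δ‖ ^ 2 := by rw [hR₂]; ring

/-- Truncating the horizon and replacing the average cost by `y` in the action value. -/
theorem exists_abs_surrogateQ_sub_le : ∃ C, 0 ≤ C ∧ ∀ (θ : ↥Θ) (y : ℝ) (T : ℕ)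
    (x : AugState S Z) (a : ↥A), |M.surrogateQ π θ k y T x a -
      (M.qValue π m k θ (x, a) + T * (M.avgCost π m k θ - y))| ≤ C * ρ ^ T := by
  obtain ⟨⟨C, hC0, hC⟩, -⟩ := R.lipFamily_meanCost k
  obtain ⟨⟨D, hD0, hD⟩, -⟩ := R.lipFamily_value k
  obtain ⟨⟨F, hF0, hF⟩, -⟩ := R.lipFamily_qValue k
  have hρ := R.problem.ρ_pos
  have hlam := R.problem.lam_pos
  refine ⟨F + D * lam / ρ, by positivity, fun θ y T x a => ?_⟩
  -- At horizon 0 the surrogate is an empty sum, and the bound `F` on the action value must do. At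
  -- horizon `N + 1` the first cost is deterministic given state and action up to the transition,
  -- and the other `N` costs telescope; the division by ρ makes up for ρ^N in place of ρ^(N+1).
  rcases T with _ | N
  · have := (hF θ).bound (x, a)
    rw [Real.norm_eq_abs] at this
    simp only [CMDP.surrogateQ, Finset.range_zero, Finset.sum_empty, Nat.cast_zero, zero_mul,
      add_zero, zero_sub, abs_neg, pow_zero, mul_one]
    have : 0 ≤ D * lam / ρ := by positivity
    linarith
  · have hsum : ∀ t, M.expCost π θ k (t + 1) x a - M.avgCost π m k θ =
        ∫ x', (∫ z, M.meanCost π θ k z ∂(kernelPow (M.stateKernel π θ) t x') -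
          M.avgCost π m k θ) ∂(M.augTrans (x, a)) := by
      intro t
      have e := integral_sub (((hC θ).kernel (kernelPow (M.stateKernel π θ) t)).integrable
        (M.augTrans (x, a)))
        ((BddMeas.const (X := AugState S Z) (M.avgCost π m k θ)).integrable (M.augTrans (x, a)))
      simp only [integral_const, probReal_univ, one_smul] at e
      rw [e, CMDP.expCost, M.iterKernel_eq, Kernel.integral_comp ((hC θ).integrable _)]
    have hV : ∑ t ∈ Finset.range N, (M.expCost π θ k (t + 1) x a - M.avgCost π m k θ) =
        ∫ x', M.value π m k θ x' ∂(M.augTrans (x, a)) -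
          ∫ x', ∫ z, M.value π m k θ z ∂(kernelPow (M.stateKernel π θ) N x')
            ∂(M.augTrans (x, a)) := by
      rw [← integral_sub ((hD θ).integrable _) (((hD θ).kernel _).integrable _)]
      simp_rw [hsum]
      rw [← integral_finsetSum _ fun t _ => (((hC θ).kernel
        (kernelPow (M.stateKernel π θ) t)).sub (BddMeas.const _)).integrable _]
      exact integral_congr_ae (ae_of_all _ fun x' =>
        ((R.ergodic θ).poisson_sub_pow (hC θ) x' N).symm)
    have hdecomp : M.surrogateQ π θ k y (N + 1) x a =
        (∑ t ∈ Finset.range N, (M.expCost π θ k (t + 1) x a - M.avgCost π m k θ)) +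
          (M.expCost π θ k 0 x a - M.avgCost π m k θ) +
          ((N + 1 : ℕ) : ℝ) * (M.avgCost π m k θ - y) := by
      rw [CMDP.surrogateQ, Finset.sum_range_succ', Finset.sum_sub_distrib, Finset.sum_sub_distrib]
      simp only [Finset.sum_const, Finset.card_range, nsmul_eq_mul]
      push_cast
      ring
    have hq := R.qValue_eq k θ (x, a)
    have h0 : M.expCost π θ k 0 x a = ∫ x', M.reshapedCost k x a x' ∂(M.augTrans (x, a)) := rfl
    have hfin : M.surrogateQ π θ k y (N + 1) x a - (M.qValue π m k θ (x, a) +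
        ((N + 1 : ℕ) : ℝ) * (M.avgCost π m k θ - y)) =
        - ∫ x', ∫ z, M.value π m k θ z ∂(kernelPow (M.stateKernel π θ) N x')
            ∂(M.augTrans (x, a)) := by
      rw [hdecomp, hV, hq, h0]; ring
    rw [hfin, abs_neg, ← Real.norm_eq_abs]
    have hb : ∀ x', ‖∫ z, M.value π m k θ z ∂(kernelPow (M.stateKernel π θ) N x')‖ ≤
        D * lam * ρ ^ N := by
      intro x'
      have := (R.ergodic θ).norm_sub_le (hD θ) x' N
      -- The value function is centered, so the tail term left by the truncation itself decays
      -- geometrically.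
      have hz : ∫ z, M.value π m k θ z ∂(m θ : Measure (AugState S Z)) = 0 :=
        (R.ergodic θ).integral_poisson (hC θ)
      rwa [hz, sub_zero] at this
    refine (BddMeas.norm_integral_le ⟨((hD θ).kernel _).meas, hb⟩ _).trans ?_
    have e : D * lam * ρ ^ N = D * lam / ρ * ρ ^ (N + 1) := by
      rw [pow_succ]; field_simp
    rw [e]
    have : 0 ≤ F * ρ ^ (N + 1) := by positivity
    linarith

end Regularity

end Values

/-! ### Joint measurability of the one-step kernel in parameter and state. -/

section JointKernel

variable {nS nZ nA K n : ℕ} {S : Set (Euc nS)} {Z : Set (Euc nZ)} {A : Set (Euc nA)}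

/-- The policies as a kernel from parameters and states to actions. -/
def Policy.jointKernel (π : Policy S Z A n) : Kernel (Euc n × AugState S Z) ↥A :=
  haveI := π.ref_sigmaFinite
  Kernel.withDensity (Kernel.const (Euc n × AugState S Z) π.ref)
    (fun p a => ENNReal.ofReal (π.dens p.1 p.2 a))

theorem Policy.jointKernel_apply (π : Policy S Z A n) (p : Euc n × AugState S Z) :
    π.jointKernel p = π.kernel p.1 p.2 := by
  have := π.ref_sigmaFinite
  have h1 : Measurable (Function.uncurry fun x a => ENNReal.ofReal (π.dens p.1 x a)) :=
    ENNReal.measurable_ofReal.comp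
      (π.dens_measurable.comp (measurable_const.prodMk measurable_id))
  have h2 : Measurable (Function.uncurry fun (p : Euc n × AugState S Z) a =>
      ENNReal.ofReal (π.dens p.1 p.2 a)) :=
    ENNReal.measurable_ofReal.comp (π.dens_measurable.comp
      (f := fun q : (Euc n × AugState S Z) × ↥A => (q.1.1, q.1.2, q.2)) (by fun_prop))
  rw [jointKernel, kernel, Kernel.withDensity_apply _ h2, Kernel.withDensity_apply _ h1,
    Kernel.const_apply, Kernel.const_apply]

instance (π : Policy S Z A n) : IsMarkovKernel π.jointKernel :=
  ⟨fun p => by rw [π.jointKernel_apply]; infer_instance⟩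

/-- One step of the decision process as a kernel from parameters and states. -/
def CMDP.jointStep (M : CMDP S Z A K) (π : Policy S Z A n) :
    Kernel (Euc n × AugState S Z) (↥A × AugState S Z) :=
  π.jointKernel ⊗ₖ M.augTrans.comap
    (fun q : (Euc n × AugState S Z) × ↥A => (q.1.2, q.2)) (by fun_prop)

instance (M : CMDP S Z A K) (π : Policy S Z A n) : IsMarkovKernel (M.jointStep π) := by
  unfold CMDP.jointStep; infer_instance

theorem CMDP.jointStep_apply (M : CMDP S Z A K) (π : Policy S Z A n)
    (p : Euc n × AugState S Z) : M.jointStep π p = M.stepKernel π p.1 p.2 := by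
  ext U hU
  rw [jointStep, stepKernel, Kernel.compProd_apply hU, Kernel.compProd_apply hU,
    π.jointKernel_apply]
  rfl

end JointKernel

/-! ### Adaptedness of the run and the conditional law of one slot. -/

namespace Run

variable {nS nZ nA K n : ℕ} {S : Set (Euc nS)} {Z : Set (Euc nZ)} {A : Set (Euc nA)}
  {M : CMDP S Z A K} {π : Policy S Z A n} {Θ : Set (Euc n)} {q : ℕ}
  {Qnet : Fin (K + 1) → Euc q → AugState S Z → ↥A → ℝ} {μ η : ℕ → ℝ} {B : ℕ}
  {Ω : Type*} [mΩ : MeasurableSpace Ω] {P : Measure Ω} (R : Run M π Θ Qnet μ η B P)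

theorem θ_mem (hΘ : Convex ℝ Θ) (hμ : ∀ i, 0 < μ i) (hμ' : ∀ i, μ i ≤ 1) (i : ℕ) (ω : Ω) :
    R.θ i ω ∈ Θ := by
  induction i with
  | zero => exact R.θ_init_mem ω
  | succ i ih =>
    rw [R.θ_succ]
    exact hΘ ih (R.θbar_mem i ω) (by linarith [hμ' i]) (hμ i).le (by ring)

theorem measurable_θ (i : ℕ) : Measurable[R.𝓕 (B * i)] (R.θ i) := by
  induction i with
  | zero => simpa using R.θ_init_measurable
  | succ i ih =>
    have h1 : Measurable[R.𝓕 (B * (i + 1))] (R.θ i) :=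
      ih.mono (R.𝓕.mono (Nat.mul_le_mul_left B i.le_succ)) le_rfl
    have h2 := R.θbar_measurable i
    have e : R.θ (i + 1) = fun ω => (1 - μ i) • R.θ i ω + μ i • R.θbar i ω :=
      funext (R.θ_succ i)
    rw [e]
    exact (h1.const_smul (1 - μ i)).add (h2.const_smul (μ i))

theorem measurable_s_of_le {t t' : ℕ} (h : t ≤ t') : Measurable[R.𝓕 t'] (R.s t) :=
  (R.s_measurable t).mono (R.𝓕.mono h) le_rfl

theorem measurable_a_of_lt {t t' : ℕ} (h : t < t') : Measurable[R.𝓕 t'] (R.a t) :=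
  (R.a_measurable t).mono (R.𝓕.mono h) le_rfl

theorem measurable_θ_of_le {i t : ℕ} (h : B * i ≤ t) : Measurable[R.𝓕 t] (R.θ i) :=
  (R.measurable_θ i).mono (R.𝓕.mono h) le_rfl

theorem slot_lt {i j : ℕ} (hj : j < B) : B * i + j < B * (i + 1) := by rw [mul_add]; omega

theorem measurable_reshapedCost (k : Fin (K + 1)) {t t' : ℕ} (h : t < t') :
    Measurable[R.𝓕 t'] fun ω => M.reshapedCost k (R.s t ω) (R.a t ω) (R.s (t + 1) ω) := by
  have h1 := R.measurable_s_of_le h.le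
  have h2 := R.measurable_s_of_le (Nat.succ_le_of_lt h)
  have h3 := R.measurable_a_of_lt h
  have e1 : Measurable[R.𝓕 t'] fun ω => M.cost k (R.s t ω).1 (R.a t ω) :=
    (M.cost_measurable k).comp ((measurable_fst.comp h1).prodMk h3)
  exact e1.add (((M.potential_measurable k).comp h2).sub ((M.potential_measurable k).comp h1))

theorem measurable_fhat (k : Fin (K + 1)) (i : ℕ) : Measurable[R.𝓕 (B * i)] (R.fhat k i) := by
  induction i with
  | zero => simpa using R.fhat_init_measurable k
  | succ i ih =>
    have h1 : Measurable[R.𝓕 (B * (i + 1))] (R.fhat k i) :=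
      ih.mono (R.𝓕.mono (Nat.mul_le_mul_left B i.le_succ)) le_rfl
    rw [show R.fhat k (i + 1) = _ from funext (R.fhat_succ k i)]
    refine (h1.const_mul _).add (Measurable.const_mul (Measurable.const_mul ?_ _) _)
    exact Finset.measurable_fun_sum _ fun j hj =>
      R.measurable_reshapedCost k (slot_lt (Finset.mem_range.1 hj))

/-- The sample of the gradient in a slot. -/
def gradSample (k : Fin (K + 1)) (i t : ℕ) (ω : Ω) : Euc n :=
  Qnet k (R.w k i ω) (R.s t ω) (R.a t ω) • π.score Θ (R.θ i ω) (R.s t ω) (R.a t ω)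

theorem measurable_score
    (hm : Measurable fun p : Euc n × AugState S Z × ↥A => π.score Θ p.1 p.2.1 p.2.2)
    {i t t' : ℕ} (ht : B * i ≤ t) (h : t < t') :
    Measurable[R.𝓕 t'] fun ω => π.score Θ (R.θ i ω) (R.s t ω) (R.a t ω) :=
  hm.comp ((R.measurable_θ_of_le (ht.trans h.le)).prodMk
    ((R.measurable_s_of_le h.le).prodMk (R.measurable_a_of_lt h)))

/-- Only the information at the end of the batch suffices, because the weights of iteration `i` may
depend on the whole batch. -/
theorem measurable_gradSample
    (hm : Measurable fun p : Euc n × AugState S Z × ↥A => π.score Θ p.1 p.2.1 p.2.2)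
    (hQnet : ∀ k, Measurable fun p : Euc q × AugState S Z × ↥A => Qnet k p.1 p.2.1 p.2.2)
    (k : Fin (K + 1)) {i j : ℕ} (hj : j < B) :
    Measurable[R.𝓕 (B * (i + 1))] (R.gradSample k i (B * i + j)) := by
  have h := slot_lt (i := i) hj
  have hq : Measurable[R.𝓕 (B * (i + 1))] fun ω =>
      Qnet k (R.w k i ω) (R.s (B * i + j) ω) (R.a (B * i + j) ω) :=
    (hQnet k).comp ((R.w_measurable k i).prodMk
      ((R.measurable_s_of_le h.le).prodMk (R.measurable_a_of_lt h)))
  exact hq.smul (R.measurable_score hm (Nat.le_add_right _ _) h)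

theorem measurable_ghat
    (hm : Measurable fun p : Euc n × AugState S Z × ↥A => π.score Θ p.1 p.2.1 p.2.2)
    (hQnet : ∀ k, Measurable fun p : Euc q × AugState S Z × ↥A => Qnet k p.1 p.2.1 p.2.2)
    (k : Fin (K + 1)) (i : ℕ) : Measurable[R.𝓕 (B * i)] (R.ghat k i) := by
  induction i with
  | zero => simpa using R.ghat_init_measurable k
  | succ i ih =>
    have h1 : Measurable[R.𝓕 (B * (i + 1))] (R.ghat k i) :=
      ih.mono (R.𝓕.mono (Nat.mul_le_mul_left B i.le_succ)) le_rfl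
    rw [show R.ghat k (i + 1) = _ from funext (R.ghat_succ k i)]
    refine (h1.const_smul (1 - η (i + 1))).add
      (Measurable.const_smul (Measurable.const_smul ?_ (1 / (B : ℝ))) (η i))
    exact Finset.measurable_fun_sum _ fun j hj =>
      R.measurable_gradSample hm hQnet k (Finset.mem_range.1 hj)

/-- The joint law of a quantity `Y` known before slot `t` and of the outcome of slot `t`. -/
theorem map_eq_compProd [IsProbabilityMeasure P] {𝒴 : Type*} [MeasurableSpace 𝒴] (t : ℕ)
    {Y : Ω → 𝒴} (hY : Measurable[R.𝓕 t] Y) (κ : Kernel 𝒴 (↥A × AugState S Z)) [IsMarkovKernel κ]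
    (hκ : ∀ ω, κ (Y ω) = M.stepKernel π (R.θ (t / B) ω) (R.s t ω)) :
    P.map (fun ω => (Y ω, R.a t ω, R.s (t + 1) ω)) = (P.map Y) ⊗ₘ κ := by
  have hle := R.𝓕.le t
  have hY' : Measurable Y := hY.mono hle le_rfl
  have hp : Measurable fun ω => (R.a t ω, R.s (t + 1) ω) :=
    ((R.a_measurable t).mono (R.𝓕.le _) le_rfl).prodMk
      ((R.s_measurable (t + 1)).mono (R.𝓕.le _) le_rfl)
  have hYp : Measurable fun ω => (Y ω, R.a t ω, R.s (t + 1) ω) := hY'.prodMk hp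
  have : IsProbabilityMeasure (P.map Y) := Measure.isProbabilityMeasure_map hY'.aemeasurable
  refine Measure.ext_prod fun {V U} hV hU => ?_
  rw [Measure.map_apply hYp (hV.prod hU), Measure.compProd_apply_prod hV hU,
    setLIntegral_map hV (κ.measurable_coe hU) hY']
  have hVt : MeasurableSet[R.𝓕 t] (Y ⁻¹' V) := hY hV
  have hUm : MeasurableSet ((fun ω => (R.a t ω, R.s (t + 1) ω)) ⁻¹' U) := hp hU
  -- Rectangles determine the joint law. The event that `Y` lies in `V` belongs to the past, so
  -- integrating the conditional probability over it gives the probability of the rectangle.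
  have h1 := setIntegral_condExp hle (μ := P)
    (f := ((fun ω => (R.a t ω, R.s (t + 1) ω)) ⁻¹' U).indicator (fun _ => (1 : ℝ)))
    ((integrable_const 1).indicator hUm) hVt
  rw [setIntegral_congr_ae (hle _ hVt) ((R.law t U hU).mono fun ω h _ => h),
    setIntegral_indicator hUm, setIntegral_const, smul_eq_mul, mul_one] at h1
  have h2 : ∫ ω in Y ⁻¹' V, (M.stepKernel π (R.θ (t / B) ω) (R.s t ω)).real U ∂P =
      (∫⁻ ω in Y ⁻¹' V, κ (Y ω) U ∂P).toReal := by
    simp_rw [← hκ, measureReal_def]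
    exact integral_toReal ((κ.measurable_coe hU).comp hY').aemeasurable
      (ae_of_all _ fun ω => measure_lt_top _ _)
  rw [h2] at h1
  have h3 : ∫⁻ ω in Y ⁻¹' V, κ (Y ω) U ∂P ≠ ∞ := by
    refine ne_top_of_le_ne_top (b := ∫⁻ ω in Y ⁻¹' V, 1 ∂P) ?_
      (lintegral_mono fun ω => prob_le_one)
    simp
  rw [← ENNReal.toReal_eq_toReal_iff' (measure_ne_top _ _) h3, h1]
  rfl

/-- The parameter as a point of `Θ`. -/
def param (hmem : ∀ i ω, R.θ i ω ∈ Θ) (i : ℕ) (ω : Ω) : ↥Θ := ⟨R.θ i ω, hmem i ω⟩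

variable (hmem : ∀ i ω, R.θ i ω ∈ Θ)

theorem measurable_param {i t : ℕ} (h : B * i ≤ t) : Measurable[R.𝓕 t] (R.param hmem i) :=
  (R.measurable_θ_of_le h).subtype_mk

variable {E : Type*} [NormedAddCommGroup E] [InnerProductSpace ℝ E] [CompleteSpace E]
  [MeasurableSpace E] [BorelSpace E] [SecondCountableTopology E]

/-- Conditional expectation of the outcome of one slot given the past. -/
theorem integral_inner_step [IsProbabilityMeasure P] {i j : ℕ} (hj : j < B) {W : Ω → E} {w : ℝ}
    (hW : Measurable[R.𝓕 (B * i + j)] W) (hWb : ∀ ω, ‖W ω‖ ≤ w)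
    {G : ↥Θ → AugState S Z → ↥A × AugState S Z → E} {C : ℝ}
    (hG : BddMeas (fun r : (↥Θ × AugState S Z) × ↥A × AugState S Z => G r.1.1 r.1.2 r.2) C) :
    ∫ ω, inner ℝ (W ω) (G (R.param hmem i ω) (R.s (B * i + j) ω)
        (R.a (B * i + j) ω, R.s (B * i + j + 1) ω)) ∂P =
      ∫ ω, inner ℝ (W ω) (∫ p, G (R.param hmem i ω) (R.s (B * i + j) ω) p
        ∂(M.stepKernel π (R.θ i ω) (R.s (B * i + j) ω))) ∂P := by
  set t := B * i + j with ht
  have hti : t / B = i := by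
    rw [ht, Nat.mul_add_div (by omega), Nat.div_eq_of_lt hj, add_zero]
  have hBi : B * i ≤ t := Nat.le_add_right _ _
  -- The weight `W` is made part of the conditioning variable, though the kernel ignores it, so that
  -- the whole integrand is a function of `Y` and the outcome.
  set Y : Ω → (↥Θ × AugState S Z) × E := fun ω => ((R.param hmem i ω, R.s t ω), W ω) with hYdef
  have hY : Measurable[R.𝓕 t] Y :=
    ((R.measurable_param hmem hBi).prodMk (R.s_measurable t)).prodMk hW
  have hY' : Measurable Y := hY.mono (R.𝓕.le t) le_rfl
  have hp : Measurable fun ω => (R.a t ω, R.s (t + 1) ω) :=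
    ((R.a_measurable t).mono (R.𝓕.le _) le_rfl).prodMk
      ((R.s_measurable (t + 1)).mono (R.𝓕.le _) le_rfl)
  set κ : Kernel ((↥Θ × AugState S Z) × E) (↥A × AugState S Z) :=
    (M.jointStep π).comap (fun y => ((y.1.1 : Euc n), y.1.2)) (by fun_prop) with hκdef
  have hκ : ∀ ω, κ (Y ω) = M.stepKernel π (R.θ i ω) (R.s t ω) := fun ω => by
    rw [hκdef, Kernel.comap_apply, M.jointStep_apply]; rfl
  have hmap := R.map_eq_compProd t hY κ (by rw [hti]; exact hκ)
  set F : ((↥Θ × AugState S Z) × E) × (↥A × AugState S Z) → ℝ :=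
    fun r => inner ℝ r.1.2 (G r.1.1.1 r.1.1.2 r.2) with hF
  have hFm : StronglyMeasurable F :=
    (measurable_snd.comp measurable_fst).stronglyMeasurable.inner
      (hG.meas.comp_measurable (g := fun r : ((↥Θ × AugState S Z) × E) × (↥A × AugState S Z) =>
        (r.1.1, r.2)) (by fun_prop))
  have hYp : Measurable fun ω => (Y ω, R.a t ω, R.s (t + 1) ω) := hY'.prodMk hp
  have hFi : Integrable F (P.map fun ω => (Y ω, R.a t ω, R.s (t + 1) ω)) := by
    rw [integrable_map_measure hFm.aestronglyMeasurable hYp.aemeasurable]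
    refine Integrable.of_bound (hFm.comp_measurable hYp).aestronglyMeasurable (w * C)
      (ae_of_all _ fun ω => ?_)
    exact (norm_inner_le_norm _ _).trans (mul_le_mul (hWb ω)
      (hG.bound ((R.param hmem i ω, R.s t ω), (R.a t ω, R.s (t + 1) ω))) (norm_nonneg _)
      ((norm_nonneg _).trans (hWb ω)))
  have h1 := integral_map hYp.aemeasurable hFm.aestronglyMeasurable (μ := P)
  have : IsProbabilityMeasure (P.map Y) := Measure.isProbabilityMeasure_map hY'.aemeasurable
  rw [hmap] at h1 hFi
  rw [Measure.integral_compProd hFi, integral_map hY'.aemeasurable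
    (hFm.integral_kernel_prod_right' (κ := κ)).aestronglyMeasurable] at h1
  refine h1.symm.trans (integral_congr_ae (ae_of_all _ fun ω => ?_))
  simp only [hκ]
  have hg : BddMeas (fun p => G (R.param hmem i ω) (R.s t ω) p) C :=
    hG.comp (g := fun p => ((R.param hmem i ω, R.s t ω), p))
      (measurable_const.prodMk measurable_id)
  exact integral_inner (hg.integrable _) (W ω)

end Run

/-! ### Pathwise error analysis of the stochastic approximation. -/

section Recursion

variable {μ η : ℕ → ℝ} {E : Type*} [NormedAddCommGroup E]

namespace StepSizes

theorem η_le_zero (h : StepSizes μ η) (i : ℕ) : η i ≤ η 0 := h.η_antitone (Nat.zero_le i)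

theorem abs_one_sub_le (h : StepSizes μ η) (i : ℕ) : |1 - η i| ≤ 1 + η 0 := by
  have h1 := h.η_pos i
  have h2 := h.η_le_zero i
  rw [abs_le]
  constructor <;> linarith

theorem inv_sub_nonneg (h : StepSizes μ η) (i : ℕ) : 0 ≤ 1 / η (i + 1) - 1 / η i :=
  sub_nonneg.2 (one_div_le_one_div_of_le (h.η_pos _) (h.η_antitone i.le_succ))

theorem sum_inv_sub (N : ℕ) :
    ∑ i ∈ Finset.range (N + 1), (1 / η (i + 1) - 1 / η i) = 1 / η (N + 1) - 1 / η 0 :=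
  Finset.sum_range_sub (fun i => 1 / η i) (N + 1)

theorem one_le_mul_inv (h : StepSizes μ η) (N : ℕ) : 1 ≤ η 0 * (1 / η N) := by
  rw [mul_one_div, one_le_div (h.η_pos N)]
  exact h.η_le_zero N

/-- Smoothed averages of bounded samples are bounded. -/
theorem exists_bound [NormedSpace ℝ E] (h : StepSizes μ η) (b c : ℝ) :
    ∃ G, 0 ≤ G ∧ ∀ x y : ℕ → E, ‖x 0‖ ≤ b → (∀ i, ‖y i‖ ≤ c) →
      (∀ i, x (i + 1) = (1 - η (i + 1)) • x i + η i • y i) → ∀ i, ‖x i‖ ≤ G := by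
  -- `g` is the scalar worst case. Early steps may exceed 1, where nothing contracts; these finitely
  -- many indices are covered by the sum of the values of `g` before `i₀`.
  set g : ℕ → ℝ := fun i => Nat.rec |b| (fun i r => |1 - η (i + 1)| * r + η i * |c|) i with hg
  have hg0 : g 0 = |b| := rfl
  have hgs : ∀ i, g (i + 1) = |1 - η (i + 1)| * g i + η i * |c| := fun i => rfl
  have hgn : ∀ i, 0 ≤ g i := by
    intro i
    induction i with
    | zero => exact abs_nonneg b
    | succ i ih =>
      rw [hgs]
      have := (h.η_pos i).le
      positivity
  obtain ⟨i₀, hi₀⟩ := (h.η_tendsto.eventually (ge_mem_nhds (zero_lt_one (α := ℝ)))).exists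
  have hsmall : ∀ i, i₀ ≤ i → η i ≤ 1 := fun i hi => (h.η_antitone hi).trans hi₀
  -- The coefficients of old estimate and sample add up to 1 + (η i - η (i+1)) instead of 1. The
  -- extra term |c|η in this decreasing quantity pays for the excess, which telescopes.
  have hmono : ∀ i, max (g (i₀ + i)) |c| + |c| * η (i₀ + i) ≤ max (g i₀) |c| + |c| * η i₀ := by
    intro i
    induction i with
    | zero => simp
    | succ i ih =>
      refine le_trans ?_ ih
      rw [← add_assoc, hgs]
      have h1 := hsmall (i₀ + i + 1) (by omega)
      have h2 := h.η_pos (i₀ + i + 1)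
      have h3 := h.η_antitone (i₀ + i).le_succ
      have h4 := le_max_left (g (i₀ + i)) |c|
      have h5 := le_max_right (g (i₀ + i)) |c|
      have h6 := abs_nonneg c
      rw [abs_of_nonneg (by linarith : (0 : ℝ) ≤ 1 - η (i₀ + i + 1)), ← le_sub_iff_add_le]
      refine max_le ?_ ?_
      · nlinarith [mul_le_mul_of_nonneg_left h4 (sub_nonneg.2 h1),
          mul_le_mul_of_nonneg_left h5 h2.le]
      · nlinarith [mul_nonneg h6 (sub_nonneg.2 h3)]
  refine ⟨∑ i ∈ Finset.range i₀, g i + (max (g i₀) |c| + |c| * η i₀), ?_, ?_⟩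
  · have := Finset.sum_nonneg fun i (_ : i ∈ Finset.range i₀) => hgn i
    have h1 := (h.η_pos i₀).le
    have h2 : 0 ≤ max (g i₀) |c| := (abs_nonneg c).trans (le_max_right _ _)
    positivity
  · intro x y hx hy hrec i
    have hle : ‖x i‖ ≤ g i := by
      induction i with
      | zero => exact hx.trans (le_abs_self b)
      | succ i ih =>
        rw [hrec, hgs]
        refine (norm_add_le _ _).trans (add_le_add ?_ ?_)
        · rw [norm_smul]
          exact mul_le_mul_of_nonneg_left ih (abs_nonneg _)
        · rw [norm_smul, Real.norm_eq_abs, abs_of_pos (h.η_pos i)]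
          exact mul_le_mul_of_nonneg_left ((hy i).trans (le_abs_self c)) (h.η_pos i).le
    refine hle.trans ?_
    have hs := Finset.sum_nonneg fun i (_ : i ∈ Finset.range i₀) => hgn i
    have h1 := (h.η_pos i₀).le
    rcases lt_or_ge i i₀ with hi | hi
    · have h2 := Finset.single_le_sum (f := g) (fun i _ => hgn i) (Finset.mem_range.2 hi)
      have h3 : 0 ≤ max (g i₀) |c| := (abs_nonneg c).trans (le_max_right _ _)
      have : 0 ≤ |c| * η i₀ := by positivity
      linarith
    · obtain ⟨j, rfl⟩ := Nat.exists_eq_add_of_le hi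
      have h2 := hmono j
      have h3 := le_max_left (g (i₀ + j)) |c|
      have h4 : 0 ≤ |c| * η (i₀ + j) := mul_nonneg (abs_nonneg c) (h.η_pos _).le
      linarith

/-- The sum of the step-size terms that bound the accumulated squared error. -/
def budget (μ η : ℕ → ℝ) (N : ℕ) : ℝ :=
  1 / η (N + 1) + ∑ i ∈ Finset.range (N + 1), (μ i ^ 2 / η i ^ 2 + μ i + η (i + 1))

end StepSizes

variable [InnerProductSpace ℝ E]

/-- A stochastic approximation recursion: `x` are the estimates of the slowly moving targets `F`,
`y` are the samples, and `v i`, `v' i` are the values of a slowly moving function at the beginning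
and at the end of step `i`. -/
structure Recursion (μ η : ℕ → ℝ) (G L : ℝ) (x F y v v' : ℕ → E) : Prop where
  succ : ∀ i, x (i + 1) = (1 - η (i + 1)) • x i + η i • y i
  x_le : ∀ i, ‖x i‖ ≤ G
  F_le : ∀ i, ‖F i‖ ≤ G
  y_le : ∀ i, ‖y i‖ ≤ G
  v_le : ∀ i, ‖v i‖ ≤ G
  F_lip : ∀ i, ‖F (i + 1) - F i‖ ≤ L * μ i
  v_lip : ∀ i, ‖v (i + 1) - v' i‖ ≤ L * μ i

namespace Recursion

variable {G L : ℝ} {x F y v v' : ℕ → E}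

theorem norm_err_le (r : Recursion μ η G L x F y v v') (i : ℕ) : ‖x i - F i‖ ≤ 2 * G := by
  have := (norm_sub_le (x i) (F i)).trans (add_le_add (r.x_le i) (r.F_le i))
  linarith

theorem G_nonneg (r : Recursion μ η G L x F y v v') : 0 ≤ G := (norm_nonneg _).trans (r.x_le 0)

/-- Dividing the expanded square by η (i+1) isolates 2‖e‖², of which one copy is used up by Young's
inequality for the drift. No bound on η i / η (i+1) is available, so each stray 1/η (i+1) is written
as 1/η i plus an increment of 1/η; these increments telescope. -/
theorem sq_err_le (hs : StepSizes μ η) (r : Recursion μ η G L x F y v v') (hL : 0 ≤ L) (i : ℕ) :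
    ‖x i - F i‖ ^ 2 ≤ (‖x i - F i‖ ^ 2 * (1 / η i) - ‖x (i + 1) - F (i + 1)‖ ^ 2 * (1 / η (i + 1)))
      + (4 * G ^ 2 + 4 * (1 + η 0) * G ^ 2 * η 0 + 4 * (1 + η 0) * G * L + 3 * G ^ 2 * η 0 ^ 2
        + 3 * L ^ 2) * (1 / η (i + 1) - 1 / η i)
      + ((1 + η 0) ^ 2 * L ^ 2 + 3 * L ^ 2 * η 0) * (μ i ^ 2 / η i ^ 2)
      + 16 * G ^ 2 * η (i + 1)
      + 2 * ((1 - η (i + 1)) * inner ℝ (x i - F i) (y i - F i)) := by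
  have hG := r.G_nonneg
  set e := x i - F i with he
  set e' := x (i + 1) - F (i + 1) with he'
  set h := η (i + 1) with hh
  set k := 1 + η 0 with hk
  have hpos : 0 < h := hs.η_pos _
  have hipos : 0 < η i := hs.η_pos _
  have h0pos : 0 < η 0 := hs.η_pos _
  have hi0 : η i ≤ η 0 := hs.η_le_zero i
  have hhi : h ≤ η i := hs.η_antitone i.le_succ
  have hμ0 := (hs.μ_pos i).le
  have hμ1 := hs.μ_le_one i
  have hk1 : |1 - h| ≤ k := hs.abs_one_sub_le _
  set qi := 1 / h - 1 / η i with hqi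
  have hq0 : 0 ≤ qi := hs.inv_sub_nonneg i
  set d := η i - h with hd
  have hd0 : 0 ≤ d := sub_nonneg.2 hhi
  have hdh : d / h ≤ η 0 * qi := by
    have : d / h = η i * qi := by rw [hqi, hd]; field_simp
    rw [this]; exact mul_le_mul_of_nonneg_right hi0 hq0
  have hdh0 : 0 ≤ d / h := by positivity
  have heb : ‖e‖ ≤ 2 * G := r.norm_err_le i
  have hyF : ‖y i - F i‖ ≤ 2 * G := by
    have := (norm_sub_le (y i) (F i)).trans (add_le_add (r.y_le i) (r.F_le i))
    linarith
  set w := F i - F (i + 1) with hw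
  have hwb : ‖w‖ ≤ L * μ i := by rw [hw, norm_sub_rev]; exact r.F_lip i
  -- Sample noise, the mismatch `d` between the two step sizes in the recursion, and the drift of
  -- the target.
  set z := h • (y i - F i) + d • y i + w with hz
  have hrec : e' = (1 - h) • e + z := by
    rw [he', r.succ, hz, hw, he, hd]
    module
  have hsq : ‖e'‖ ^ 2 = (1 - h) ^ 2 * ‖e‖ ^ 2 + 2 * ((1 - h) * inner ℝ e z) + ‖z‖ ^ 2 := by
    rw [hrec, norm_add_sq_real, norm_smul, inner_smul_left, mul_pow, Real.norm_eq_abs, sq_abs]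
    simp
  have hin : inner ℝ e z = h * inner ℝ e (y i - F i) + d * inner ℝ e (y i) + inner ℝ e w := by
    rw [hz, inner_add_right, inner_add_right, inner_smul_right, inner_smul_right]
  have ha : ‖e‖ ^ 2 ≤ 4 * G ^ 2 := by
    have := pow_le_pow_left₀ (norm_nonneg e) heb 2
    linarith
  have hzn : ‖z‖ ≤ h * (2 * G) + d * G + L * μ i := by
    refine (norm_add_le _ _).trans (add_le_add ((norm_add_le _ _).trans (add_le_add ?_ ?_)) hwb)
    · rw [norm_smul, Real.norm_eq_abs, abs_of_pos hpos]
      exact mul_le_mul_of_nonneg_left hyF hpos.le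
    · rw [norm_smul, Real.norm_eq_abs, abs_of_nonneg hd0]
      exact mul_le_mul_of_nonneg_left (r.y_le i) hd0
  have hz2 : ‖z‖ ^ 2 ≤ 3 * ((h * (2 * G)) ^ 2 + (d * G) ^ 2 + (L * μ i) ^ 2) := by
    have := pow_le_pow_left₀ (norm_nonneg z) hzn 2
    nlinarith [sq_nonneg (h * (2 * G) - d * G), sq_nonneg (h * (2 * G) - L * μ i),
      sq_nonneg (d * G - L * μ i)]
  -- The bound μ ≤ 1 lets the increment of 1/η stand alone, ready to telescope.
  have hμh : μ i ^ 2 / h ≤ η 0 * (μ i ^ 2 / η i ^ 2) + qi := by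
    have e1 : μ i ^ 2 / h = η i * (μ i ^ 2 / η i ^ 2) + μ i ^ 2 * qi := by
      rw [hqi]; field_simp; ring
    rw [e1]
    refine add_le_add (mul_le_mul_of_nonneg_right hi0 (by positivity)) ?_
    exact mul_le_of_le_one_left hq0 (pow_le_one₀ hμ0 hμ1)
  have hd2 : d ^ 2 / h ≤ η 0 ^ 2 * qi := by
    have e1 : d ^ 2 / h = d * (d / h) := by ring
    rw [e1, sq, mul_assoc]
    exact mul_le_mul (by linarith) hdh hdh0 h0pos.le
  have hz3 : ‖z‖ ^ 2 / h ≤ 12 * G ^ 2 * h + 3 * G ^ 2 * (η 0 ^ 2 * qi)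
      + 3 * L ^ 2 * (η 0 * (μ i ^ 2 / η i ^ 2) + qi) := by
    calc ‖z‖ ^ 2 / h ≤ 3 * ((h * (2 * G)) ^ 2 + (d * G) ^ 2 + (L * μ i) ^ 2) / h := by gcongr
      _ = 12 * G ^ 2 * h + 3 * G ^ 2 * (d ^ 2 / h) + 3 * L ^ 2 * (μ i ^ 2 / h) := by
        field_simp; ring
      _ ≤ _ := by gcongr
  have hey : (1 - h) * inner ℝ e (y i) ≤ k * (2 * G * G) := by
    refine (le_abs_self _).trans ?_
    rw [abs_mul]
    exact mul_le_mul hk1 ((abs_real_inner_le_norm _ _).trans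
      (mul_le_mul heb (r.y_le i) (norm_nonneg _) (by positivity))) (abs_nonneg _) (by positivity)
  have hew : (1 - h) * inner ℝ e w ≤ k * (‖e‖ * (L * μ i)) := by
    refine (le_abs_self _).trans ?_
    rw [abs_mul]
    exact mul_le_mul hk1 ((abs_real_inner_le_norm _ _).trans
      (mul_le_mul_of_nonneg_left hwb (norm_nonneg _))) (abs_nonneg _) (by positivity)
  have hcross : 2 * ((1 - h) * inner ℝ e w) / h ≤
      ‖e‖ ^ 2 + k ^ 2 * L ^ 2 * (μ i ^ 2 / η i ^ 2) + 4 * k * G * L * qi := by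
    calc 2 * ((1 - h) * inner ℝ e w) / h ≤ 2 * (k * (‖e‖ * (L * μ i))) / h := by gcongr
      _ = 2 * ‖e‖ * (k * L * (μ i / η i)) + 2 * k * ‖e‖ * L * μ i * qi := by
        rw [hqi]; field_simp; ring
      _ ≤ (‖e‖ ^ 2 + (k * L * (μ i / η i)) ^ 2) + 2 * k * (2 * G) * L * 1 * qi := by
        refine add_le_add (two_mul_le_add_sq _ _) ?_
        gcongr
      _ = _ := by rw [mul_pow, div_pow]; ring
  have hcross2 : 2 * ((1 - h) * inner ℝ e (y i)) * (d / h) ≤ 4 * k * G ^ 2 * (η 0 * qi) := by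
    calc _ ≤ 2 * (k * (2 * G * G)) * (d / h) := by gcongr
      _ ≤ 2 * (k * (2 * G * G)) * (η 0 * qi) := by gcongr
      _ = _ := by ring
  have hmain : 2 * ‖e‖ ^ 2 = (‖e‖ ^ 2 * (1 / η i) - ‖e'‖ ^ 2 * (1 / h)) + ‖e‖ ^ 2 * qi
      + h * ‖e‖ ^ 2 + 2 * ((1 - h) * inner ℝ e (y i - F i))
      + 2 * ((1 - h) * inner ℝ e (y i)) * (d / h) + 2 * ((1 - h) * inner ℝ e w) / h
      + ‖z‖ ^ 2 / h := by
    rw [hsq, hin, hqi]; field_simp; ring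
  have h1 : ‖e‖ ^ 2 * qi ≤ 4 * G ^ 2 * qi := mul_le_mul_of_nonneg_right ha hq0
  have h2 : h * ‖e‖ ^ 2 ≤ h * (4 * G ^ 2) := mul_le_mul_of_nonneg_left ha hpos.le
  linarith

/-- Summation by parts of the telescoping part of the bias. -/
theorem neg_sum_inner_le (hs : StepSizes μ η) (r : Recursion μ η G L x F y v v') (hL : 0 ≤ L)
    (N : ℕ) :
    ∑ i ∈ Finset.range (N + 1), (1 - η (i + 1)) * inner ℝ (x i - F i) (v i - v' i) ≤
      (4 * G ^ 2 * (1 + η 0) * η 0 + 2 * G ^ 2 * η 0 ^ 2 + G ^ 2 * (1 + η 0) * η 0 ^ 2)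
        * (1 / η (N + 1)) +
      (1 + η 0) * (3 * G * L + 2 * G ^ 2) * ∑ i ∈ Finset.range (N + 1), (μ i + η (i + 1)) := by
  have hG := r.G_nonneg
  set k := 1 + η 0 with hk
  have h0pos : 0 < η 0 := hs.η_pos _
  have hk0 : 0 ≤ k := by positivity
  -- Replacing v' i by v (i+1) makes the sum telescope in `U`, up to three corrections: the change
  -- of step size, the change of the error, and the gap between v (i+1) and v' i.
  set U : ℕ → ℝ := fun i => (1 - η (i + 1)) * inner ℝ (x i - F i) (v i) with hU
  have hUb : ∀ i, |U i| ≤ 2 * G ^ 2 * k := by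
    intro i
    rw [hU, abs_mul]
    calc _ ≤ k * (2 * G * G) := mul_le_mul (hs.abs_one_sub_le _) ((abs_real_inner_le_norm _ _).trans
          (mul_le_mul (r.norm_err_le i) (r.v_le i) (norm_nonneg _) (by positivity)))
          (abs_nonneg _) hk0
      _ = _ := by ring
  have hstep : ∀ i, (1 - η (i + 1)) * inner ℝ (x i - F i) (v i - v' i) ≤ (U i - U (i + 1)) +
      (2 * G ^ 2 * (η (i + 1) - η (i + 2)) + k * G ^ 2 * (η i - η (i + 1)) +
        k * (3 * G * L + 2 * G ^ 2) * (μ i + η (i + 1))) := by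
    intro i
    have hd := sub_nonneg.2 (hs.η_antitone (i + 1).le_succ)
    have hd' := sub_nonneg.2 (hs.η_antitone i.le_succ)
    have hμ0 := (hs.μ_pos i).le
    have hη0 := (hs.η_pos (i + 1)).le
    have he : ‖(x (i + 1) - F (i + 1)) - (x i - F i)‖ ≤
        2 * G * η (i + 1) + G * (η i - η (i + 1)) + L * μ i := by
      have e1 : (x (i + 1) - F (i + 1)) - (x i - F i) =
          (-η (i + 1)) • x i + η i • y i - (F (i + 1) - F i) := by
        rw [r.succ]; module
      rw [e1]
      refine (norm_sub_le _ _).trans ?_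
      have t1 := norm_add_le ((-η (i + 1)) • x i) (η i • y i)
      rw [norm_smul, norm_smul, Real.norm_eq_abs, Real.norm_eq_abs, abs_neg,
        abs_of_pos (hs.η_pos _), abs_of_pos (hs.η_pos _)] at t1
      have t2 := mul_le_mul_of_nonneg_left (r.x_le i) hη0
      have t3 := mul_le_mul_of_nonneg_left (r.y_le i) (hs.η_pos i).le
      have t4 := r.F_lip i
      linarith
    have e2 : (1 - η (i + 1)) * inner ℝ (x i - F i) (v i - v' i) = (U i - U (i + 1)) +
        ((η (i + 1) - η (i + 2)) * inner ℝ (x (i + 1) - F (i + 1)) (v (i + 1)) +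
          (1 - η (i + 1)) * inner ℝ ((x (i + 1) - F (i + 1)) - (x i - F i)) (v (i + 1)) +
          (1 - η (i + 1)) * inner ℝ (x i - F i) (v (i + 1) - v' i)) := by
      simp only [hU, inner_sub_left, inner_sub_right]; ring
    rw [e2]
    have b1 : (η (i + 1) - η (i + 2)) * inner ℝ (x (i + 1) - F (i + 1)) (v (i + 1)) ≤
        2 * G ^ 2 * (η (i + 1) - η (i + 2)) := by
      have := (le_abs_self _).trans ((abs_real_inner_le_norm (x (i + 1) - F (i + 1)) (v (i + 1))).trans
        (mul_le_mul (r.norm_err_le (i + 1)) (r.v_le (i + 1)) (norm_nonneg _) (by positivity)))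
      calc _ ≤ (η (i + 1) - η (i + 2)) * (2 * G * G) := mul_le_mul_of_nonneg_left this hd
        _ = _ := by ring
    have b2 : (1 - η (i + 1)) * inner ℝ ((x (i + 1) - F (i + 1)) - (x i - F i)) (v (i + 1)) ≤
        k * ((2 * G * η (i + 1) + G * (η i - η (i + 1)) + L * μ i) * G) := by
      refine (le_abs_self _).trans ?_
      rw [abs_mul]
      exact mul_le_mul (hs.abs_one_sub_le _) ((abs_real_inner_le_norm _ _).trans
        (mul_le_mul he (r.v_le _) (norm_nonneg _) (by positivity))) (abs_nonneg _) hk0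
    have b3 : (1 - η (i + 1)) * inner ℝ (x i - F i) (v (i + 1) - v' i) ≤
        k * (2 * G * (L * μ i)) := by
      refine (le_abs_self _).trans ?_
      rw [abs_mul]
      exact mul_le_mul (hs.abs_one_sub_le _) ((abs_real_inner_le_norm _ _).trans
        (mul_le_mul (r.norm_err_le i) (r.v_lip i) (norm_nonneg _) (by positivity)))
        (abs_nonneg _) hk0
    have b4 : 0 ≤ k * (2 * G ^ 2) * μ i := by positivity
    have b5 : 0 ≤ k * (3 * G * L) * η (i + 1) := by positivity
    linarith
  refine (Finset.sum_le_sum fun i _ => hstep i).trans ?_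
  simp only [Finset.sum_add_distrib, ← Finset.mul_sum]
  rw [Finset.sum_range_sub', Finset.sum_range_sub' η,
    Finset.sum_range_sub' (fun i => η (i + 1)) (N + 1)]
  -- Boundary terms are constants; since η 0 / η (N+1) ≥ 1 they can be charged to 1/η (N+1).
  have hinv := hs.one_le_mul_inv (N + 1)
  have c1 : U 0 - U (N + 1) ≤ 4 * G ^ 2 * k * (η 0 * (1 / η (N + 1))) := by
    have t1 := (abs_le.1 (hUb 0)).2
    have t2 := (abs_le.1 (hUb (N + 1))).1
    have t3 := le_mul_of_one_le_right (by positivity : 0 ≤ 4 * G ^ 2 * k) hinv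
    linarith
  have c2 : ∀ a b : ℝ, 0 < b → a ≤ η 0 → a - b ≤ η 0 * (η 0 * (1 / η (N + 1))) := by
    intro a b hb ha
    have := le_mul_of_one_le_right h0pos.le hinv
    linarith
  have c3 := mul_le_mul_of_nonneg_left (c2 _ _ (hs.η_pos (N + 1 + 1)) (hs.η_le_zero (0 + 1)))
    (by positivity : 0 ≤ 2 * G ^ 2)
  have c4 := mul_le_mul_of_nonneg_left (c2 _ _ (hs.η_pos (N + 1)) (hs.η_le_zero 0))
    (by positivity : 0 ≤ k * G ^ 2)
  linarith

end Recursion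

/-- Accumulated squared error of a stochastic approximation recursion. -/
theorem StepSizes.exists_sum_sq_err_le (hs : StepSizes μ η) (G : ℝ) {L : ℝ} (hL : 0 ≤ L) :
    ∃ C, 0 ≤ C ∧ ∀ x F y v v' : ℕ → E, Recursion μ η G L x F y v v' → ∀ N,
      ∑ i ∈ Finset.range (N + 1), ‖x i - F i‖ ^ 2 ≤ C * StepSizes.budget μ η N +
        ∑ i ∈ Finset.range (N + 1), 2 * (1 - η (i + 1)) *
          (inner ℝ (x i - F i) (y i - F i) - inner ℝ (x i - F i) (v i - v' i)) := by
  by_cases hG : 0 ≤ G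
  swap
  · exact ⟨0, le_rfl, fun x F y v v' r => absurd r.G_nonneg hG⟩
  have h0 : 0 < η 0 := hs.η_pos 0
  set C₁ := 4 * G ^ 2 + 4 * (1 + η 0) * G ^ 2 * η 0 + 4 * (1 + η 0) * G * L + 3 * G ^ 2 * η 0 ^ 2
        + 3 * L ^ 2 with hC₁
  set C₂ := (1 + η 0) ^ 2 * L ^ 2 + 3 * L ^ 2 * η 0 with hC₂
  set C₃ := 4 * G ^ 2 * (1 + η 0) * η 0 + 2 * G ^ 2 * η 0 ^ 2 + G ^ 2 * (1 + η 0) * η 0 ^ 2 with hC₃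
  set C₄ := (1 + η 0) * (3 * G * L + 2 * G ^ 2) with hC₄
  have p1 : 0 ≤ C₁ := by positivity
  have p2 : 0 ≤ C₂ := by positivity
  have p3 : 0 ≤ C₃ := by positivity
  have p4 : 0 ≤ C₄ := by positivity
  refine ⟨4 * G ^ 2 + C₁ + C₂ + 2 * C₃ + 2 * C₄ + 16 * G ^ 2, by positivity, ?_⟩
  intro x F y v v' r N
  have h1 := Finset.sum_le_sum fun i (_ : i ∈ Finset.range (N + 1)) => r.sq_err_le hs hL i
  have h2 := r.neg_sum_inner_le hs hL N
  simp only [← hC₁, ← hC₂, ← hC₃, ← hC₄] at h1 h2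
  simp only [Finset.sum_add_distrib, ← Finset.mul_sum] at h1 h2
  rw [Finset.sum_range_sub' (fun i => ‖x i - F i‖ ^ 2 * (1 / η i)), StepSizes.sum_inv_sub] at h1
  -- The products with v - v' are added and subtracted: their sum is bounded pathwise by `h2`, and
  -- the difference from the noise products is kept for its expectation.
  have h3 : ∑ i ∈ Finset.range (N + 1), 2 * (1 - η (i + 1)) *
          (inner ℝ (x i - F i) (y i - F i) - inner ℝ (x i - F i) (v i - v' i)) =
      2 * ∑ i ∈ Finset.range (N + 1), (1 - η (i + 1)) * inner ℝ (x i - F i) (y i - F i) -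
      2 * ∑ i ∈ Finset.range (N + 1), (1 - η (i + 1)) * inner ℝ (x i - F i) (v i - v' i) := by
    rw [Finset.mul_sum, Finset.mul_sum, ← Finset.sum_sub_distrib]
    exact Finset.sum_congr rfl fun i _ => by ring
  rw [h3, StepSizes.budget]
  simp only [Finset.sum_add_distrib]
  set I := 1 / η (N + 1) with hI
  set Sa := ∑ i ∈ Finset.range (N + 1), μ i ^ 2 / η i ^ 2 with hSa
  set Sb := ∑ i ∈ Finset.range (N + 1), μ i with hSb
  set Sc := ∑ i ∈ Finset.range (N + 1), η (i + 1) with hSc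
  have hI0 : 0 ≤ I := by have := hs.η_pos (N + 1); positivity
  have hSa0 : 0 ≤ Sa := Finset.sum_nonneg fun i _ => by positivity
  have hSb0 : 0 ≤ Sb := Finset.sum_nonneg fun i _ => (hs.μ_pos i).le
  have hSc0 : 0 ≤ Sc := Finset.sum_nonneg fun i _ => (hs.η_pos _).le
  have hI1 : 1 / η 0 ≤ I := one_div_le_one_div_of_le (hs.η_pos _) (hs.η_le_zero _)
  have hI2 : 0 ≤ 1 / η 0 := by positivity
  have h4 : ‖x 0 - F 0‖ ^ 2 * (1 / η 0) ≤ 4 * G ^ 2 * I := by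
    have := pow_le_pow_left₀ (norm_nonneg _) (r.norm_err_le 0) 2
    exact mul_le_mul (by linarith) hI1 hI2 (by positivity)
  have h5 : 0 ≤ ‖x (N + 1) - F (N + 1)‖ ^ 2 * I := by positivity
  have h6 : 0 ≤ C₁ * (1 / η 0) := by positivity
  have q1 : 0 ≤ (C₂ + 2 * C₄ + 16 * G ^ 2) * I := by positivity
  have q2 : 0 ≤ (4 * G ^ 2 + C₁ + 2 * C₃ + 2 * C₄ + 16 * G ^ 2) * Sa := by positivity
  have q3 : 0 ≤ (4 * G ^ 2 + C₁ + C₂ + 2 * C₃ + 16 * G ^ 2) * Sb := by positivity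
  have q4 : 0 ≤ (4 * G ^ 2 + C₁ + C₂ + 2 * C₃) * Sc := by positivity
  linarith

end Recursion

/-! ### Size of the budget, and the error bound in expectation. -/

namespace StepSizes

variable {μ η : ℕ → ℝ}

theorem budget_nonneg (h : StepSizes μ η) (N : ℕ) : 0 ≤ budget μ η N := by
  have h1 := h.η_pos (N + 1)
  have h2 : 0 ≤ ∑ i ∈ Finset.range (N + 1), (μ i ^ 2 / η i ^ 2 + μ i + η (i + 1)) :=
    Finset.sum_nonneg fun i _ => by
      have := h.η_pos (i + 1)
      have := h.μ_pos i
      positivity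
  rw [budget]
  positivity

/-- 1/(N η N) is O(N^(r-1)) with r < 1, and the remaining part is a Cesàro mean of a sequence
tending to zero. -/
theorem tendsto_budget (h : StepSizes μ η) :
    Tendsto (fun N : ℕ => 1 / (1 + (N : ℝ)) * budget μ η N) atTop (𝓝 0) := by
  have h1 : Tendsto (fun N : ℕ => (N : ℝ)⁻¹ * (1 / η N)) atTop (𝓝 0) := by
    obtain ⟨r, -, hr1, hO⟩ := h.η_inv
    have e : (fun N : ℕ => (N : ℝ)⁻¹ * (1 / η N)) =O[atTop]
        fun N : ℕ => (N : ℝ)⁻¹ * (N : ℝ) ^ r :=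
      (Asymptotics.isBigO_refl _ _).mul hO
    refine e.trans_tendsto ?_
    have hlim : Tendsto (fun N : ℕ => (N : ℝ) ^ (-(1 - r))) atTop (𝓝 0) :=
      (tendsto_rpow_neg_atTop (sub_pos.2 hr1)).comp tendsto_natCast_atTop_atTop
    refine hlim.congr' ?_
    filter_upwards [eventually_gt_atTop 0] with N hN
    have hN' : (0 : ℝ) < N := Nat.cast_pos.2 hN
    rw [← Real.rpow_neg_one, ← Real.rpow_add hN']
    ring_nf
  have h2 : Tendsto (fun i => μ i ^ 2 / η i ^ 2 + μ i + η (i + 1)) atTop (𝓝 0) := by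
    have := ((h.ratio.pow 2).add h.μ_tendsto).add (h.η_tendsto.comp (tendsto_add_atTop_nat 1))
    simpa [div_pow, Function.comp_def] using this
  have h3 := (h1.add h2.cesaro).comp (tendsto_add_atTop_nat 1)
  rw [add_zero] at h3
  refine h3.congr fun N => ?_
  simp only [Function.comp, budget]
  push_cast
  rw [add_comm (N : ℝ) 1]
  ring

/-- The average budget is at most of the order of the stated rate. -/
theorem budget_le (h : StepSizes μ η) {N : ℕ} {c₁ c₂ : ℝ} (hc₁ : 0 ≤ c₁) (hc₂ : 0 ≤ c₂)
    (hN : 3 ≤ N → 1 ≤ c₁ ∧ 1 ≤ c₂) :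
    1 / (1 + (N : ℝ)) * budget μ η N ≤ (1 + 3 * (1 + η 0) * η 0) *
      (1 / ((1 + (N : ℝ)) * η (N + 1)) + 1 / (1 + (N : ℝ)) * ∑ j ∈ Finset.range (N + 1),
        (μ j * c₁ + μ j ^ 2 / η (j + 1) ^ 2 + μ j ^ 2 / η (j + 1) + η (j + 1) * c₂)) := by
  set Sg := ∑ j ∈ Finset.range (N + 1),
        (μ j * c₁ + μ j ^ 2 / η (j + 1) ^ 2 + μ j ^ 2 / η (j + 1) + η (j + 1) * c₂) with hSg
  have h0 := h.η_pos 0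
  have hη := h.η_pos
  have hμ := h.μ_pos
  have hSg0 : 0 ≤ Sg := Finset.sum_nonneg fun j _ => by
    have := hη (j + 1); have := hμ j; positivity
  have hI := hη (N + 1)
  have key : budget μ η N ≤ (1 + 3 * (1 + η 0) * η 0) * (1 / η (N + 1) + Sg) := by
    have hsq : ∀ j, μ j ^ 2 / η j ^ 2 ≤ μ j ^ 2 / η (j + 1) ^ 2 := fun j => by
      have := hη (j + 1); have := hη j; have := h.η_antitone j.le_succ
      gcongr
    have hA : budget μ η N ≤ 1 / η (N + 1) + Sg + 3 * (1 + η 0) * η 0 * (1 / η (N + 1)) := by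
      rw [budget, add_assoc]
      refine add_le_add le_rfl ?_
      -- For `N < 3` the factors `c₁`, `c₂` may be below 1, so the terms are not comparable. There
      -- are then at most three terms, each in excess by at most 1 + η 0, and 1/η (N+1) absorbs
      -- them.
      by_cases h3 : 3 ≤ N
      · obtain ⟨d₁, d₂⟩ := hN h3
        have : ∑ i ∈ Finset.range (N + 1), (μ i ^ 2 / η i ^ 2 + μ i + η (i + 1)) ≤ Sg := by
          refine Finset.sum_le_sum fun j _ => ?_
          have := hη (j + 1); have := hμ j
          have t1 := le_mul_of_one_le_right (hμ j).le d₁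
          have t2 := le_mul_of_one_le_right (hη (j + 1)).le d₂
          have t3 : 0 ≤ μ j ^ 2 / η (j + 1) := by positivity
          linarith [hsq j]
        have : 0 ≤ 3 * (1 + η 0) * η 0 * (1 / η (N + 1)) := by positivity
        linarith
      · have t1 : ∑ i ∈ Finset.range (N + 1), (μ i ^ 2 / η i ^ 2 + μ i + η (i + 1)) ≤
            ∑ i ∈ Finset.range (N + 1), ((μ i * c₁ + μ i ^ 2 / η (i + 1) ^ 2
              + μ i ^ 2 / η (i + 1) + η (i + 1) * c₂) + (1 + η 0)) := by
          refine Finset.sum_le_sum fun j _ => ?_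
          have := hη (j + 1); have := hμ j
          have t2 : 0 ≤ μ j ^ 2 / η (j + 1) := by positivity
          have t3 : 0 ≤ μ j * c₁ := by positivity
          have t4 : 0 ≤ η (j + 1) * c₂ := by positivity
          linarith [hsq j, h.μ_le_one j, h.η_le_zero (j + 1)]
        rw [Finset.sum_add_distrib (g := fun _ => 1 + η 0), Finset.sum_const, Finset.card_range, nsmul_eq_mul] at t1
        have t2 : ((N + 1 : ℕ) : ℝ) ≤ 3 := by exact_mod_cast (by omega : N + 1 ≤ 3)
        have t3 : ((N + 1 : ℕ) : ℝ) * (1 + η 0) ≤ 3 * (1 + η 0) :=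
          mul_le_mul_of_nonneg_right t2 (by positivity)
        have t4 : 3 * (1 + η 0) ≤ 3 * (1 + η 0) * (η 0 * (1 / η (N + 1))) :=
          le_mul_of_one_le_right (by positivity) (h.one_le_mul_inv (N + 1))
        linarith
    have : 0 ≤ 3 * (1 + η 0) * η 0 * Sg := by positivity
    linarith
  calc _ ≤ 1 / (1 + (N : ℝ)) * ((1 + 3 * (1 + η 0) * η 0) * (1 / η (N + 1) + Sg)) := by gcongr
    _ = _ := by
      have : (1 + (N : ℝ)) ≠ 0 := by positivity
      field_simp

variable {E : Type*} [NormedAddCommGroup E] [InnerProductSpace ℝ E]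

theorem _root_.CACRL.BddMeas.inner {X : Type*} [MeasurableSpace X] {φ ψ : X → E} {C D : ℝ}
    (h : BddMeas φ C) (h' : BddMeas ψ D) : BddMeas (fun x => inner ℝ (φ x) (ψ x)) (C * D) :=
  ⟨h.meas.inner h'.meas, fun x => (norm_inner_le_norm _ _).trans
    (mul_le_mul (h.bound x) (h'.bound x) (norm_nonneg _) ((norm_nonneg _).trans (h.bound x)))⟩

/-- Expected accumulated squared error of a random stochastic approximation recursion whose samples
are biased by the increments `v - v'` up to errors `ε`. -/
theorem exists_sum_integral_sq_err_le (hs : StepSizes μ η) (G : ℝ) {L : ℝ} (hL : 0 ≤ L) :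
    ∃ C, 0 ≤ C ∧ ∀ (Ω : Type*) [MeasurableSpace Ω] (P : Measure Ω) [IsProbabilityMeasure P]
      (x F y v v' : ℕ → Ω → E) (ε : ℕ → ℝ), (∀ i, StronglyMeasurable (x i)) →
      (∀ i, StronglyMeasurable (F i)) → (∀ i, StronglyMeasurable (y i)) →
      (∀ i, StronglyMeasurable (v i)) → (∀ i, StronglyMeasurable (v' i)) →
      (∀ ω, Recursion μ η G L (x · ω) (F · ω) (y · ω) (v · ω) (v' · ω)) →
      (∀ i, |∫ ω, inner ℝ (x i ω - F i ω) (y i ω - F i ω) ∂P -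
        ∫ ω, inner ℝ (x i ω - F i ω) (v i ω - v' i ω) ∂P| ≤ ε i) → ∀ N,
      ∑ i ∈ Finset.range (N + 1), ∫ ω, ‖x i ω - F i ω‖ ^ 2 ∂P ≤
        C * (budget μ η N + ∑ i ∈ Finset.range (N + 1), ε i) := by
  obtain ⟨C, hC0, hC⟩ := hs.exists_sum_sq_err_le (E := E) G hL
  have h0 := hs.η_pos 0
  refine ⟨C + 2 * (1 + η 0), by positivity, ?_⟩
  intro Ω _ P _ x F y v v' ε hx hF hy hv hv' hrec hε N
  have hG : 0 ≤ G := by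
    obtain ⟨ω⟩ : Nonempty Ω := P.nonempty_of_neZero
    exact (hrec ω).G_nonneg
  have be : ∀ i, BddMeas (fun ω => x i ω - F i ω) (2 * G) := fun i =>
    ⟨(hx i).sub (hF i), fun ω => (hrec ω).norm_err_le i⟩
  have by' : ∀ i, BddMeas (fun ω => y i ω - F i ω) (G + G) := fun i =>
    BddMeas.sub ⟨hy i, fun ω => (hrec ω).y_le i⟩ ⟨hF i, fun ω => (hrec ω).F_le i⟩
  -- No bound on v' is part of the recursion; it follows from v (i+1) and the increment bound.
  have bv' : ∀ i, BddMeas (v' i) (G + L * μ i) := fun i => ⟨hv' i, fun ω => by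
    have t1 := (hrec ω).v_le (i + 1)
    have t2 := (hrec ω).v_lip i
    have t3 := norm_sub_norm_le (v' i ω) (v (i + 1) ω)
    rw [norm_sub_rev] at t3
    linarith⟩
  have bv : ∀ i, BddMeas (fun ω => v i ω - v' i ω) (G + (G + L * μ i)) := fun i =>
    BddMeas.sub ⟨hv i, fun ω => (hrec ω).v_le i⟩ (bv' i)
  have i1 : ∀ i, Integrable (fun ω => ‖x i ω - F i ω‖ ^ 2) P := fun i => by
    simpa only [real_inner_self_eq_norm_sq] using ((be i).inner (be i)).integrable P
  have i2 : ∀ i, Integrable (fun ω => inner ℝ (x i ω - F i ω) (y i ω - F i ω)) P :=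
    fun i => ((be i).inner (by' i)).integrable P
  have i3 : ∀ i, Integrable (fun ω => inner ℝ (x i ω - F i ω) (v i ω - v' i ω)) P :=
    fun i => ((be i).inner (bv i)).integrable P
  have i4 : ∀ i, Integrable (fun ω => 2 * (1 - η (i + 1)) *
      (inner ℝ (x i ω - F i ω) (y i ω - F i ω) - inner ℝ (x i ω - F i ω) (v i ω - v' i ω))) P :=
    fun i => ((i2 i).sub (i3 i)).const_mul _
  rw [← integral_finsetSum _ fun i _ => i1 i]
  have h1 : ∫ ω, ∑ i ∈ Finset.range (N + 1), ‖x i ω - F i ω‖ ^ 2 ∂P ≤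
      ∫ ω, (C * budget μ η N + ∑ i ∈ Finset.range (N + 1), 2 * (1 - η (i + 1)) *
        (inner ℝ (x i ω - F i ω) (y i ω - F i ω) - inner ℝ (x i ω - F i ω) (v i ω - v' i ω))) ∂P :=
    integral_mono (integrable_finsetSum _ fun i _ => i1 i)
      ((integrable_const _).add (integrable_finsetSum _ fun i _ => i4 i))
      fun ω => hC _ _ _ _ _ (hrec ω) N
  rw [integral_add (integrable_const _) (integrable_finsetSum _ fun i _ => i4 i),
    integral_finsetSum _ fun i _ => i4 i] at h1
  simp only [integral_const, probReal_univ, one_smul] at h1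
  have h2 : ∀ i, ∫ ω, 2 * (1 - η (i + 1)) *
      (inner ℝ (x i ω - F i ω) (y i ω - F i ω) - inner ℝ (x i ω - F i ω) (v i ω - v' i ω)) ∂P ≤
      2 * (1 + η 0) * ε i := fun i => by
    rw [integral_const_mul, integral_sub (i2 i) (i3 i), mul_assoc, mul_assoc]
    refine mul_le_mul_of_nonneg_left ((le_abs_self _).trans ?_) zero_le_two
    rw [abs_mul]
    exact mul_le_mul (hs.abs_one_sub_le _) (hε i) (abs_nonneg _) (by positivity)
  have h3 := Finset.sum_le_sum fun i (_ : i ∈ Finset.range (N + 1)) => h2 i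
  rw [← Finset.mul_sum] at h3
  have h4 : 0 ≤ ∑ i ∈ Finset.range (N + 1), ε i :=
    Finset.sum_nonneg fun i _ => (abs_nonneg _).trans (hε i)
  have h5 := mul_nonneg hC0 h4
  have h6 : 0 ≤ 2 * (1 + η 0) * budget μ η N :=
    mul_nonneg (by positivity) (hs.budget_nonneg N)
  linarith

end StepSizes

theorem LipFamily.exists_bddMeas_uncurry {n : ℕ} {Θ : Set (Euc n)} {X E : Type*}
    [MeasurableSpace X] [NormedAddCommGroup E] {φ : ↥Θ → X → E} (h : LipFamily φ) :
    ∃ C, 0 ≤ C ∧ BddMeas (Function.uncurry φ) C := by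
  obtain ⟨C, hC0, hC⟩ := h.bdd
  exact ⟨C, hC0, h.stronglyMeasurable_uncurry, fun p => (hC p.1).bound p.2⟩

/-! ### Telescoping of the bias of batch averages. -/

namespace Run

variable {nS nZ nA K n : ℕ} {S : Set (Euc nS)} {Z : Set (Euc nZ)} {A : Set (Euc nA)}
  {M : CMDP S Z A K} {π : Policy S Z A n} {Θ : Set (Euc n)} {q : ℕ}
  {Qnet : Fin (K + 1) → Euc q → AugState S Z → ↥A → ℝ} {μ η : ℕ → ℝ} {B : ℕ}
  {Ω : Type*} [mΩ : MeasurableSpace Ω] {P : Measure Ω} (R : Run M π Θ Qnet μ η B P)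
  (hmem : ∀ i ω, R.θ i ω ∈ Θ)

theorem measurable_of_adapted {β : Type*} [MeasurableSpace β] {t : ℕ} {f : Ω → β}
    (h : Measurable[R.𝓕 t] f) : Measurable f := h.mono (R.𝓕.le t) le_rfl

/-- Evaluating a parameter-dependent function along the run. -/
theorem bddMeas_eval {X E : Type*} [MeasurableSpace X] [NormedAddCommGroup E] {φ : ↥Θ → X → E}
    {C : ℝ} (h : BddMeas (Function.uncurry φ) C) (i : ℕ) {g : Ω → X} (hg : Measurable g) :
    BddMeas (fun ω => φ (R.param hmem i ω) (g ω)) C :=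
  h.comp (g := fun ω => (R.param hmem i ω, g ω))
    ((R.measurable_of_adapted (R.measurable_param hmem le_rfl)).prodMk hg)

include hmem in
theorem norm_θ_succ_sub_le (hμ : ∀ i, 0 < μ i) {r : ℝ} (hr : ∀ θ ∈ Θ, ∀ θ' ∈ Θ, ‖θ' - θ‖ ≤ r)
    (i : ℕ) (ω : Ω) : ‖R.θ (i + 1) ω - R.θ i ω‖ ≤ μ i * r := by
  have e : R.θ (i + 1) ω - R.θ i ω = μ i • (R.θbar i ω - R.θ i ω) := by rw [R.θ_succ]; module
  rw [e, norm_smul, Real.norm_eq_abs, abs_of_pos (hμ i)]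
  exact mul_le_mul_of_nonneg_left (hr _ (hmem i ω) _ (R.θbar_mem i ω)) (hμ i).le

variable {E : Type*} [NormedAddCommGroup E] [InnerProductSpace ℝ E] [CompleteSpace E]
  [MeasurableSpace E] [BorelSpace E] [SecondCountableTopology E]

/-- The bias of a batch average telescopes along a solution `u` of Poisson's equation. -/
theorem integral_inner_batch [IsProbabilityMeasure P] (hB : 0 < B)
    {H : ↥Θ → AugState S Z × ↥A × AugState S Z → E} {u : ↥Θ → AugState S Z → E} {F : ↥Θ → E}
    (hH : LipFamily H) (hu : LipFamily u) (hF : LipFamily fun θ (_ : AugState S Z) => F θ)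
    (hpo : ∀ (θ : ↥Θ) x, ∫ p, H θ (x, p) ∂(M.stepKernel π θ x) + ∫ y, u θ y ∂(M.stateKernel π θ x) =
      u θ x + F θ) {i : ℕ} {W : Ω → E} {w : ℝ} (hW : Measurable[R.𝓕 (B * i)] W)
    (hWb : ∀ ω, ‖W ω‖ ≤ w) :
    ∫ ω, inner ℝ (W ω) ((1 / (B : ℝ)) • ∑ j ∈ Finset.range B, H (R.param hmem i ω)
        (R.s (B * i + j) ω, R.a (B * i + j) ω, R.s (B * i + j + 1) ω) -
        F (R.param hmem i ω)) ∂P =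
      ∫ ω, inner ℝ (W ω) ((1 / (B : ℝ)) • u (R.param hmem i ω) (R.s (B * i) ω) -
        (1 / (B : ℝ)) • u (R.param hmem i ω) (R.s (B * (i + 1)) ω)) ∂P := by
  obtain ⟨CH, -, hCH⟩ := hH.exists_bddMeas_uncurry
  obtain ⟨Cu, -, hCu⟩ := hu.exists_bddMeas_uncurry
  obtain ⟨CF, -, hCF⟩ := hF.exists_bddMeas_uncurry
  set θ := R.param hmem i with hθ
  have ms : ∀ t, Measurable (R.s t) := fun t => R.measurable_of_adapted (R.s_measurable t)
  have ma : ∀ t, Measurable (R.a t) := fun t => R.measurable_of_adapted (R.a_measurable t)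
  have bW : BddMeas W w := ⟨(R.measurable_of_adapted hW).stronglyMeasurable, hWb⟩
  have bH : ∀ t, BddMeas (fun ω => H (θ ω) (R.s t ω, R.a t ω, R.s (t + 1) ω)) CH := fun t =>
    R.bddMeas_eval hmem hCH i ((ms t).prodMk ((ma t).prodMk (ms (t + 1))))
  have bu : ∀ t, BddMeas (fun ω => u (θ ω) (R.s t ω)) Cu := fun t =>
    R.bddMeas_eval hmem hCu i (ms t)
  have bF : BddMeas (fun ω => F (θ ω)) CF := R.bddMeas_eval hmem hCF i (ms 0)
  -- By Poisson's equation `D` has conditional mean zero in every slot of the batch, where the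
  -- parameter is frozen; `W` is known before the batch, so the products vanish in expectation.
  set D : ℕ → Ω → E := fun t ω => H (θ ω) (R.s t ω, R.a t ω, R.s (t + 1) ω) +
    u (θ ω) (R.s (t + 1) ω) - (u (θ ω) (R.s t ω) + F (θ ω)) with hD
  have bD : ∀ t, BddMeas (D t) (CH + Cu + (Cu + CF)) := fun t =>
    ((bH t).add (bu (t + 1))).sub ((bu t).add bF)
  have hzero : ∀ j, j < B → ∫ ω, inner ℝ (W ω) (D (B * i + j) ω) ∂P = 0 := by
    intro j hj
    have hG : BddMeas (fun r : (↥Θ × AugState S Z) × ↥A × AugState S Z =>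
        H r.1.1 (r.1.2, r.2) + u r.1.1 r.2.2 - (u r.1.1 r.1.2 + F r.1.1))
        (CH + Cu + (Cu + CF)) :=
      ((hCH.comp (g := fun r : (↥Θ × AugState S Z) × ↥A × AugState S Z =>
          (r.1.1, r.1.2, r.2)) (by fun_prop)).add
        (hCu.comp (g := fun r : (↥Θ × AugState S Z) × ↥A × AugState S Z =>
          (r.1.1, r.2.2)) (by fun_prop))).sub
      ((hCu.comp (g := fun r : (↥Θ × AugState S Z) × ↥A × AugState S Z =>
          (r.1.1, r.1.2)) (by fun_prop)).add
        (hCF.comp (g := fun r : (↥Θ × AugState S Z) × ↥A × AugState S Z =>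
          (r.1.1, r.1.2)) (by fun_prop)))
    have h1 := R.integral_inner_step hmem hj
      (hW.mono (R.𝓕.mono (Nat.le_add_right _ _)) le_rfl) hWb
      (G := fun θ x p => H θ (x, p) + u θ p.2 - (u θ x + F θ)) hG
    refine h1.trans ?_
    rw [← integral_zero Ω ℝ (μ := P)]
    refine integral_congr_ae (ae_of_all _ fun ω => ?_)
    have hx : ∀ (θ : ↥Θ) x, ∫ p, (H θ (x, p) + u θ p.2 - (u θ x + F θ)) ∂(M.stepKernel π θ x)
        = 0 := by
      intro θ x
      have c1 : BddMeas (fun p => H θ (x, p)) CH :=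
        hCH.comp (g := fun p => (θ, x, p)) (by fun_prop)
      have c0 : BddMeas (u θ) Cu := hCu.comp (g := fun y => (θ, y)) (by fun_prop)
      have c2 : BddMeas (fun p : ↥A × AugState S Z => u θ p.2) Cu := c0.comp measurable_snd
      rw [integral_sub ((c1.add c2).integrable _) (integrable_const _),
        integral_add (c1.integrable _) (c2.integrable _), ← M.integral_stateKernel π θ x c0, hpo]
      simp
    have := hx (R.param hmem i ω) (R.s (B * i + j) ω)
    change inner ℝ (W ω) (∫ p, (H (R.param hmem i ω) (R.s (B * i + j) ω, p) +
      u (R.param hmem i ω) p.2 - (u (R.param hmem i ω) (R.s (B * i + j) ω) +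
        F (R.param hmem i ω))) ∂(M.stepKernel π (R.param hmem i ω) (R.s (B * i + j) ω))) = 0
    rw [this, inner_zero_right]
  have hB' : (B : ℝ) ≠ 0 := Nat.cast_ne_zero.2 hB.ne'
  have hpath : ∀ ω, inner ℝ (W ω) ((1 / (B : ℝ)) • ∑ j ∈ Finset.range B, H (θ ω)
        (R.s (B * i + j) ω, R.a (B * i + j) ω, R.s (B * i + j + 1) ω) - F (θ ω)) =
      -- Summed over the slots, the differences of u between consecutive states collapse to the two
      -- ends of the batch.
      inner ℝ (W ω) ((1 / (B : ℝ)) • u (θ ω) (R.s (B * i) ω) -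
        (1 / (B : ℝ)) • u (θ ω) (R.s (B * (i + 1)) ω)) +
      (1 / (B : ℝ)) * ∑ j ∈ Finset.range B, inner ℝ (W ω) (D (B * i + j) ω) := by
    intro ω
    have t1 : ∑ j ∈ Finset.range B, D (B * i + j) ω =
        ∑ j ∈ Finset.range B, H (θ ω)
          (R.s (B * i + j) ω, R.a (B * i + j) ω, R.s (B * i + j + 1) ω) +
        (u (θ ω) (R.s (B * (i + 1)) ω) - u (θ ω) (R.s (B * i) ω)) - (B : ℝ) • F (θ ω) := by
      have t2 := Finset.sum_range_sub (fun j => u (θ ω) (R.s (B * i + j) ω)) B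
      rw [add_zero, ← Nat.mul_succ] at t2
      rw [Nat.succ_eq_add_one] at t2
      rw [← t2, ← Finset.sum_add_distrib]
      have t3 : (B : ℝ) • F (θ ω) = ∑ j ∈ Finset.range B, F (θ ω) := by
        rw [Finset.sum_const, Finset.card_range, Nat.cast_smul_eq_nsmul]
      rw [t3, ← Finset.sum_sub_distrib]
      refine Finset.sum_congr rfl fun j _ => ?_
      simp only [hD, ← add_assoc]
      abel
    rw [← inner_sum, t1, ← inner_smul_right, ← inner_add_right]
    congr 1
    rw [smul_sub, smul_add, smul_sub, smul_smul, one_div_mul_cancel hB', one_smul]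
    abel
  simp_rw [hpath]
  have bv : BddMeas (fun ω => (1 / (B : ℝ)) • u (θ ω) (R.s (B * i) ω) -
      (1 / (B : ℝ)) • u (θ ω) (R.s (B * (i + 1)) ω)) (‖1 / (B : ℝ)‖ * Cu + ‖1 / (B : ℝ)‖ * Cu) :=
    (BddMeas.smul (BddMeas.const _) (bu _)).sub (BddMeas.smul (BddMeas.const _) (bu _))
  rw [integral_add ((bW.inner bv).integrable P)
    ((integrable_finsetSum _ fun j _ => (bW.inner (bD _)).integrable P).const_mul _),
    integral_const_mul, integral_finsetSum _ fun j _ => (bW.inner (bD _)).integrable P,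
    Finset.sum_eq_zero fun j hj => hzero j (Finset.mem_range.1 hj)]
  simp

end Run

theorem norm_batch_le {E : Type*} [NormedAddCommGroup E] [NormedSpace ℝ E] {B : ℕ} (hB : 0 < B)
    {z : ℕ → E} {c : ℝ} (hz : ∀ j, j < B → ‖z j‖ ≤ c) :
    ‖(1 / (B : ℝ)) • ∑ j ∈ Finset.range B, z j‖ ≤ c := by
  have hB' : (0 : ℝ) < B := Nat.cast_pos.2 hB
  have h := norm_sum_le_of_le (Finset.range B) fun j hj => hz j (Finset.mem_range.1 hj)
  rw [Finset.sum_const, Finset.card_range, nsmul_eq_mul] at h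
  rw [norm_smul, Real.norm_eq_abs, abs_of_pos (by positivity)]
  calc 1 / (B : ℝ) * ‖∑ j ∈ Finset.range B, z j‖ ≤ 1 / (B : ℝ) * (B * c) := by gcongr
    _ = c := by field_simp

section Batch

variable {nS nZ nA K n : ℕ} {S : Set (Euc nS)} {Z : Set (Euc nZ)} {A : Set (Euc nA)}
  {M : CMDP S Z A K} {π : Policy S Z A n} {Θ : Set (Euc n)} {q : ℕ}
  {Qnet : Fin (K + 1) → Euc q → AugState S Z → ↥A → ℝ} {μ η : ℕ → ℝ} {B : ℕ}
  {E : Type*} [NormedAddCommGroup E] [InnerProductSpace ℝ E] [CompleteSpace E]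
  [MeasurableSpace E] [BorelSpace E] [SecondCountableTopology E]

/-- Batch average of a function of the parameter and of the slots of iteration `i`. -/
def Run.batch {Ω : Type*} [MeasurableSpace Ω] {P : Measure Ω} (R : Run M π Θ Qnet μ η B P)
    (hmem : ∀ i ω, R.θ i ω ∈ Θ) (H : ↥Θ → AugState S Z × ↥A × AugState S Z → E) (i : ℕ) (ω : Ω) :
    E :=
  (1 / (B : ℝ)) • ∑ j ∈ Finset.range B, H (R.param hmem i ω)
    (R.s (B * i + j) ω, R.a (B * i + j) ω, R.s (B * i + j + 1) ω)

omit [CompleteSpace E] [MeasurableSpace E] [BorelSpace E] [SecondCountableTopology E] in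
theorem Run.bddMeas_batch {Ω : Type*} [MeasurableSpace Ω] {P : Measure Ω}
    (R : Run M π Θ Qnet μ η B P) (hmem : ∀ i ω, R.θ i ω ∈ Θ) (hB : 0 < B)
    {H : ↥Θ → AugState S Z × ↥A × AugState S Z → E} {C : ℝ}
    (hH : BddMeas (Function.uncurry H) C) (i : ℕ) : BddMeas (R.batch hmem H i) C := by
  have h : ∀ j, BddMeas (fun ω => H (R.param hmem i ω)
      (R.s (B * i + j) ω, R.a (B * i + j) ω, R.s (B * i + j + 1) ω)) C := fun j =>
    R.bddMeas_eval hmem hH i ((R.measurable_of_adapted (R.s_measurable _)).prodMk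
      ((R.measurable_of_adapted (R.a_measurable _)).prodMk
        (R.measurable_of_adapted (R.s_measurable _))))
  exact ⟨(Finset.stronglyMeasurable_fun_sum _ fun j _ => (h j).meas).const_smul _,
    fun ω => norm_batch_le hB fun j _ => (h j).bound ω⟩

/-- Convergence of the estimates of a function `F` of the parameter, given samples `y` close to
batch averages of `H`, where `u` solves Poisson's equation for `H` and `F`. -/
theorem exists_sum_integral_sq_le (hs : StepSizes μ η) (hcomp : IsCompact Θ) (hB : 0 < B)
    {H : ↥Θ → AugState S Z × ↥A × AugState S Z → E} {u : ↥Θ → AugState S Z → E} {F : ↥Θ → E}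
    (hH : LipFamily H) (hu : LipFamily u) (hF : LipFamily fun θ (_ : AugState S Z) => F θ)
    (hpo : ∀ (θ : ↥Θ) x, ∫ p, H θ (x, p) ∂(M.stepKernel π θ x) +
      ∫ y, u θ y ∂(M.stateKernel π θ x) = u θ x + F θ) (b c : ℝ) :
    ∃ C G, 0 ≤ C ∧ 0 ≤ G ∧ ∀ (Ω : Type*) [MeasurableSpace Ω] (P : Measure Ω)
      [IsProbabilityMeasure P] (R : Run M π Θ Qnet μ η B P) (hmem : ∀ i ω, R.θ i ω ∈ Θ)
      (x y : ℕ → Ω → E), (∀ i, Measurable[R.𝓕 (B * i)] (x i)) → (∀ i, Measurable (y i)) →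
      (∀ ω, ‖x 0 ω‖ ≤ b) → (∀ i ω, ‖y i ω‖ ≤ c) →
      (∀ i ω, x (i + 1) ω = (1 - η (i + 1)) • x i ω + η i • y i ω) →
      (∀ i ω, ‖x i ω‖ ≤ G) ∧ (∀ i, BddMeas (fun ω => x i ω - F (R.param hmem i ω)) (2 * G)) ∧
      ∀ N, ∑ i ∈ Finset.range (N + 1), ∫ ω, ‖x i ω - F (R.param hmem i ω)‖ ^ 2 ∂P ≤
        C * (StepSizes.budget μ η N + ∑ i ∈ Finset.range (N + 1),
          |∫ ω, inner ℝ (x i ω - F (R.param hmem i ω)) (y i ω - R.batch hmem H i ω) ∂P|) := by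
  obtain ⟨CH, hCH0, hCH⟩ := hH.exists_bddMeas_uncurry
  obtain ⟨Cu, hCu0, hCu⟩ := hu.exists_bddMeas_uncurry
  obtain ⟨CF, hCF0, hCF⟩ := hF.exists_bddMeas_uncurry
  obtain ⟨Lu, hLu0, hLu⟩ := hu.lip
  obtain ⟨LF, hLF0, hLF⟩ := hF.lip
  obtain ⟨G₀, hG₀0, hG₀⟩ := hs.exists_bound (E := E) b c
  obtain ⟨r, hr⟩ := Metric.isBounded_iff.1 hcomp.isBounded
  have hr' : ∀ θ ∈ Θ, ∀ θ' ∈ Θ, ‖θ' - θ‖ ≤ |r| := fun θ h θ' h' => by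
    rw [← dist_eq_norm]; exact (hr h' h).trans (le_abs_self r)
  set G := G₀ + |c| + Cu + CF with hG
  have hc0 := abs_nonneg c
  have hr0 := abs_nonneg r
  obtain ⟨C, hC0, hC⟩ := hs.exists_sum_integral_sq_err_le (E := E) G
    (L := (Lu + LF) * |r|) (by positivity)
  refine ⟨C, G, hC0, by positivity, ?_⟩
  intro Ω _ P _ R hmem x y hx hy hx0 hyc hrec
  have ms : ∀ t, Measurable (R.s t) := fun t => R.measurable_of_adapted (R.s_measurable t)
  have hxG : ∀ i ω, ‖x i ω‖ ≤ G₀ := fun i ω =>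
    hG₀ (x · ω) (y · ω) (hx0 ω) (fun i => hyc i ω) (fun i => hrec i ω) i
  have bF : ∀ i, BddMeas (fun ω => F (R.param hmem i ω)) CF := fun i =>
    R.bddMeas_eval hmem hCF i (ms 0)
  have bu : ∀ i t, BddMeas (fun ω => u (R.param hmem i ω) (R.s t ω)) Cu := fun i t =>
    R.bddMeas_eval hmem hCu i (ms t)
  have hB1 : ‖(1 : ℝ) / B‖ ≤ 1 := by
    have : (1 : ℝ) ≤ B := Nat.one_le_cast.2 hB
    rw [Real.norm_eq_abs, abs_of_nonneg (by positivity), div_le_one (by positivity)]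
    exact this
  have hstep := R.norm_θ_succ_sub_le hmem hs.μ_pos hr'
  -- v (i+1) and v' i evaluate u at the same state, the first with the new parameter and the second
  -- with the old one. They differ by the Lipschitz constant times μ i and the diameter bound |r|,
  -- like consecutive targets.
  have hrecur : ∀ ω, Recursion μ η G ((Lu + LF) * |r|) (x · ω) (fun i => F (R.param hmem i ω))
      (y · ω) (fun i => (1 / (B : ℝ)) • u (R.param hmem i ω) (R.s (B * i) ω))
      (fun i => (1 / (B : ℝ)) • u (R.param hmem i ω) (R.s (B * (i + 1)) ω)) := by
    intro ω
    refine ⟨fun i => hrec i ω, fun i => (hxG i ω).trans (by linarith),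
      fun i => ((bF i).bound ω).trans (by linarith),
      fun i => (hyc i ω).trans (by linarith [le_abs_self c]), fun i => ?_, fun i => ?_,
      fun i => ?_⟩
    · rw [norm_smul]
      have := mul_le_mul hB1 ((bu i (B * i)).bound ω) (norm_nonneg _) zero_le_one
      linarith
    · refine (hLF _ _ (R.s 0 ω)).trans ?_
      refine (mul_le_mul_of_nonneg_left (hstep i ω) hLF0).trans ?_
      have : 0 ≤ Lu * |r| * μ i := mul_nonneg (by positivity) (hs.μ_pos i).le
      linarith
    · rw [← smul_sub, norm_smul]
      refine (mul_le_mul hB1 (hLu _ _ _) (norm_nonneg _) zero_le_one).trans ?_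
      rw [one_mul]
      refine (mul_le_mul_of_nonneg_left (hstep i ω) hLu0).trans ?_
      have : 0 ≤ LF * |r| * μ i := mul_nonneg (by positivity) (hs.μ_pos i).le
      linarith
  have bx : ∀ i, BddMeas (x i) G₀ := fun i =>
    ⟨(R.measurable_of_adapted (hx i)).stronglyMeasurable, hxG i⟩
  have by' : ∀ i, BddMeas (y i) c := fun i => ⟨(hy i).stronglyMeasurable, hyc i⟩
  have be : ∀ i, BddMeas (fun ω => x i ω - F (R.param hmem i ω)) (2 * G) := fun i =>
    ((bx i).sub (bF i)).mono (by linarith)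
  refine ⟨fun i ω => (hxG i ω).trans (by linarith), be, ?_⟩
  refine hC Ω P x (fun i ω => F (R.param hmem i ω)) y
    (fun i ω => (1 / (B : ℝ)) • u (R.param hmem i ω) (R.s (B * i) ω))
    (fun i ω => (1 / (B : ℝ)) • u (R.param hmem i ω) (R.s (B * (i + 1)) ω)) _
    (fun i => (bx i).meas) (fun i => (bF i).meas) (fun i => (by' i).meas)
    (fun i => (bu i _).meas.const_smul _) (fun i => (bu i _).meas.const_smul _) hrecur fun i => ?_
  have hxF : Measurable[R.𝓕 (B * i)] fun ω => x i ω - F (R.param hmem i ω) := by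
    have h1 : Measurable[R.𝓕 (B * i)] fun ω => F (R.param hmem i ω) :=
      hCF.meas.measurable.comp ((R.measurable_param hmem le_rfl).prodMk
        (R.measurable_s_of_le (Nat.zero_le _)))
    exact (hx i).sub h1
  have bbatch := R.bddMeas_batch hmem hB hCH i
  rw [← R.integral_inner_batch hmem hB hH hu hF hpo hxF (be i).bound]
  change |_ - ∫ ω, inner ℝ (x i ω - F (R.param hmem i ω))
    (R.batch hmem H i ω - F (R.param hmem i ω)) ∂P| ≤ _
  rw [← integral_sub (((be i).inner ((by' i).sub (bF i))).integrable P)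
      (((be i).inner (bbatch.sub (bF i))).integrable P)]
  refine le_of_eq (congrArg abs (integral_congr_ae (ae_of_all _ fun ω => ?_)))
  simp only [← inner_sub_right, sub_sub_sub_cancel_right]

end Batch

/-! ### Error bounds for the value and gradient estimates. -/

section Estimates

variable {nS nZ nA K n : ℕ} {S : Set (Euc nS)} {Z : Set (Euc nZ)} {A : Set (Euc nA)}
  {M : CMDP S Z A K} {π : Policy S Z A n} {Θ : Set (Euc n)} {lam ρ : ℝ}
  {m : ↥Θ → ProbabilityMeasure (AugState S Z)} {q : ℕ}
  {Qnet : Fin (K + 1) → Euc q → AugState S Z → ↥A → ℝ} {μ η : ℕ → ℝ} {B : ℕ}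

namespace Regularity

variable (Rg : Regularity M π Θ lam ρ m) (k : Fin (K + 1))
include Rg

theorem lipFamily_reshapedCost : LipFamily (fun (_ : ↥Θ) (p : AugState S Z × ↥A × AugState S Z) =>
    M.reshapedCost k p.1 p.2.1 p.2.2) := by
  obtain ⟨C, hC⟩ := Rg.exists_bddMeas_reshapedCost k
  exact LipFamily.const (hC.comp (g := fun p : AugState S Z × ↥A × AugState S Z =>
    ((p.1, p.2.1), p.2.2)) (by fun_prop))

/-- Poisson's equation in the form required for batch averages of the costs. -/
theorem meanCost_add_integral_value (θ : ↥Θ) (x : AugState S Z) :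
    ∫ p, M.reshapedCost k x p.1 p.2 ∂(M.stepKernel π θ x) +
      ∫ y, M.value π m k θ y ∂(M.stateKernel π θ x) =
      M.value π m k θ x + M.avgCost π m k θ := by
  obtain ⟨C, -, hC⟩ := (Rg.lipFamily_meanCost k).bdd
  have h := (Rg.ergodic θ).poisson_sub (hC θ) x
  change M.value π m k θ x - ∫ y, M.value π m k θ y ∂(M.stateKernel π θ x) =
    M.meanCost π θ k x - M.avgCost π m k θ at h
  change M.meanCost π θ k x + _ = _
  linarith

/-- The action value times the score. -/
theorem lipFamily_qScore : LipFamily (fun (θ : ↥Θ) (p : AugState S Z × ↥A × AugState S Z) =>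
    M.qValue π m k θ (p.1, p.2.1) • π.score Θ θ p.1 p.2.1) :=
  ((Rg.lipFamily_qValue k).smul Rg.lipFamily_score).comp
    (g := fun p : AugState S Z × ↥A × AugState S Z => (p.1, p.2.1)) (by fun_prop)

omit Rg in
theorem integral_stepKernel_fst {E : Type*} [NormedAddCommGroup E] [NormedSpace ℝ E]
    [CompleteSpace E] {ψ : ↥A → E} {C : ℝ} (h : BddMeas ψ C) (θ : Euc n) (x : AugState S Z) :
    ∫ p, ψ p.1 ∂(M.stepKernel π θ x) = ∫ a, ψ a ∂(π.kernel θ x) := by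
  rw [M.integral_stepKernel π θ x (h.comp measurable_fst)]
  simp

/-- The counterpart for action value times score, whose mean given the state is `gradTerm`. -/
theorem gradTerm_add_integral_gradValue (θ : ↥Θ) (x : AugState S Z) :
    ∫ p, M.qValue π m k θ (x, p.1) • π.score Θ θ x p.1 ∂(M.stepKernel π θ x) +
      ∫ y, M.gradValue π m k θ y ∂(M.stateKernel π θ x) =
      M.gradValue π m k θ x + ∫ y, M.gradTerm π m k θ y ∂(m θ : Measure (AugState S Z)) := by
  obtain ⟨C, -, hC⟩ := (Rg.lipFamily_gradTerm k).bdd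
  obtain ⟨D, -, hD⟩ := ((Rg.lipFamily_qValue k).smul Rg.lipFamily_score).bdd
  have h := (Rg.ergodic θ).poisson_sub (hC θ) x
  have e := integral_stepKernel_fst (M := M) (π := π)
    ((hD θ).comp (measurable_const.prodMk measurable_id : Measurable fun a : ↥A => (x, a))) θ x
  change _ = M.gradTerm π m k θ x at e
  change M.gradValue π m k θ x - ∫ y, M.gradValue π m k θ y ∂(M.stateKernel π θ x) = _ at h
  rw [sub_eq_iff_eq_add] at h
  change ∫ p, M.qValue π m k θ (x, p.1) • π.score Θ θ x p.1 ∂(M.stepKernel π θ x) = _ at e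
  rw [e, h]
  abel

/-- Bound for the accumulated squared errors of the value estimates. -/
theorem exists_sum_sqErrF_le (hs : StepSizes μ η) (hB : 0 < B) (b : ℝ) :
    ∃ C G, 0 ≤ C ∧ 0 ≤ G ∧ ∀ (Ω : Type*) [MeasurableSpace Ω] (P : Measure Ω)
      [IsProbabilityMeasure P] (R : Run M π Θ Qnet μ η B P), R.BoundedBy b →
      (∀ i ω, |R.fhat k i ω| ≤ G) ∧ (∀ i, Integrable (R.sqErrF k i) P) ∧
      ∀ N, ∑ i ∈ Finset.range (N + 1), ∫ ω, R.sqErrF k i ω ∂P ≤ C * StepSizes.budget μ η N := by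
  obtain ⟨c, hc⟩ := Rg.problem.cost_bounded
  obtain ⟨C, G, hC0, hG0, hC⟩ := exists_sum_integral_sq_le (Qnet := Qnet) hs Rg.problem.compact_Θ
    hB (Rg.lipFamily_reshapedCost k) (Rg.lipFamily_value k) (Rg.lipFamily_avgCost k)
    (Rg.meanCost_add_integral_value k) b c
  refine ⟨C, G, hC0, hG0, fun Ω _ P _ R hb => ?_⟩
  have hmem := R.θ_mem Rg.problem.convex_Θ hs.μ_pos hs.μ_le_one
  have hb' : ∀ i, Measurable (R.batch hmem (fun (_ : ↥Θ) (p : AugState S Z × ↥A × AugState S Z) =>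
      M.reshapedCost k p.1 p.2.1 p.2.2) i) := fun i => by
    obtain ⟨D, -, hD⟩ := (Rg.lipFamily_reshapedCost k).exists_bddMeas_uncurry
    exact (R.bddMeas_batch hmem hB hD i).meas.measurable
  obtain ⟨h1, h2, h3⟩ := hC Ω P R hmem (R.fhat k) _ (R.measurable_fhat k) hb'
    (fun ω => hb.fhat_init k ω) (fun i ω => norm_batch_le hB fun j _ => hc k _ _ _)
    (fun i ω => R.fhat_succ k i ω)
  have e : ∀ i ω, R.sqErrF k i ω = ‖R.fhat k i ω - M.avgCost π m k (R.param hmem i ω)‖ ^ 2 := by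
    intro i ω
    rw [Real.norm_eq_abs, sq_abs, ← Rg.objective_eq]
    rfl
  refine ⟨h1, fun i => ?_, fun N => ?_⟩
  · rw [funext (e i)]
    simpa only [real_inner_self_eq_norm_sq] using ((h2 i).inner (h2 i)).integrable P
  -- The samples are exactly the batch averages of the costs, so the extra bias terms are zero.
  · have h4 := h3 N
    simp only [sub_self, inner_zero_right, integral_zero, abs_zero, Finset.sum_const_zero,
      add_zero] at h4
    simpa only [e] using h4

end Regularity

namespace Run

variable {Ω : Type*} [mΩ : MeasurableSpace Ω] {P : Measure Ω} [IsProbabilityMeasure P]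
  (R : Run M π Θ Qnet μ η B P)

/-- Gap between the critic and the recentered action value in one slot. -/
theorem integral_abs_critic_sub_le (Rg : Regularity M π Θ lam ρ m)
    (hmem : ∀ i ω, R.θ i ω ∈ Θ) (k : Fin (K + 1)) {T i : ℕ} {C : ℝ} (hC0 : 0 ≤ C)
    (hC : ∀ (θ : ↥Θ) (y : ℝ) (T : ℕ) (x : AugState S Z) (a : ↥A), |M.surrogateQ π θ k y T x a -
      (M.qValue π m k θ (x, a) + T * (M.avgCost π m k θ - y))| ≤ C * ρ ^ T)
    (hfin : R.criticErr k T i ≠ ∞) {t : ℕ} {D : Ω → ℝ} (hD : D = fun ω =>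
      Qnet k (R.w k i ω) (R.s t ω) (R.a t ω) - (M.qValue π m k (R.param hmem i ω)
        (R.s t ω, R.a t ω) + T * (M.avgCost π m k (R.param hmem i ω) - R.fhat k i ω)))
    (hDm : Measurable D) :
    ∫ ω, |D ω| ∂P ≤ (R.criticErr k T i).toReal + C * ρ ^ T := by
  have hρ := Rg.problem.ρ_pos
  have hr : 0 ≤ C * ρ ^ T := by positivity
  have h1 : ∫⁻ ω, ENNReal.ofReal |D ω| ∂P ≤ R.criticErr k T i + ENNReal.ofReal (C * ρ ^ T) := by
    have h2 : ∀ ω, ENNReal.ofReal |D ω| ≤ (⨆ (x : AugState S Z) (a : ↥A), ENNReal.ofReal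
        |Qnet k (R.w k i ω) x a - M.surrogateQ π (R.θ i ω) k (R.fhat k i ω) T x a|) +
        ENNReal.ofReal (C * ρ ^ T) := by
      intro ω
      have h3 := le_iSup₂ (f := fun (x : AugState S Z) (a : ↥A) => ENNReal.ofReal
        |Qnet k (R.w k i ω) x a - M.surrogateQ π (R.θ i ω) k (R.fhat k i ω) T x a|)
        (R.s t ω) (R.a t ω)
      refine le_trans ?_ (add_le_add h3 le_rfl)
      rw [← ENNReal.ofReal_add (abs_nonneg _) hr]
      refine ENNReal.ofReal_le_ofReal ?_
      have h4 := hC (R.param hmem i ω) (R.fhat k i ω) T (R.s t ω) (R.a t ω)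
      rw [hD]
      exact (abs_sub_le _ (M.surrogateQ π (R.θ i ω) k (R.fhat k i ω) T (R.s t ω) (R.a t ω)) _).trans
        (add_le_add le_rfl h4)
    refine (lintegral_mono h2).trans_eq ?_
    -- Measurability is asked of the constant summand only; the supremum over states and actions
    -- need not be measurable.
    rw [lintegral_add_right _ measurable_const]
    simp [criticErr]
  rw [integral_eq_lintegral_of_nonneg_ae (ae_of_all _ fun ω => abs_nonneg _)
    hDm.abs.aestronglyMeasurable]
  refine (ENNReal.toReal_mono (ENNReal.add_ne_top.2 ⟨hfin, ENNReal.ofReal_ne_top⟩) h1).trans_eq ?_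
  rw [ENNReal.toReal_add hfin ENNReal.ofReal_ne_top, ENNReal.toReal_ofReal hr]

/-- The critic error controls the bias of the gradient samples; the baseline introduced by the
estimate of the average cost does not matter, since the score has conditional mean zero. -/
theorem abs_integral_inner_gradSample_sub_le (Rg : Regularity M π Θ lam ρ m)
    (hQnet : ∀ k, Measurable fun p : Euc q × AugState S Z × ↥A => Qnet k p.1 p.2.1 p.2.2)
    (hmem : ∀ i ω, R.θ i ω ∈ Θ) (k : Fin (K + 1)) {T i : ℕ} {C : ℝ} (hC0 : 0 ≤ C)
    (hC : ∀ (θ : ↥Θ) (y : ℝ) (T : ℕ) (x : AugState S Z) (a : ↥A), |M.surrogateQ π θ k y T x a -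
      (M.qValue π m k θ (x, a) + T * (M.avgCost π m k θ - y))| ≤ C * ρ ^ T)
    (hfin : R.criticErr k T i ≠ ∞) {sb : ℝ}
    (hsb : ∀ θ : ↥Θ, BddMeas (fun p : AugState S Z × ↥A => π.score Θ θ p.1 p.2) sb)
    {b Gf : ℝ} (hb : ∀ ω x a, |Qnet k (R.w k i ω) x a| ≤ b) (hGf : ∀ ω, |R.fhat k i ω| ≤ Gf)
    {W : Ω → Euc n} {w : ℝ} (hW : Measurable[R.𝓕 (B * i)] W) (hWb : ∀ ω, ‖W ω‖ ≤ w)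
    {j : ℕ} (hj : j < B) :
    |∫ ω, inner ℝ (W ω) (R.gradSample k i (B * i + j) ω -
        M.qValue π m k (R.param hmem i ω) (R.s (B * i + j) ω, R.a (B * i + j) ω) •
          π.score Θ (R.θ i ω) (R.s (B * i + j) ω) (R.a (B * i + j) ω)) ∂P| ≤
      w * sb * ((R.criticErr k T i).toReal + C * ρ ^ T) := by
  obtain ⟨ω₀⟩ : Nonempty Ω := P.nonempty_of_neZero
  have hw0 : 0 ≤ w := (norm_nonneg _).trans (hWb ω₀)
  have hsb0 : 0 ≤ sb := (norm_nonneg _).trans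
    ((hsb (R.param hmem i ω₀)).bound (R.s 0 ω₀, R.a 0 ω₀))
  obtain ⟨Cq, hCq0, hCq⟩ := (Rg.lipFamily_qValue k).exists_bddMeas_uncurry
  obtain ⟨Cf, hCf0, hCf⟩ := (Rg.lipFamily_avgCost (Y := AugState S Z) k).exists_bddMeas_uncurry
  obtain ⟨L', hL'⟩ := Rg.problem.score_lipschitz
  obtain ⟨L, hL⟩ := Rg.problem.policy_lipschitz
  set t := B * i + j with ht
  have hBt : B * i ≤ t := Nat.le_add_right _ _
  have hlt := slot_lt (i := i) hj
  have ms : Measurable (R.s t) := R.measurable_of_adapted (R.s_measurable t)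
  have ma : Measurable (R.a t) := R.measurable_of_adapted (R.a_measurable t)
  have mp : Measurable (R.param hmem i) := R.measurable_of_adapted (R.measurable_param hmem le_rfl)
  have mf : Measurable[R.𝓕 (B * i)] (R.fhat k i) := R.measurable_fhat k i
  have bscore : BddMeas (fun ω => π.score Θ (R.θ i ω) (R.s t ω) (R.a t ω)) sb :=
    ⟨(R.measurable_of_adapted
      (R.measurable_score Rg.problem.score_measurable hBt hlt)).stronglyMeasurable,
      fun ω => (hsb (R.param hmem i ω)).bound (R.s t ω, R.a t ω)⟩
  have bQ : BddMeas (fun ω => Qnet k (R.w k i ω) (R.s t ω) (R.a t ω)) b :=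
    ⟨((hQnet k).comp ((R.measurable_of_adapted (R.w_measurable k i)).prodMk
      (ms.prodMk ma))).stronglyMeasurable, fun ω => hb ω _ _⟩
  have bq : BddMeas (fun ω => M.qValue π m k (R.param hmem i ω) (R.s t ω, R.a t ω)) Cq :=
    R.bddMeas_eval hmem hCq i (ms.prodMk ma)
  have mbase : Measurable[R.𝓕 (B * i)] fun ω =>
      (T : ℝ) * (M.avgCost π m k (R.param hmem i ω) - R.fhat k i ω) := by
    have h1 : Measurable[R.𝓕 (B * i)] fun ω => M.avgCost π m k (R.param hmem i ω) :=
      hCf.meas.measurable.comp ((R.measurable_param hmem le_rfl).prodMk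
        (R.measurable_s_of_le (Nat.zero_le _)))
    exact (h1.sub mf).const_mul _
  have bbase : BddMeas (fun ω => (T : ℝ) * (M.avgCost π m k (R.param hmem i ω) - R.fhat k i ω))
      (T * (Cf + Gf)) := by
    refine ⟨(R.measurable_of_adapted mbase).stronglyMeasurable, fun ω => ?_⟩
    have h1 : ‖M.avgCost π m k (R.param hmem i ω)‖ ≤ Cf :=
      hCf.bound (R.param hmem i ω, R.s 0 ω)
    rw [norm_mul, Real.norm_natCast]
    exact mul_le_mul_of_nonneg_left ((norm_sub_le _ _).trans (add_le_add h1 (hGf ω)))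
      (Nat.cast_nonneg T)
  have bW : BddMeas W w := ⟨(R.measurable_of_adapted hW).stronglyMeasurable, hWb⟩
  -- `D` compares the network with the action value shifted by the baseline. It may be correlated
  -- with the batch, so only its absolute mean is used.
  obtain ⟨D, hD⟩ : ∃ D : Ω → ℝ, D = fun ω =>
      Qnet k (R.w k i ω) (R.s t ω) (R.a t ω) - (M.qValue π m k (R.param hmem i ω)
        (R.s t ω, R.a t ω) + T * (M.avgCost π m k (R.param hmem i ω) - R.fhat k i ω)) := ⟨_, rfl⟩
  have bD : BddMeas D (b + (Cq + T * (Cf + Gf))) := by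
    rw [hD]; exact bQ.sub (bq.add bbase)
  have hDint := R.integral_abs_critic_sub_le Rg hmem k hC0 hC hfin hD bD.meas.measurable
  -- The baseline is known at the start of the batch and is moved onto `W`. The score has
  -- conditional mean zero, so it drops out however long the horizon and however poor the cost
  -- estimate.
  have hbase : ∫ ω, inner ℝ (((T : ℝ) * (M.avgCost π m k (R.param hmem i ω) - R.fhat k i ω)) • W ω)
      (π.score Θ (R.θ i ω) (R.s t ω) (R.a t ω)) ∂P = 0 := by
    have hG : BddMeas (fun r : (↥Θ × AugState S Z) × ↥A × AugState S Z =>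
        π.score Θ r.1.1 r.1.2 r.2.1) sb :=
      ⟨(Rg.problem.score_measurable.comp
        (f := fun r : (↥Θ × AugState S Z) × ↥A × AugState S Z => ((r.1.1 : Euc n), r.1.2, r.2.1))
        (by fun_prop)).stronglyMeasurable, fun r => (hsb r.1.1).bound (r.1.2, r.2.1)⟩
    have h1 := R.integral_inner_step hmem hj
      ((mbase.smul hW).mono (R.𝓕.mono hBt) le_rfl) (BddMeas.smul bbase bW).bound
      (G := fun θ x p => π.score Θ θ x p.1) hG
    refine h1.trans ?_
    rw [← integral_zero Ω ℝ (μ := P)]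
    refine integral_congr_ae (ae_of_all _ fun ω => ?_)
    have h2 : BddMeas (π.score Θ (R.param hmem i ω) (R.s t ω)) sb :=
      (hsb (R.param hmem i ω)).comp (measurable_const.prodMk measurable_id)
    have h3 : ∫ p, π.score Θ (R.param hmem i ω) (R.s t ω) p.1
        ∂(M.stepKernel π (R.θ i ω) (R.s t ω)) = 0 := by
      rw [Regularity.integral_stepKernel_fst h2]
      exact Policy.integral_score Rg.problem.convex_Θ Rg.problem.interior_Θ
        Rg.problem.policy_differentiable hL hL' (hmem i ω) _ h2
    change inner ℝ _ (∫ p, π.score Θ (R.param hmem i ω) (R.s t ω) p.1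
        ∂(M.stepKernel π (R.θ i ω) (R.s t ω))) = 0
    rw [h3, inner_zero_right]
  have hsplit : ∀ ω, inner ℝ (W ω) (R.gradSample k i t ω -
        M.qValue π m k (R.param hmem i ω) (R.s t ω, R.a t ω) •
          π.score Θ (R.θ i ω) (R.s t ω) (R.a t ω)) =
      inner ℝ (W ω) (D ω • π.score Θ (R.θ i ω) (R.s t ω) (R.a t ω)) +
      inner ℝ (((T : ℝ) * (M.avgCost π m k (R.param hmem i ω) - R.fhat k i ω)) • W ω)
      (π.score Θ (R.θ i ω) (R.s t ω) (R.a t ω)) := by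
    intro ω
    rw [real_inner_smul_left, ← real_inner_smul_right, ← inner_add_right, ← add_smul, hD,
      gradSample, ← sub_smul]
    congr 2
    ring
  simp_rw [hsplit]
  rw [integral_add ((bW.inner (BddMeas.smul bD bscore)).integrable P)
    (((BddMeas.smul bbase bW).inner bscore).integrable P), hbase, add_zero, ← Real.norm_eq_abs]
  have iD : Integrable (fun ω => |D ω|) P := (bD.integrable P).abs
  refine (norm_integral_le_of_norm_le (iD.const_mul (w * sb)) (ae_of_all _ fun ω => ?_)).trans ?_
  · refine (norm_inner_le_norm _ _).trans ?_
    rw [norm_smul, Real.norm_eq_abs]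
    calc ‖W ω‖ * (|D ω| * ‖π.score Θ (R.θ i ω) (R.s t ω) (R.a t ω)‖) ≤ w * (|D ω| * sb) := by
          have h1 := bscore.bound ω
          have h2 := hWb ω
          gcongr
      _ = _ := by ring
  · rw [integral_const_mul]
    exact mul_le_mul_of_nonneg_left hDint (by positivity)

end Run

namespace Regularity

variable (Rg : Regularity M π Θ lam ρ m) (k : Fin (K + 1))
include Rg

/-- The critic errors are finite. -/
theorem criticErr_ne_top {Ω : Type*} [MeasurableSpace Ω] {P : Measure Ω} [IsProbabilityMeasure P]
    (R : Run M π Θ Qnet μ η B P) (hmem : ∀ i ω, R.θ i ω ∈ Θ) {b Gf : ℝ} (hb : R.BoundedBy b)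
    (T i : ℕ) (hGf : ∀ ω, |R.fhat k i ω| ≤ Gf) : R.criticErr k T i ≠ ∞ := by
  obtain ⟨C, hC0, hC⟩ := Rg.exists_abs_surrogateQ_sub_le k
  obtain ⟨Cq, hCq0, hCq⟩ := (Rg.lipFamily_qValue k).exists_bddMeas_uncurry
  obtain ⟨Cf, hCf0, hCf⟩ := (Rg.lipFamily_avgCost (Y := AugState S Z) k).exists_bddMeas_uncurry
  refine ne_top_of_le_ne_top (b := ∫⁻ _, ENNReal.ofReal
    (b + (C * ρ ^ T + (Cq + T * (Cf + Gf)))) ∂P) ?_ (lintegral_mono fun ω =>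
      iSup₂_le fun x a => ENNReal.ofReal_le_ofReal ?_)
  · simp
  have h1 := hb.critic k i ω x a
  have h2 := hC (R.param hmem i ω) (R.fhat k i ω) T x a
  have h3 : |M.qValue π m k (R.param hmem i ω) (x, a)| ≤ Cq :=
    hCq.bound (R.param hmem i ω, (x, a))
  have h4 : |M.avgCost π m k (R.param hmem i ω)| ≤ Cf := hCf.bound (R.param hmem i ω, x)
  have h5 : |(T : ℝ) * (M.avgCost π m k (R.param hmem i ω) - R.fhat k i ω)| ≤ T * (Cf + Gf) := by
    rw [abs_mul, Nat.abs_cast]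
    exact mul_le_mul_of_nonneg_left ((abs_sub _ _).trans (add_le_add h4 (hGf ω)))
      (Nat.cast_nonneg T)
  refine (abs_sub _ _).trans (add_le_add h1 ?_)
  have h6 := abs_add_le (M.surrogateQ π (R.θ i ω) k (R.fhat k i ω) T x a -
    (M.qValue π m k (R.param hmem i ω) (x, a) +
      T * (M.avgCost π m k (R.param hmem i ω) - R.fhat k i ω)))
    (M.qValue π m k (R.param hmem i ω) (x, a) +
      T * (M.avgCost π m k (R.param hmem i ω) - R.fhat k i ω))
  rw [sub_add_cancel] at h6
  exact h6.trans (add_le_add h2 ((abs_add_le _ _).trans (add_le_add h3 h5)))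

/-- Bound for the accumulated squared errors of the gradient estimates. -/
theorem exists_sum_sqErrG_le (hs : StepSizes μ η) (hB : 0 < B)
    (hQnet : ∀ k, Measurable fun p : Euc q × AugState S Z × ↥A => Qnet k p.1 p.2.1 p.2.2)
    (T : ℕ → ℕ) (c : ℝ) (hT : ∀ i, ρ ^ T i ≤ c * η (i + 1)) (b Gf : ℝ) :
    ∃ C, 0 ≤ C ∧ ∀ (Ω : Type*) [MeasurableSpace Ω] (P : Measure Ω)
      [IsProbabilityMeasure P] (R : Run M π Θ Qnet μ η B P), R.BoundedBy b →
      (∀ i ω, |R.fhat k i ω| ≤ Gf) →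
      (∀ i, R.criticErr k (T i) i ≠ ∞) ∧ (∀ i, Integrable (R.sqErrG k i) P) ∧
      ∀ N, ∑ i ∈ Finset.range (N + 1), ∫ ω, R.sqErrG k i ω ∂P ≤
        C * (StepSizes.budget μ η N +
          ∑ i ∈ Finset.range (N + 1), (R.criticErr k (T i) i).toReal) := by
  obtain ⟨sb, hsb0, hsb⟩ := Rg.lipFamily_score.bdd
  obtain ⟨Cs, hCs0, hCs⟩ := Rg.exists_abs_surrogateQ_sub_le k
  obtain ⟨C, G, hC0, hG0, hC⟩ := exists_sum_integral_sq_le (Qnet := Qnet) hs Rg.problem.compact_Θ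
    hB (Rg.lipFamily_qScore k) (Rg.lipFamily_gradValue k) (Rg.lipFamily_mean
      (Rg.lipFamily_gradTerm k)) (Rg.gradTerm_add_integral_gradValue k) b (|b| * sb)
  have hc0 : 0 ≤ c := by
    have h1 := (pow_pos Rg.problem.ρ_pos (T 0)).le.trans (hT 0)
    exact nonneg_of_mul_nonneg_left h1 (hs.η_pos 1)
  -- 2G bounds the gradient error, `sb` the score, and Cs·c the truncation error relative to η.
  refine ⟨C * (1 + 2 * G * sb * (1 + Cs * c)), by positivity, fun Ω _ P _ R hb hGf => ?_⟩
  have hmem := R.θ_mem Rg.problem.convex_Θ hs.μ_pos hs.μ_le_one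
  have hfin : ∀ i, R.criticErr k (T i) i ≠ ∞ := fun i =>
    Rg.criticErr_ne_top k R hmem hb (T i) i (hGf i)
  have hsm := Rg.problem.score_measurable
  have hgs : ∀ i j, j < B → BddMeas (R.gradSample k i (B * i + j)) (|b| * sb) := fun i j hj =>
    ⟨(R.measurable_of_adapted (R.measurable_gradSample hsm hQnet k hj)).stronglyMeasurable,
      fun ω => by
        rw [Run.gradSample, norm_smul]
        exact mul_le_mul ((hb.critic k i ω _ _).trans (le_abs_self b))
          ((hsb (R.param hmem i ω)).bound (_, _)) (norm_nonneg _) (abs_nonneg _)⟩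
  have hgh := R.measurable_ghat hsm hQnet k
  obtain ⟨-, h2, h3⟩ := hC Ω P R hmem (R.ghat k) (fun i ω => (1 / (B : ℝ)) •
      ∑ j ∈ Finset.range B, R.gradSample k i (B * i + j) ω) hgh
    (fun i => (Finset.measurable_fun_sum _ fun j hj =>
      (hgs i j (Finset.mem_range.1 hj)).meas.measurable).const_smul (1 / (B : ℝ)))
    (fun ω => hb.ghat_init k ω)
    (fun i ω => norm_batch_le hB fun j hj => (hgs i j hj).bound ω)
    (fun i ω => R.ghat_succ k i ω)
  have e : ∀ i ω, R.sqErrG k i ω = ‖R.ghat k i ω - ∫ y, M.gradTerm π m k (R.param hmem i ω) y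
      ∂(m (R.param hmem i ω) : Measure (AugState S Z))‖ ^ 2 := by
    intro i ω
    rw [← Rg.gradObjective_eq]
    rfl
  refine ⟨hfin, fun i => ?_, fun N => ?_⟩
  · rw [funext (e i)]
    simpa only [real_inner_self_eq_norm_sq] using ((h2 i).inner (h2 i)).integrable P
  simp only [e]
  refine (h3 N).trans ?_
  rw [mul_assoc]
  refine mul_le_mul_of_nonneg_left ?_ hC0
  have hbias : ∀ i, |∫ ω, inner ℝ (R.ghat k i ω - ∫ y, M.gradTerm π m k (R.param hmem i ω) y
      ∂(m (R.param hmem i ω) : Measure (AugState S Z)))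
      ((1 / (B : ℝ)) • ∑ j ∈ Finset.range B, R.gradSample k i (B * i + j) ω -
        R.batch hmem (fun (θ : ↥Θ) (p : AugState S Z × ↥A × AugState S Z) =>
          M.qValue π m k θ (p.1, p.2.1) • π.score Θ θ p.1 p.2.1) i ω) ∂P| ≤
      2 * G * sb * ((R.criticErr k (T i) i).toReal + Cs * ρ ^ T i) := by
    intro i
    set W : Ω → Euc n := fun ω => R.ghat k i ω - ∫ y, M.gradTerm π m k (R.param hmem i ω) y
      ∂(m (R.param hmem i ω) : Measure (AugState S Z)) with hWdef
    have hW : Measurable[R.𝓕 (B * i)] W := by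
      obtain ⟨Cm, -, hCm⟩ := (Rg.lipFamily_mean (Y := AugState S Z)
        (Rg.lipFamily_gradTerm k)).exists_bddMeas_uncurry
      have h1 : Measurable[R.𝓕 (B * i)] fun ω => ∫ y, M.gradTerm π m k (R.param hmem i ω) y
          ∂(m (R.param hmem i ω) : Measure (AugState S Z)) :=
        hCm.meas.measurable.comp ((R.measurable_param hmem le_rfl).prodMk
          (R.measurable_s_of_le (Nat.zero_le _)))
      exact (hgh i).sub h1
    have hslot : ∀ j, j < B → _ := fun j hj =>
      R.abs_integral_inner_gradSample_sub_le Rg hQnet hmem k hCs0 hCs (hfin i) hsb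
        (hb.critic k i) (hGf i) hW (h2 i).bound hj
    obtain ⟨Cq, -, hCq⟩ := (Rg.lipFamily_qScore k).exists_bddMeas_uncurry
    have bz : ∀ j, j < B → BddMeas (fun ω => R.gradSample k i (B * i + j) ω -
        M.qValue π m k (R.param hmem i ω) (R.s (B * i + j) ω, R.a (B * i + j) ω) •
          π.score Θ (R.θ i ω) (R.s (B * i + j) ω) (R.a (B * i + j) ω)) (|b| * sb + Cq) :=
      fun j hj => (hgs i j hj).sub (R.bddMeas_eval hmem hCq i
        (g := fun ω => (R.s (B * i + j) ω, R.a (B * i + j) ω, R.s (B * i + j + 1) ω))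
        ((R.measurable_of_adapted (R.s_measurable _)).prodMk
          ((R.measurable_of_adapted (R.a_measurable _)).prodMk
            (R.measurable_of_adapted (R.s_measurable _)))))
    have hexp : ∀ ω, inner ℝ (W ω)
        ((1 / (B : ℝ)) • ∑ j ∈ Finset.range B, R.gradSample k i (B * i + j) ω -
          R.batch hmem (fun (θ : ↥Θ) (p : AugState S Z × ↥A × AugState S Z) =>
            M.qValue π m k θ (p.1, p.2.1) • π.score Θ θ p.1 p.2.1) i ω) =
        (1 / (B : ℝ)) • ∑ j ∈ Finset.range B, inner ℝ (W ω) (R.gradSample k i (B * i + j) ω -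
          M.qValue π m k (R.param hmem i ω) (R.s (B * i + j) ω, R.a (B * i + j) ω) •
            π.score Θ (R.θ i ω) (R.s (B * i + j) ω) (R.a (B * i + j) ω)) := by
      intro ω
      rw [Run.batch, ← smul_sub, ← Finset.sum_sub_distrib, real_inner_smul_right, inner_sum,
        smul_eq_mul]
      rfl
    refine (congrArg abs (integral_congr_ae (ae_of_all P hexp))).trans_le ?_
    rw [integral_smul, integral_finsetSum _ fun j hj =>
      ((h2 i).inner (bz j (Finset.mem_range.1 hj))).integrable P, ← Real.norm_eq_abs]
    exact norm_batch_le hB hslot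
  have hsum := Finset.sum_le_sum fun i (_ : i ∈ Finset.range (N + 1)) => (hbias i).trans
    (mul_le_mul_of_nonneg_left (add_le_add le_rfl (mul_le_mul_of_nonneg_left (hT i) hCs0))
      (by positivity : 0 ≤ 2 * G * sb))
  rw [← Finset.mul_sum, Finset.sum_add_distrib, ← Finset.mul_sum, ← Finset.mul_sum] at hsum
  set Sc := ∑ i ∈ Finset.range (N + 1), (R.criticErr k (T i) i).toReal with hSc
  have hSc0 : 0 ≤ Sc := Finset.sum_nonneg fun i _ => ENNReal.toReal_nonneg
  -- The truncation errors ρ^(T i) ≤ c η (i+1) thus add up to a multiple of the budget.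
  have hη : ∑ i ∈ Finset.range (N + 1), η (i + 1) ≤ StepSizes.budget μ η N := by
    rw [StepSizes.budget]
    have h4 := hs.η_pos (N + 1)
    have h5 : 0 ≤ 1 / η (N + 1) := by positivity
    refine le_add_of_nonneg_of_le h5 (Finset.sum_le_sum fun i _ => ?_)
    have h6 := (hs.μ_pos i).le
    have h7 : 0 ≤ μ i ^ 2 / η i ^ 2 := by positivity
    linarith
  have hbud := hs.budget_nonneg N
  have h8 : 2 * G * sb * (Cs * (c * ∑ i ∈ Finset.range (N + 1), η (i + 1))) ≤
      2 * G * sb * (Cs * (c * StepSizes.budget μ η N)) := by gcongr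
  have h9 : 0 ≤ 2 * G * sb * StepSizes.budget μ η N := by positivity
  have h10 : 0 ≤ 2 * G * sb * (Cs * c) * Sc := by positivity
  linarith

end Regularity

end Estimates

end CACRL

end

/-! ### Assembly of the rates and the limits. -/

theorem lemma1
    {nS nZ nA K n q : ℕ}
    {S : Set (CACRL.Euc nS)} {Z : Set (CACRL.Euc nZ)} {A : Set (CACRL.Euc nA)}
    (M : CACRL.CMDP S Z A K) (π : CACRL.Policy S Z A n) (Θ : Set (CACRL.Euc n)) (lam ρ : ℝ)
    (hprob : CACRL.ProblemAssumptions M π Θ lam ρ)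
    (μ η : ℕ → ℝ) (hstep : CACRL.StepSizes μ η)
    (B : ℕ) (hB : 0 < B)
    (Qnet : Fin (K + 1) → CACRL.Euc q → CACRL.AugState S Z → ↥A → ℝ)
    (hQnet : ∀ k, Measurable fun p : CACRL.Euc q × CACRL.AugState S Z × ↥A =>
      Qnet k p.1 p.2.1 p.2.2)
    (T : ℕ → ℕ) (c : ℝ) (hT : ∀ i, ρ ^ T i ≤ c * η (i + 1))
    (b : ℝ) :
    ∃ C : ℝ, 0 < C ∧
      ∀ (Ω : Type*) [MeasurableSpace Ω] (P : Measure Ω) [IsProbabilityMeasure P]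
        (R : CACRL.Run M π Θ Qnet μ η B P), R.BoundedBy b → ∀ k : Fin (K + 1),
        -- all the expectations involved are finite
        (∀ i, Integrable (R.sqErrF k i) P) ∧ (∀ i, Integrable (R.sqErrG k i) P) ∧
        (∀ i, R.criticErr k (T i) i ≠ ∞) ∧
        -- finite-iteration bounds
        (∀ i : ℕ, 1 ≤ i → R.epsF k i ≤
          C * (1 / ((1 + (i : ℝ)) * η (i + 1))) +
          C * ((1 / (1 + (i : ℝ))) * ∑ j ∈ Finset.range (i + 1),
            (μ j * Real.log i ^ 2 + μ j ^ 2 / η (j + 1) ^ 2 + μ j ^ 2 / η (j + 1)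
              + η (j + 1) * Real.log i))) ∧
        (∀ i : ℕ, 1 ≤ i → R.epsG k i ≤
          C * (1 / ((1 + (i : ℝ)) * η (i + 1))) +
          C * ((1 / (1 + (i : ℝ))) * ∑ j ∈ Finset.range (i + 1),
            (μ j * Real.log i ^ 2 + μ j ^ 2 / η (j + 1) ^ 2 + μ j ^ 2 / η (j + 1)
              + η (j + 1))) +
          C * R.epsQ k T i + Real.sqrt (R.epsF k i)) ∧
        -- asymptotics
        Tendsto (fun i => R.epsF k i) atTop (𝓝 0) ∧
        (∀ ε : ℝ, 0 < ε → ∀ᶠ i in atTop, R.epsG k i ≤ C * R.epsQ k T i + ε) := by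
  obtain ⟨m, Rg⟩ := hprob.exists_regularity
  choose C₁ G hC₁0 hG0 hF using fun k => Rg.exists_sum_sqErrF_le (Qnet := Qnet) k hstep hB b
  choose C₂ hC₂0 hGr using fun k =>
    Rg.exists_sum_sqErrG_le k hstep hB hQnet T c hT b (G k)
  have hη0 := hstep.η_pos 0
  -- One constant for all cost functions at once and for both estimates.
  set D := ∑ k, (C₁ k + C₂ k) with hD
  have hD0 : 0 ≤ D := Finset.sum_nonneg fun k _ => add_nonneg (hC₁0 k) (hC₂0 k)
  have hD₁ : ∀ k, C₁ k ≤ D ∧ C₂ k ≤ D := fun k => by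
    have h := Finset.single_le_sum (f := fun k => C₁ k + C₂ k)
      (fun k _ => add_nonneg (hC₁0 k) (hC₂0 k)) (Finset.mem_univ k)
    exact ⟨(le_add_of_nonneg_right (hC₂0 k)).trans h, (le_add_of_nonneg_left (hC₁0 k)).trans h⟩
  set s := 1 + 3 * (1 + η 0) * η 0 with hs
  have hs1 : 1 ≤ s := by
    have : 0 ≤ 3 * (1 + η 0) * η 0 := by positivity
    linarith
  refine ⟨(D + 1) * s, by positivity, ?_⟩
  intro Ω _ P _ R hb k
  obtain ⟨hf, hFi, hFs⟩ := hF k Ω P R hb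
  obtain ⟨hcr, hGi, hGs⟩ := hGr k Ω P R hb hf
  have hbud : ∀ N : ℕ, 0 ≤ 1 / (1 + (N : ℝ)) * CACRL.StepSizes.budget μ η N := fun N =>
    mul_nonneg (by positivity) (hstep.budget_nonneg N)
  have hQ0 : ∀ N, 0 ≤ R.epsQ k T N := fun N =>
    mul_nonneg (by positivity) (Finset.sum_nonneg fun i _ => ENNReal.toReal_nonneg)
  have hF0 : ∀ N, 0 ≤ R.epsF k N := fun N =>
    mul_nonneg (by positivity) (Finset.sum_nonneg fun i _ => integral_nonneg fun ω => sq_nonneg _)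
  have hFle : ∀ N : ℕ, R.epsF k N ≤ D * (1 / (1 + (N : ℝ)) * CACRL.StepSizes.budget μ η N) := by
    intro N
    calc R.epsF k N ≤ 1 / (1 + (N : ℝ)) * (C₁ k * CACRL.StepSizes.budget μ η N) :=
          mul_le_mul_of_nonneg_left (hFs N) (by positivity)
      _ = C₁ k * (1 / (1 + (N : ℝ)) * CACRL.StepSizes.budget μ η N) := by ring
      _ ≤ _ := mul_le_mul_of_nonneg_right (hD₁ k).1 (hbud N)
  have hGle : ∀ N : ℕ, R.epsG k N ≤
      D * (1 / (1 + (N : ℝ)) * CACRL.StepSizes.budget μ η N) + D * R.epsQ k T N := by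
    intro N
    calc R.epsG k N ≤ 1 / (1 + (N : ℝ)) * (C₂ k * (CACRL.StepSizes.budget μ η N +
          ∑ i ∈ Finset.range (N + 1), (R.criticErr k (T i) i).toReal)) :=
          mul_le_mul_of_nonneg_left (hGs N) (by positivity)
      _ = C₂ k * (1 / (1 + (N : ℝ)) * CACRL.StepSizes.budget μ η N + R.epsQ k T N) := by
          rw [CACRL.Run.epsQ]; ring
      _ ≤ D * (1 / (1 + (N : ℝ)) * CACRL.StepSizes.budget μ η N + R.epsQ k T N) :=
          mul_le_mul_of_nonneg_right (hD₁ k).2 (add_nonneg (hbud N) (hQ0 N))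
      _ = _ := by ring
  have hQle : ∀ N, D * R.epsQ k T N ≤ (D + 1) * s * R.epsQ k T N := fun N =>
    mul_le_mul_of_nonneg_right (by nlinarith) (hQ0 N)
  -- The threshold 3 comes from e < 3; beyond it the logarithmic factors only weaken the bound.
  have hlog : ∀ N : ℕ, 3 ≤ N → 1 ≤ Real.log N := fun N hN => by
    rw [Real.le_log_iff_exp_le (by positivity)]
    exact Real.exp_one_lt_three.le.trans (by exact_mod_cast hN)
  have hrate : ∀ (N : ℕ) (c₁ c₂ : ℝ), 0 ≤ c₁ → 0 ≤ c₂ → (3 ≤ N → 1 ≤ c₁ ∧ 1 ≤ c₂) →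
      D * (1 / (1 + (N : ℝ)) * CACRL.StepSizes.budget μ η N) ≤
        (D + 1) * s * (1 / ((1 + (N : ℝ)) * η (N + 1))) +
        (D + 1) * s * ((1 / (1 + (N : ℝ))) * ∑ j ∈ Finset.range (N + 1),
          (μ j * c₁ + μ j ^ 2 / η (j + 1) ^ 2 + μ j ^ 2 / η (j + 1) + η (j + 1) * c₂)) := by
    intro N c₁ c₂ h₁ h₂ h
    have h3 := hstep.budget_le h₁ h₂ h
    calc _ ≤ (D + 1) * (1 / (1 + (N : ℝ)) * CACRL.StepSizes.budget μ η N) :=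
          mul_le_mul_of_nonneg_right (by linarith) (hbud N)
      _ ≤ (D + 1) * _ := mul_le_mul_of_nonneg_left h3 (by positivity)
      _ = _ := by ring
  have htend : Tendsto (fun N : ℕ => D * (1 / (1 + (N : ℝ)) * CACRL.StepSizes.budget μ η N)) atTop
      (𝓝 0) := by
    simpa using hstep.tendsto_budget.const_mul D
  refine ⟨hFi, hGi, hcr, fun i hi => ?_, fun i hi => ?_, ?_, fun ε hε => ?_⟩
  · have h0 : 0 ≤ Real.log i := Real.log_nonneg (by exact_mod_cast hi)
    exact (hFle i).trans (hrate i _ _ (by positivity) h0 fun h =>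
      ⟨one_le_pow₀ (hlog i h), hlog i h⟩)
  · have h1 := hrate i (Real.log i ^ 2) 1 (by positivity) zero_le_one fun h =>
      ⟨one_le_pow₀ (hlog i h), le_rfl⟩
    simp only [mul_one] at h1
    have h2 := hGle i
    have h3 := hQle i
    -- The square root is slack: it is added on the right because it is nonnegative.
    have h4 := Real.sqrt_nonneg (R.epsF k i)
    linarith
  · exact squeeze_zero hF0 hFle htend
  · filter_upwards [htend.eventually (ge_mem_nhds hε)] with N hN
    have h2 := hGle N
    have h3 := hQle N
    linarith
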